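/- Let $F$ be the free group of rank $2$ with basis $x_1,x_2$, with lower central series $F_1=F$, $F_{k+1}=[F_k,F]$, and let $\hat F=\varprojlim F/F_k$ be its pronilpotent completion (limit topology of discrete groups), with closed lower central series $\hat F_1=\hat F$, $\hat F_{k+1}=\overline{[\hat F_k,\hat F]}$. Let $B$ be the group of continuous automorphisms of $\hat F$ (with continuous inverse), $B_k$ the kernel of $B\to\mathrm{Aut}(\hat F/\hat F_{k+1})$, and for $n\ge 1$ put $\mathcal J_n=\hat F_n/\hat F_{n+1}$ and $\mathcal M_n=B_n/B_{n+1}$. The group $B$ acts on $\mathcal J_n$ naturally and on $\mathcal M_n$ by conjugation. On each of $\mathcal J_n\otimes\mathbb Q$ and $\mathcal M_n\otimes\mathbb Q$ there is an algebraic representation of $GL_2(\mathbb Q)$ of degree $n$ in which every $\varphi\in B$ acts through the element of $GL_2(\mathbb Z)$ that it induces on $\hat F/\hat F_2=\mathbb Z^2$. (Algebraic of degree $n$: for some $k\ge0$, after tensoring with $\det^k$ the matrix coefficients are homogeneous polynomials of degree $n+2k$ in the matrix entries.) For integers $a\ge b\ge0$ let $(a,b)$ denote the irreducible representation $\mathrm{Sym}^{a-b}(\mathbb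 Q^2)\otimes\det^{b}$ of $GL_2(\mathbb Q)$, i.e. the one with Young diagram with rows of lengths $a,b$. Define, for integers $a,b$ with $a+b>0$, \[\theta(a,b)=\frac1{a+b}\sum_{d\mid\gcd(a,b)}\mu(d)\binom{(a+b)/d}{a/d},\] where $\binom mk=0$ unless $0\le k\le m$. Then for every $n\ge1$ and every such representation on $\mathcal J_n\otimes\mathbb Q$, respectively $\mathcal M_n\otimes\mathbb Q$, the representation is finite-dimensional and semisimple, and the following hold. 1. For $a\ge b\ge 0$ with $a+b=n$, the multiplicity of $(a,b)$ in $\mathcal J_n\otimes\mathbb Q$ is $\theta(a,b)-\theta(a+1,b-1)$. 2. The total number of irreducible summands of $\mathcal J_n\otimes\mathbb Q$, counted with multiplicity, is $\theta(n/2,n/2)$ if $n$ is even, and $\theta\left(\frac{n+1}2,\frac{n-1}2\right)=\frac1n\binom n{(n-1)/2}$ if $n$ is odd. 3. For $a\ge b\ge 0$ with $a+b=n$, the multiplicity of $(a,b)$ in $\mathcal M_n\otimes\mathbb Q$ is $\theta(a,b+1)-\theta(a+2,b-1)$. 4. The total number of irreducible summands of $\mathcal M_n\otimes\mathbb Q$,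 counted with multiplicity, is $2\,\theta\left(\frac n2+1,\frac n2\right)$ if $n$ is even, and $\theta\left(\frac{n+1}2,\frac{n+1}2\right)+\theta\left(\frac{n+3}2,\frac{n-1}2\right)$ if $n$ is odd. -/

import Mathlib

open scoped TensorProduct commutatorElement

noncomputable section

namespace PronilpotentFree

/-! ### The pronilpotent completion of a free group -/

/-- `F / F_{n+1}`, where `F` is free of rank `r` and `F_1 = F`, `F_{k+1} = [F_k, F]`
(Mathlib numbers the lower central series from `0`). -/
abbrev NilQuot (r n : ℕ) : Type :=
  FreeGroup (Fin r) ⧸ (⊤ : Subgroup (FreeGroup (Fin r))).lowerCentralSeries n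

/-- The projection `F / F_{n+1} → F / F_{m+1}` for `m ≤ n`. -/
def nilProj (r : ℕ) {m n : ℕ} (h : m ≤ n) : NilQuot r n →* NilQuot r m :=
  QuotientGroup.map _ _ (MonoidHom.id _) (Subgroup.lowerCentralSeries_antitone _ h)

/-- The inverse limit of the groups `F / F_{n+1}`, as a subgroup of their product. -/
def limitSubgroup (r : ℕ) : Subgroup (∀ n, NilQuot r n) where
  carrier := {x | ∀ (m n : ℕ) (h : m ≤ n), nilProj r h (x n) = x m}
  mul_mem' := by
    intro x y hx hy m n h
    simp [hx m n h, hy m n h]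
  one_mem' := by
    intro m n h
    simp
  inv_mem' := by
    intro x hx m n h
    simp [hx m n h]

/-- The pronilpotent completion `F̂` of the free group `F` of rank `r`. -/
def Completion (r : ℕ) : Type := limitSubgroup r

instance (r : ℕ) : Group (Completion r) := inferInstanceAs (Group (limitSubgroup r))

/-- The component `F̂ → F / F_{n+1}`. -/
def component (r n : ℕ) : Completion r →* NilQuot r n :=
  (Pi.evalMonoidHom (fun n => NilQuot r n) n).comp (limitSubgroup r).subtype

/-- The limit topology, all the groups `F / F_{n+1}` being discrete. -/
instance (r : ℕ) : TopologicalSpace (Completion r) :=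
  ⨅ n, TopologicalSpace.induced (component r n) ⊥

instance (r : ℕ) : IsTopologicalGroup (Completion r) := by
  refine topologicalGroup_iInf fun n => ?_
  let : TopologicalSpace (NilQuot r n) := ⊥
  have : DiscreteTopology (NilQuot r n) := ⟨rfl⟩
  exact topologicalGroup_induced (component r n)

/-- The natural map `F → F̂`. -/
def toCompletion (r : ℕ) : FreeGroup (Fin r) →* Completion r where
  toFun w := ⟨fun n => (w : NilQuot r n), fun _ _ _ => rfl⟩
  map_one' := rfl
  map_mul' _ _ := rfl

/-- The images `x_i ∈ F̂` of the basis elements of `F`. -/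
def gen (r : ℕ) (i : Fin r) : Completion r := toCompletion r (FreeGroup.of i)

/-- The closed lower central series: `F̂_1 = F̂` and `F̂_{n+1}` is the closure of `[F̂_n, F̂]`
(with `F̂_0 = F̂` as a convention). -/
def series (r : ℕ) : ℕ → Subgroup (Completion r)
  | 0 => ⊤
  | 1 => ⊤
  | n + 2 => (⁅series r (n + 1), (⊤ : Subgroup (Completion r))⁆).topologicalClosure

instance series_normal (r : ℕ) : ∀ n, (series r n).Normal
  | 0 => inferInstanceAs (⊤ : Subgroup (Completion r)).Normal
  | 1 => inferInstanceAs (⊤ : Subgroup (Completion r)).Normal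
  | n + 2 => by
    have := series_normal r (n + 1)
    exact Subgroup.is_normal_topologicalClosure _

theorem isClosed_series (r : ℕ) : ∀ n, IsClosed (series r n : Set (Completion r))
  | 0 => isClosed_univ
  | 1 => isClosed_univ
  | _ + 2 => Subgroup.isClosed_topologicalClosure _

theorem commutator_series_le (r : ℕ) : ∀ n,
    ⁅series r n, (⊤ : Subgroup (Completion r))⁆ ≤ series r (n + 1)
  | 0 => le_top
  | _ + 1 => Subgroup.le_topologicalClosure _

/-! ### The Lie ring of `F̂` and the automorphisms of `F̂` -/

/-- The homogeneous component `J_n = F̂_n / F̂_{n+1}`. -/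
abbrev J (r n : ℕ) : Type := series r n ⧸ (series r (n + 1)).subgroupOf (series r n)

instance (r n : ℕ) : CommGroup (J r n) :=
  { (inferInstance : Group (J r n)) with
    mul_comm := by
      rintro ⟨x⟩ ⟨y⟩
      refine QuotientGroup.eq.2 ?_
      have h := commutator_series_le r n (Subgroup.commutator_mem_commutator
        ((series r n).inv_mem y.2) (Subgroup.mem_top (x⁻¹ : Completion r)))
      rw [Subgroup.mem_subgroupOf]
      simpa [commutatorElement_def, mul_assoc] using h }

/-- The group `B` of continuous automorphisms of `F̂` (with continuous inverse); the product is
composition, `(φ * ψ) x = φ (ψ x)`. -/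
def B (r : ℕ) : Subgroup (MulAut (Completion r)) where
  carrier := {φ | Continuous φ ∧ Continuous φ.symm}
  mul_mem' := fun hx hy => ⟨hx.1.comp hy.1, hy.2.comp hx.2⟩
  one_mem' := ⟨continuous_id, continuous_id⟩
  inv_mem' := fun hx => ⟨hx.2, hx.1⟩

/-- `B_n`, the subgroup of all `φ ∈ B` that act trivially on `F̂ / F̂_{n+1}`. -/
def BFilt (r n : ℕ) : Subgroup (B r) where
  carrier := {φ | ∀ x : Completion r,
    (QuotientGroup.mk (φ.1 x) : Completion r ⧸ series r (n + 1)) = QuotientGroup.mk x}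
  mul_mem' := fun {φ ψ} hφ hψ x => (hφ (ψ.1 x)).trans (hψ x)
  one_mem' := fun _ => rfl
  inv_mem' := fun {φ} hφ x => by
    have h := hφ (φ.1⁻¹ x)
    rw [MulAut.apply_inv_self] at h
    exact h.symm

theorem apply_mem_series {r : ℕ} (φ : B r) : ∀ (n : ℕ) {x : Completion r},
    x ∈ series r n → φ.1 x ∈ series r n
  | 0, _, _ => Subgroup.mem_top _
  | 1, _, _ => Subgroup.mem_top _
  | n + 2, x, hx => by
    have hle : ⁅series r (n + 1), (⊤ : Subgroup (Completion r))⁆ ≤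
        (series r (n + 2)).comap φ.1.toMonoidHom := by
      rw [Subgroup.commutator_le]
      intro a ha b _
      have := commutator_series_le r (n + 1) (Subgroup.commutator_mem_commutator
        (apply_mem_series φ (n + 1) ha) (Subgroup.mem_top (φ.1 b)))
      simpa [Subgroup.mem_comap, map_commutatorElement] using this
    exact Subgroup.topologicalClosure_minimal _ hle
      ((isClosed_series r (n + 2)).preimage φ.2.1) hx

theorem series_commutator_two_le (r n : ℕ) :
    ⁅series r n, series r 2⁆ ≤ series r (n + 2) := by
  have key : ⁅⁅(⊤ : Subgroup (Completion r)), (⊤ : Subgroup (Completion r))⁆, series r n⁆ ≤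
      series r (n + 2) := by
    have h1 : ⁅⁅series r n, (⊤ : Subgroup (Completion r))⁆, ⊤⁆ ≤ series r (n + 2) :=
      (Subgroup.commutator_mono (commutator_series_le r n) le_rfl).trans
        (commutator_series_le r (n + 1))
    have h2 : ⁅⁅(⊤ : Subgroup (Completion r)), series r n⁆, ⊤⁆ ≤ series r (n + 2) := by
      rwa [Subgroup.commutator_comm (⊤ : Subgroup (Completion r)) (series r n)]
    have hq : ∀ H : Subgroup (Completion r), H ≤ series r (n + 2) ↔
        H.map (QuotientGroup.mk' (series r (n + 2))) = ⊥ := by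
      intro H
      rw [Subgroup.map_eq_bot_iff, QuotientGroup.ker_mk']
    rw [hq, Subgroup.map_commutator, Subgroup.map_commutator] at h1 h2 ⊢
    exact Subgroup.commutator_commutator_eq_bot_of_rotate h2 h1
  rw [Subgroup.commutator_le]
  intro a ha y hy
  have hle : ⁅series r 1, (⊤ : Subgroup (Completion r))⁆ ≤
      (Subgroup.centralizer {(QuotientGroup.mk a : Completion r ⧸ series r (n + 2))}).comap
        (QuotientGroup.mk' (series r (n + 2))) := by
    intro z hz
    rw [Subgroup.mem_comap, Subgroup.mem_centralizer_singleton_iff]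
    have h := key (Subgroup.commutator_mem_commutator hz ha)
    rw [← QuotientGroup.eq_one_iff] at h
    have h' : ⁅(QuotientGroup.mk' (series r (n + 2))) z,
        (QuotientGroup.mk' (series r (n + 2))) a⁆ = 1 := by
      rw [← map_commutatorElement]; exact h
    exact (commutatorElement_eq_one_iff_mul_comm.1 h')
  have hset : ∀ z : Completion r, z ∈
      (Subgroup.centralizer {(QuotientGroup.mk a : Completion r ⧸ series r (n + 2))}).comap
        (QuotientGroup.mk' (series r (n + 2))) ↔ ⁅a, z⁆ ∈ series r (n + 2) := by
    intro z
    rw [Subgroup.mem_comap, Subgroup.mem_centralizer_singleton_iff, ← QuotientGroup.eq_one_iff]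
    change _ ↔ QuotientGroup.mk' (series r (n + 2)) ⁅a, z⁆ = 1
    rw [map_commutatorElement, commutatorElement_eq_one_iff_mul_comm]
    exact eq_comm
  have hcl : IsClosed ((Subgroup.comap (QuotientGroup.mk' (series r (n + 2)))
      (Subgroup.centralizer {(QuotientGroup.mk a : Completion r ⧸ series r (n + 2))}) :
        Subgroup (Completion r)) : Set (Completion r)) := by
    have : ((Subgroup.comap (QuotientGroup.mk' (series r (n + 2)))
      (Subgroup.centralizer {(QuotientGroup.mk a : Completion r ⧸ series r (n + 2))}) :
        Subgroup (Completion r)) : Set (Completion r)) =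
        (fun z => ⁅a, z⁆) ⁻¹' (series r (n + 2) : Set (Completion r)) := by
      ext z; exact hset z
    rw [this]
    refine (isClosed_series r (n + 2)).preimage ?_
    simp only [commutatorElement_def]
    fun_prop
  exact (hset y).1 (Subgroup.topologicalClosure_minimal _ hle hcl hy)

/-- An automorphism acting trivially on `F̂ / F̂_2` acts trivially on every `F̂_n / F̂_{n+1}`. -/
theorem mk_apply_eq {r : ℕ} {φ : B r} (hφ : φ ∈ BFilt r 1) : ∀ (n : ℕ) {x : Completion r},
    x ∈ series r n →
      (QuotientGroup.mk (φ.1 x) : Completion r ⧸ series r (n + 1)) = QuotientGroup.mk x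
  | 0, _, _ => QuotientGroup.eq.2 (Subgroup.mem_top _)
  | 1, x, _ => hφ x
  | n + 2, x, hx => by
    let π := QuotientGroup.mk' (series r (n + 3))
    have hle : ⁅series r (n + 1), (⊤ : Subgroup (Completion r))⁆ ≤
        MonoidHom.eqLocus (π.comp φ.1.toMonoidHom) π := by
      rw [Subgroup.commutator_le]
      intro a ha b _
      change π (φ.1 ⁅a, b⁆) = π ⁅a, b⁆
      have h1 := QuotientGroup.eq.1 (mk_apply_eq hφ (n + 1) ha).symm
      have h2 := QuotientGroup.eq.1 (hφ b).symm
      have ea : φ.1 a = a * (a⁻¹ * φ.1 a) := by group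
      have eb : φ.1 b = b * (b⁻¹ * φ.1 b) := by group
      generalize a⁻¹ * φ.1 a = α at h1 ea
      generalize b⁻¹ * φ.1 b = β at h2 eb
      have c1 : ∀ g, Commute (π α) (π g) := by
        intro g
        have := commutator_series_le r (n + 2) (Subgroup.commutator_mem_commutator h1
          (Subgroup.mem_top g))
        rw [← QuotientGroup.eq_one_iff] at this
        change π ⁅α, g⁆ = 1 at this
        rwa [map_commutatorElement, commutatorElement_eq_one_iff_mul_comm] at this
      have c2 : Commute (π a) (π β) := by
        have := series_commutator_two_le r (n + 1) (Subgroup.commutator_mem_commutator ha h2)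
        rw [← QuotientGroup.eq_one_iff] at this
        change π ⁅a, β⁆ = 1 at this
        rwa [map_commutatorElement, commutatorElement_eq_one_iff_mul_comm] at this
      rw [map_commutatorElement, map_commutatorElement, map_commutatorElement, ea, eb]
      simp only [map_mul, commutatorElement_def, mul_inv_rev]
      have e1 := (c1 b).eq
      have e2 := (c1 β).eq
      have e3 := (c2.inv_left).eq
      calc π a * π α * (π b * π β) * ((π α)⁻¹ * (π a)⁻¹) * ((π β)⁻¹ * (π b)⁻¹)
          = π a * (π α * π b) * π β * (π α)⁻¹ * (π a)⁻¹ * (π β)⁻¹ * (π b)⁻¹ := by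
            simp only [mul_assoc]
        _ = π a * π b * (π α * π β) * (π α)⁻¹ * (π a)⁻¹ * (π β)⁻¹ * (π b)⁻¹ := by
            rw [e1]; simp only [mul_assoc]
        _ = π a * π b * (π β * (π a)⁻¹) * (π β)⁻¹ * (π b)⁻¹ := by
            rw [e2]; simp only [mul_assoc, mul_inv_cancel_left]
        _ = π a * π b * (π a)⁻¹ * (π b)⁻¹ := by
            rw [← e3]; simp only [mul_assoc, mul_inv_cancel_left]
    have hcl : IsClosed ((MonoidHom.eqLocus (π.comp φ.1.toMonoidHom) π :
        Subgroup (Completion r)) : Set (Completion r)) := by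
      have : ((MonoidHom.eqLocus (π.comp φ.1.toMonoidHom) π :
          Subgroup (Completion r)) : Set (Completion r)) =
          (fun z => (φ.1 z)⁻¹ * z) ⁻¹' (series r (n + 3) : Set (Completion r)) := by
        ext z
        exact QuotientGroup.eq
      rw [this]
      refine (isClosed_series r (n + 3)).preimage ?_
      have := φ.2.1
      fun_prop
    exact Subgroup.topologicalClosure_minimal _ hle hcl hx

theorem series_succ_le (r : ℕ) (n : ℕ) : series r (n + 1) ≤ series r n :=
  match n with
  | 0 => le_top
  | 1 => le_top
  | n + 2 => Subgroup.topologicalClosure_minimal _ (Subgroup.commutator_le_left _ _)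
      (isClosed_series r (n + 2))

theorem series_antitone (r : ℕ) : Antitone (series r) :=
  antitone_nat_of_succ_le (series_succ_le r)

instance BFilt_normal (r n : ℕ) : (BFilt r n).Normal where
  conj_mem φ hφ μ x := by
    have h := QuotientGroup.eq.1 (hφ (μ.1⁻¹ x))
    refine QuotientGroup.eq.2 ?_
    have h' := apply_mem_series μ (n + 1) h
    simpa using h'

/-- The homogeneous component `M_n = B_n / B_{n+1}`. -/
abbrev M (r n : ℕ) : Type := BFilt r n ⧸ (BFilt r (n + 1)).subgroupOf (BFilt r n)

instance (r n : ℕ) [NeZero n] : CommGroup (M r n) :=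
  { (inferInstance : Group (M r n)) with
    mul_comm := by
      rintro ⟨φ, hφ⟩ ⟨ψ, hψ⟩
      have hn : 1 ≤ n := NeZero.one_le
      have hB : BFilt r n ≤ BFilt r 1 := by
        intro χ hχ x
        exact QuotientGroup.eq.2 (series_antitone r (by omega) (QuotientGroup.eq.1 (hχ x)))
      have key : ∀ x, (QuotientGroup.mk (φ.1 (ψ.1 x)) : Completion r ⧸ series r (n + 2)) =
          QuotientGroup.mk (ψ.1 (φ.1 x)) := by
        intro x
        let π := QuotientGroup.mk' (series r (n + 2))
        change π (φ.1 (ψ.1 x)) = π (ψ.1 (φ.1 x))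
        have h1 := QuotientGroup.eq.1 (hφ x).symm
        have h2 := QuotientGroup.eq.1 (hψ x).symm
        have ea : φ.1 x = x * (x⁻¹ * φ.1 x) := by group
        have eb : ψ.1 x = x * (x⁻¹ * ψ.1 x) := by group
        generalize x⁻¹ * φ.1 x = f at h1 ea
        generalize x⁻¹ * ψ.1 x = g at h2 eb
        have k1 : π (φ.1 g) = π g := mk_apply_eq (hB hφ) (n + 1) h2
        have k2 : π (ψ.1 f) = π f := mk_apply_eq (hB hψ) (n + 1) h1
        have c : Commute (π f) (π g) := by
          have := commutator_series_le r (n + 1) (Subgroup.commutator_mem_commutator h1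
            (Subgroup.mem_top g))
          rw [← QuotientGroup.eq_one_iff] at this
          change π ⁅f, g⁆ = 1 at this
          rwa [map_commutatorElement, commutatorElement_eq_one_iff_mul_comm] at this
        calc π (φ.1 (ψ.1 x)) = π x * π f * π g := by rw [eb, map_mul, ea]; simp [k1]
          _ = π x * π g * π f := by rw [mul_assoc, c.eq, mul_assoc]
          _ = π (ψ.1 (φ.1 x)) := by rw [ea, map_mul, eb]; simp [k2]
      refine QuotientGroup.eq.2 ?_
      rw [Subgroup.mem_subgroupOf]
      intro x
      have h := apply_mem_series (φ * ψ)⁻¹ (n + 2) (QuotientGroup.eq.1 (key x))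
      refine (QuotientGroup.eq.2 ?_).symm
      have e : x⁻¹ * (((φ * ψ)⁻¹ * (ψ * φ)).1 x) =
          (φ * ψ)⁻¹.1 ((φ.1 (ψ.1 x))⁻¹ * ψ.1 (φ.1 x)) := by
        rw [map_mul, map_inv]
        change _ = ((φ.1 * ψ.1)⁻¹ ((φ.1 * ψ.1) x))⁻¹ * _
        rw [MulAut.inv_apply_self]
        rfl
      rw [← e] at h
      exact h }

/-- The action of `B` on `J_n`, `x F̂_{n+1} ↦ φ(x) F̂_{n+1}`. -/
def actJ (r n : ℕ) (φ : B r) : J r n →* J r n :=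
  QuotientGroup.map _ _
    ((φ.1.toMonoidHom.comp (series r n).subtype).codRestrict (series r n)
      fun x => apply_mem_series φ n x.2)
    fun _ hx => apply_mem_series φ (n + 1) hx

/-- The conjugation action of `B` on `M_n`, `ψ B_{n+1} ↦ φ ψ φ⁻¹ B_{n+1}`. -/
def actM (r n : ℕ) (φ : B r) : M r n →* M r n :=
  QuotientGroup.map _ _
    (((MulAut.conj φ).toMonoidHom.comp (BFilt r n).subtype).codRestrict (BFilt r n)
      fun x => (BFilt_normal r n).conj_mem x.1 x.2 φ)
    fun x hx => (BFilt_normal r (n + 1)).conj_mem x.1 hx φ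

/-- `φ ∈ B` induces `g ∈ GL_r(ℤ)` on `F̂ / F̂_2 = ℤ^r` (columns are the images of the basis):
`φ(x_j) ≡ x_1^{g_{1j}} ⋯ x_r^{g_{rj}}` modulo `F̂_2`. -/
def Induces (r : ℕ) (φ : B r) (g : GL (Fin r) ℤ) : Prop :=
  ∀ j, (QuotientGroup.mk (φ.1 (gen r j)) : Completion r ⧸ series r 2) =
    QuotientGroup.mk (List.ofFn fun i => gen r i ^ (g.1 i j)).prod

/-! ### Representations of `GL_r(ℚ)` -/

/-- A representation of `GL_r(ℚ)` is algebraic of degree `n` if after tensoring with some power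
`det^k` its matrix coefficients are homogeneous polynomials of degree `n + r k` in the matrix
entries. -/
def IsAlgebraicOfDegree {r : ℕ} {V : Type*} [AddCommGroup V] [Module ℚ V]
    (ρ : Representation ℚ (GL (Fin r) ℚ) V) (n : ℕ) : Prop :=
  ∃ k : ℕ, ∀ (v : V) (l : Module.Dual ℚ V),
    ∃ P : MvPolynomial (Fin r × Fin r) ℚ, P.IsHomogeneous (n + r * k) ∧
      ∀ g : GL (Fin r) ℚ, g.1.det ^ k * l (ρ g v) = MvPolynomial.eval (fun p => g.1 p.1 p.2) P

/-- Let `B` act on the abelian group `A` by `act`. A representation of `GL_r(ℚ)` on `ℚ ⊗ A` is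
its rational form of degree `n` if it is algebraic of degree `n`, and if every `φ ∈ B` acts on
`ℚ ⊗ A` as the element of `GL_r(ℤ) ⊆ GL_r(ℚ)` that it induces. -/
structure IsRationalForm {r : ℕ} {A : Type*} [CommGroup A] (act : B r → A →* A) (n : ℕ)
    (ρ : Representation ℚ (GL (Fin r) ℚ) (ℚ ⊗[ℤ] Additive A)) : Prop where
  algebraic : IsAlgebraicOfDegree ρ n
  extends_act : ∀ (φ : B r) (g : GL (Fin r) ℤ), Induces r φ g → ∀ (q : ℚ) (x : A),
    ρ (Matrix.GeneralLinearGroup.map (Int.castRingHom ℚ) g) (q ⊗ₜ Additive.ofMul x) =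
      q ⊗ₜ Additive.ofMul (act φ x)

/-- The linear substitution `X_j ↦ ∑_i g_{ij} X_i`. -/
def subst (g : Matrix (Fin 2) (Fin 2) ℚ) :
    MvPolynomial (Fin 2) ℚ →ₐ[ℚ] MvPolynomial (Fin 2) ℚ :=
  MvPolynomial.aeval fun j => ∑ i, MvPolynomial.C (g i j) * MvPolynomial.X i

theorem subst_mul (g h : Matrix (Fin 2) (Fin 2) ℚ) :
    subst (g * h) = (subst g).comp (subst h) := by
  refine MvPolynomial.algHom_ext fun j => ?_
  simp [subst, Matrix.mul_apply, Fin.sum_univ_two]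
  ring

theorem subst_one : subst 1 = AlgHom.id ℚ _ := by
  refine MvPolynomial.algHom_ext fun j => ?_
  simp [subst, Matrix.one_apply]

theorem subst_mem (g : Matrix (Fin 2) (Fin 2) ℚ) (k : ℕ) {p : MvPolynomial (Fin 2) ℚ}
    (hp : p ∈ MvPolynomial.homogeneousSubmodule (Fin 2) ℚ k) :
    subst g p ∈ MvPolynomial.homogeneousSubmodule (Fin 2) ℚ k := by
  rw [MvPolynomial.mem_homogeneousSubmodule] at hp ⊢
  have := hp.aeval (fun j => ∑ i, MvPolynomial.C (g i j) * MvPolynomial.X i) (n := 1)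
    fun j => MvPolynomial.IsHomogeneous.sum _ _ _ fun i _ =>
      MvPolynomial.IsHomogeneous.C_mul (MvPolynomial.isHomogeneous_X ℚ i) _
  rw [one_mul] at this
  exact this

/-- The irreducible representation of `GL_2(ℚ)` with Young diagram `(a, b)`, `a ≥ b`: it is
`Sym^{a-b}(V) ⊗ det^b` for the natural representation `V = ℚ²`, the symmetric power being
realized as the binary forms of degree `a - b`. -/
def W (a b : ℕ) : Representation ℚ (GL (Fin 2) ℚ)
    (MvPolynomial.homogeneousSubmodule (Fin 2) ℚ (a - b)) where
  toFun g := g.1.det ^ b • (subst g.1).toLinearMap.restrict fun _ hp => subst_mem g.1 (a - b) hp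
  map_one' := by
    ext p
    simp [subst_one]
  map_mul' g h := by
    refine LinearMap.ext fun p => Subtype.ext ?_
    change (g * h).1.det ^ b • subst (g * h).1 p.1 =
      g.1.det ^ b • subst g.1 (h.1.det ^ b • subst h.1 p.1)
    rw [Units.val_mul, subst_mul, Matrix.det_mul, mul_pow, mul_smul, map_smul]
    rfl

/-- The multiplicity of the irreducible representation `(a, b)` in a semisimple `ρ`. -/
def mult {V : Type*} [AddCommGroup V] [Module ℚ V]
    (ρ : Representation ℚ (GL (Fin 2) ℚ) V) (a b : ℕ) : ℕ :=
  Module.finrank ℚ ((W a b).IntertwiningMap ρ)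

/-- The total number of irreducible representations, counted with multiplicity, in a decomposition
of a semisimple `ρ`: the length of `ρ` as a module over the group algebra. -/
def irreducibleCount {V : Type*} [AddCommGroup V] [Module ℚ V]
    (ρ : Representation ℚ (GL (Fin 2) ℚ) V) : ℕ∞ :=
  Module.length (MonoidAlgebra ℚ (GL (Fin 2) ℚ)) ρ.asModule

/-! ### The function `θ` -/

/-- The binomial coefficient `m.choose k`, equal to `0` unless `0 ≤ k ≤ m`. -/
def binom (m k : ℤ) : ℚ := if 0 ≤ k ∧ k ≤ m then (m.toNat.choose k.toNat : ℚ) else 0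

/-- `θ(a, b) = (1 / (a + b)) ∑_{d ∣ gcd(a, b)} μ(d) ((a + b) / d).choose (a / d)`. -/
def theta (a b : ℤ) : ℚ :=
  1 / ((a + b : ℤ) : ℚ) * ∑ d ∈ (Int.gcd a b).divisors,
    (ArithmeticFunction.moebius d : ℚ) * binom ((a + b) / d) (a / d)

end PronilpotentFree

end

/-! Everything is realised in the free associative algebra A = ℚ⟨X_0, X_1⟩, on which matrices act by
linear substitution. The bilinear form with orthonormal words is positive definite, and the adjoint
of a substitution is the transposed one, so orthogonal complements of GL_2-stable subspaces are
stable and representations embedded in a homogeneous part of A are semisimple. The derivations `E`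
and `F` are adjoint, and positivity yields the sl_2 theory directly: in degree N, `E` maps weight a
onto weight a + 1 as soon as N ≤ 2a (`finrank_hw_wt`). Hence the multiplicity of an irreducible is a
difference of two neighbouring weight dimensions (`Model.mult_eq`), and the number of irreducibles
is the dimension of the middle weight space (`finrank_hw`, `Model.irreducibleCount_eq`).

For the Lie ring, the coefficient of degree n of the Magnus expansion x_i ↦ 1 + X_i t embeds J_n ⊗ ℚ
in A with image the primitive elements of degree n. Surjectivity holds because the Dynkin operator
multiplies primitives of degree n by n (`dyn_of_mem_lie`) and its values on words come from iterated
commutators. Injectivity is the same argument run inside the graded Lie algebra of F̂ itself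
(`beta_iota`).

For the automorphisms, φ ↦ (x_i⁻¹ φ(x_i)) identifies M_n with two copies of J_{n+1}
(`tau_bijective`); every pair occurs because endomorphisms that are unipotent for the filtration are
invertible by completeness. As a representation this is V* ⊗ J_{n+1}. Since V* ⊗ det ≅ V, the twist
of M_n ⊗ ℚ by det is the space of all X_1 a − X_0 b with a, b Lie elements of degree n + 1, and its
weight dimensions are sums of two weight dimensions of Lie elements.

The weight dimensions of Lie elements come from elimination. If y is a primitive element of lowest
degree, S consists of further primitives, and the commutators of y with S stay in the algebra
generated by S, then the algebra B generated by S and y is the direct sum of `adjoin S` and y·B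
(`finrank_adjoin_insert`). Iterating gives the product formula for the Hilbert series of A; its
logarithmic derivative and Möbius inversion give θ (`finrank_prim_wt`).

Finally, a rational form exists by transport of the substitution action, and it is unique: elements
of B realise the integral transvections, which are Zariski dense in SL_2, while the degree fixes the
action of scalars (`rep_ext`). -/

noncomputable section

namespace PronilpotentFree

section

/-! ### The free associative algebra on two letters -/

/-- The free associative `ℚ`-algebra on two letters. -/
abbrev NC : Type := MonoidAlgebra ℚ (FreeMonoid (Fin 2))

namespace NC

/-- The basis element of a word. -/
def word (l : List (Fin 2)) : NC := MonoidAlgebra.single (FreeMonoid.ofList l) 1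

/-- The letters. -/
def x (i : Fin 2) : NC := word [i]

theorem word_nil : word [] = 1 := rfl

theorem word_append (l m : List (Fin 2)) : word (l ++ m) = word l * word m := by
  simp [word, MonoidAlgebra.single_mul_single]

theorem word_cons (i : Fin 2) (l : List (Fin 2)) : word (i :: l) = x i * word l :=
  word_append [i] l

/-- The basis of words. -/
def wordBasis : Module.Basis (List (Fin 2)) ℚ NC :=
  (MonoidAlgebra.basis (FreeMonoid (Fin 2)) ℚ).reindex FreeMonoid.toList

@[simp] theorem wordBasis_apply (l : List (Fin 2)) : wordBasis l = word l := by
  simp [wordBasis, MonoidAlgebra.basis_apply, word]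

/-- The coefficient of a word. -/
def cf (l : List (Fin 2)) : NC →ₗ[ℚ] ℚ := wordBasis.coord l

theorem cf_word (l m : List (Fin 2)) : cf l (word m) = if m = l then 1 else 0 := by
  rw [cf, ← wordBasis_apply, Module.Basis.coord_apply, Module.Basis.repr_self,
    Finsupp.single_apply]

theorem hom_ext {V : Type*} [AddCommGroup V] [Module ℚ V] {f g : NC →ₗ[ℚ] V}
    (h : ∀ l, f (word l) = g (word l)) : f = g :=
  wordBasis.ext fun l => by simpa using h l

theorem ext_cf {a b : NC} (h : ∀ l, cf l a = cf l b) : a = b :=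
  wordBasis.ext_elem h

/-- The linear map with prescribed values on the words. -/
def ofWords {V : Type*} [AddCommGroup V] [Module ℚ V] (f : List (Fin 2) → V) : NC →ₗ[ℚ] V :=
  wordBasis.constr ℚ f

@[simp] theorem ofWords_word {V : Type*} [AddCommGroup V] [Module ℚ V] (f : List (Fin 2) → V)
    (l : List (Fin 2)) : ofWords f (word l) = f l := by
  rw [ofWords, ← wordBasis_apply, Module.Basis.constr_basis]

theorem ofWords_apply {V : Type*} [AddCommGroup V] [Module ℚ V] (f : List (Fin 2) → V)
    (a : NC) : ofWords f a = (wordBasis.repr a).sum fun l c => c • f l :=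
  wordBasis.constr_apply ..

theorem span_word : Submodule.span ℚ (Set.range word) = ⊤ := by
  rw [← wordBasis.span_eq]
  congr 2
  ext l
  simp

theorem word_induction {P : NC → Prop} (hw : ∀ l, P (word l)) (h0 : P 0)
    (hadd : ∀ a b, P a → P b → P (a + b)) (hsmul : ∀ (c : ℚ) a, P a → P (c • a)) (a : NC) :
    P a := by
  have : a ∈ Submodule.span ℚ (Set.range word) := by rw [span_word]; trivial
  induction this using Submodule.span_induction with
  | mem _ h => obtain ⟨l, rfl⟩ := h; exact hw l
  | zero => exact h0
  | add _ _ _ _ h1 h2 => exact hadd _ _ h1 h2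
  | smul c _ _ h => exact hsmul c _ h

theorem cf_nil_x_mul (i : Fin 2) (a : NC) : cf [] (x i * a) = 0 := by
  induction a using word_induction with
  | hw l => rw [← word_cons, cf_word]; simp
  | h0 => simp
  | hadd a b ha hb => rw [mul_add, map_add, ha, hb, add_zero]
  | hsmul c a ha => rw [mul_smul_comm, map_smul, ha, smul_zero]

theorem cf_cons_x_mul (j i : Fin 2) (l : List (Fin 2)) (a : NC) :
    cf (j :: l) (x i * a) = if i = j then cf l a else 0 := by
  induction a using word_induction with
  | hw m =>
    rw [← word_cons, cf_word, cf_word]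
    by_cases h : i = j <;> simp [h]
  | h0 => simp
  | hadd a b ha hb => rw [mul_add, map_add, ha, hb, map_add]; split_ifs <;> simp
  | hsmul c a ha => rw [mul_smul_comm, map_smul, ha, map_smul]; split_ifs <;> simp

/-! ### Subspaces spanned by words -/

/-- The span of a set of words. -/
def supp (S : Set (List (Fin 2))) : Submodule ℚ NC := Submodule.span ℚ (word '' S)

theorem mem_supp {S : Set (List (Fin 2))} {a : NC} : a ∈ supp S ↔ ∀ l, cf l a ≠ 0 → l ∈ S := by
  have : word '' S = wordBasis '' S := by ext; simp
  rw [supp, this, Module.Basis.mem_span_image]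
  simp [Set.subset_def, cf]

theorem word_mem_supp {S : Set (List (Fin 2))} {l : List (Fin 2)} (h : l ∈ S) :
    word l ∈ supp S :=
  Submodule.subset_span ⟨l, h, rfl⟩

theorem supp_induction {S : Set (List (Fin 2))} {P : NC → Prop} (hw : ∀ l ∈ S, P (word l))
    (h0 : P 0) (hadd : ∀ a b, P a → P b → P (a + b)) (hsmul : ∀ (c : ℚ) a, P a → P (c • a))
    {a : NC} (ha : a ∈ supp S) : P a := by
  induction ha using Submodule.span_induction with
  | mem _ h => obtain ⟨l, hl, rfl⟩ := h; exact hw l hl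
  | zero => exact h0
  | add _ _ _ _ h1 h2 => exact hadd _ _ h1 h2
  | smul c _ _ h => exact hsmul c _ h

theorem map_supp_le {V : Type*} [AddCommGroup V] [Module ℚ V] {S : Set (List (Fin 2))}
    {f : NC →ₗ[ℚ] V} {U : Submodule ℚ V} (h : ∀ l ∈ S, f (word l) ∈ U) {a : NC}
    (ha : a ∈ supp S) : f a ∈ U :=
  supp_induction (P := fun a => f a ∈ U) h (by simp)
    (fun a b ha hb => by rw [map_add]; exact U.add_mem ha hb)
    (fun c a ha => by rw [map_smul]; exact U.smul_mem c ha) ha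

theorem eqOn_supp {V : Type*} [AddCommGroup V] [Module ℚ V] {S : Set (List (Fin 2))}
    {f g : NC →ₗ[ℚ] V} (h : ∀ l ∈ S, f (word l) = g (word l)) {a : NC} (ha : a ∈ supp S) :
    f a = g a := by
  have := map_supp_le (f := f - g) (U := ⊥) (S := S) (fun l hl => by simp [h l hl]) ha
  simpa [sub_eq_zero] using this

theorem supp_mono {S T : Set (List (Fin 2))} (h : S ⊆ T) : supp S ≤ supp T :=
  Submodule.span_mono (Set.image_mono h)

open Classical in
/-- The projection onto the span of a set of words. -/
def proj (S : Set (List (Fin 2))) : NC →ₗ[ℚ] NC := ofWords fun l => if l ∈ S then word l else 0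

open Classical in
theorem cf_proj (S : Set (List (Fin 2))) (l : List (Fin 2)) (a : NC) :
    cf l (proj S a) = if l ∈ S then cf l a else 0 := by
  induction a using word_induction with
  | hw m =>
    rw [proj, ofWords_word, cf_word]
    by_cases hm : m = l
    · subst hm; by_cases h : m ∈ S <;> simp [cf_word, h]
    · split_ifs <;> simp [cf_word, hm]
  | h0 => simp
  | hadd a b ha hb => rw [map_add, map_add, ha, hb, map_add]; split_ifs <;> simp
  | hsmul c a ha => rw [map_smul, map_smul, ha, map_smul]; split_ifs <;> simp

theorem proj_mem (S : Set (List (Fin 2))) (a : NC) : proj S a ∈ supp S := by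
  rw [mem_supp]
  intro l hl
  rw [cf_proj] at hl
  by_contra h
  simp [h] at hl

theorem proj_of_mem {S : Set (List (Fin 2))} {a : NC} (h : a ∈ supp S) : proj S a = a := by
  refine ext_cf fun l => ?_
  rw [cf_proj]
  split_ifs with hl
  · rfl
  · by_contra h'
    exact hl (mem_supp.1 h l (Ne.symm h'))

theorem proj_eq_zero {S T : Set (List (Fin 2))} (hST : Disjoint S T) {a : NC}
    (h : a ∈ supp T) : proj S a = 0 := by
  refine ext_cf fun l => ?_
  rw [cf_proj, map_zero]
  split_ifs with hl
  · by_contra h'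
    exact Set.disjoint_left.1 hST hl (mem_supp.1 h l h')
  · rfl

theorem finite_words (N : ℕ) : {l : List (Fin 2) | l.length = N}.Finite :=
  List.finite_length_eq (Fin 2) N

theorem finiteDimensional_supp {S : Set (List (Fin 2))} (h : S.Finite) :
    FiniteDimensional ℚ (supp S) :=
  FiniteDimensional.span_of_finite ℚ (h.image _)

theorem finrank_supp (S : Set (List (Fin 2))) : Module.finrank ℚ (supp S) = S.ncard := by
  have : word '' S = Set.range fun l : S => wordBasis l.1 := by ext; simp
  have hli : LinearIndependent ℚ fun l : S => wordBasis l.1 :=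
    wordBasis.linearIndependent.comp (Subtype.val : S → _) Subtype.val_injective
  rw [supp, this, Module.finrank, rank_span hli, Cardinal.mk_range_eq _ hli.injective]
  rfl

/-- The elements homogeneous of degree `N`. -/
def deg (N : ℕ) : Submodule ℚ NC := supp {l | l.length = N}

/-- The elements homogeneous of degree `N` and of degree `a` in the first letter. -/
def wt (N a : ℕ) : Submodule ℚ NC := supp {l | l.length = N ∧ l.count 0 = a}

theorem wt_le_deg (N a : ℕ) : wt N a ≤ deg N := supp_mono fun _ h => h.1

instance (N : ℕ) : FiniteDimensional ℚ (deg N) := finiteDimensional_supp (finite_words N)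

instance (N a : ℕ) : FiniteDimensional ℚ (wt N a) :=
  finiteDimensional_supp ((finite_words N).subset fun _ h => h.1)

/-! ### Linear substitutions and derivations -/

/-- The linear form with coefficients the `j`-th column of `g`. -/
def lin (g : Matrix (Fin 2) (Fin 2) ℚ) (j : Fin 2) : NC := ∑ i, g i j • x i

/-- The linear substitution `X_j ↦ ∑_i g_{ij} X_i`. -/
def rhoA (g : Matrix (Fin 2) (Fin 2) ℚ) : NC →ₐ[ℚ] NC :=
  MonoidAlgebra.lift ℚ NC _ (FreeMonoid.lift (lin g))

theorem rhoA_x (g : Matrix (Fin 2) (Fin 2) ℚ) (j : Fin 2) : rhoA g (x j) = lin g j := by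
  rw [rhoA, x, word, MonoidAlgebra.lift_single, one_smul]
  rfl

theorem algHom_ext {R : Type*} [Ring R] [Algebra ℚ R] {f g : NC →ₐ[ℚ] R}
    (h : ∀ i, f (x i) = g (x i)) : f = g := by
  have : f.toLinearMap = g.toLinearMap := by
    refine hom_ext fun l => ?_
    induction l with
    | nil => simp [word_nil]
    | cons i l ih =>
      simp only [AlgHom.toLinearMap_apply] at ih ⊢
      rw [word_cons, map_mul, map_mul, ih, h]
  exact AlgHom.toLinearMap_injective this

theorem rhoA_mul (g h : Matrix (Fin 2) (Fin 2) ℚ) : rhoA (g * h) = (rhoA g).comp (rhoA h) := by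
  refine algHom_ext fun j => ?_
  simp [rhoA_x, lin, Fin.sum_univ_two, Matrix.mul_apply, add_smul, mul_smul]
  module

theorem rhoA_one : rhoA 1 = AlgHom.id ℚ NC := by
  refine algHom_ext fun j => ?_
  simp [rhoA_x, lin, Matrix.one_apply]

theorem rhoA_diagonal_word (d : Fin 2 → ℚ) (l : List (Fin 2)) :
    rhoA (Matrix.diagonal d) (word l) = (d 0 ^ l.count 0 * d 1 ^ l.count 1) • word l := by
  induction l with
  | nil => simp [word_nil]
  | cons i l ih =>
    rw [word_cons, map_mul, ih, rhoA_x, lin]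
    fin_cases i <;> simp [Matrix.diagonal_apply, pow_succ, smul_smul] <;> ring_nf

theorem lin_mem_deg (g : Matrix (Fin 2) (Fin 2) ℚ) (j : Fin 2) : lin g j ∈ deg 1 :=
  Submodule.sum_mem _ fun _ _ => Submodule.smul_mem _ _ (word_mem_supp rfl)

theorem mul_mem_supp {S T R : Set (List (Fin 2))} (h : ∀ s ∈ S, ∀ t ∈ T, s ++ t ∈ R) {a b : NC}
    (ha : a ∈ supp S) (hb : b ∈ supp T) : a * b ∈ supp R := by
  refine map_supp_le (f := LinearMap.mulRight ℚ b) (fun s hs => ?_) ha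
  refine map_supp_le (f := LinearMap.mulLeft ℚ (word s)) (fun t ht => ?_) hb
  rw [LinearMap.mulLeft_apply, ← word_append]
  exact word_mem_supp (h s hs t ht)

theorem mul_mem_deg {m n : ℕ} {a b : NC} (ha : a ∈ deg m) (hb : b ∈ deg n) :
    a * b ∈ deg (m + n) :=
  mul_mem_supp (by rintro s rfl t rfl; simp) ha hb

theorem rhoA_mem_deg (g : Matrix (Fin 2) (Fin 2) ℚ) {N : ℕ} {a : NC} (ha : a ∈ deg N) :
    rhoA g a ∈ deg N := by
  refine map_supp_le (f := (rhoA g).toLinearMap) ?_ ha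
  rintro l rfl
  clear ha
  induction l with
  | nil => rw [word_nil, AlgHom.toLinearMap_apply, map_one]; exact word_mem_supp rfl
  | cons i l ih =>
    rw [AlgHom.toLinearMap_apply] at ih ⊢
    rw [word_cons, map_mul, rhoA_x, List.length_cons, add_comm]
    exact mul_mem_deg (lin_mem_deg _ _) ih

/-- The values on words of the derivation `derM`. -/
def derWord (M : Matrix (Fin 2) (Fin 2) ℚ) : List (Fin 2) → NC
  | [] => 0
  | j :: l => lin M j * word l + x j * derWord M l

/-- The derivation `X_j ↦ ∑_i M_{ij} X_i`. -/
def derM (M : Matrix (Fin 2) (Fin 2) ℚ) : NC →ₗ[ℚ] NC := ofWords (derWord M)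

theorem derM_one (M : Matrix (Fin 2) (Fin 2) ℚ) : derM M 1 = 0 := by
  rw [← word_nil, derM, ofWords_word, derWord]

theorem derM_x_mul (M : Matrix (Fin 2) (Fin 2) ℚ) (j : Fin 2) (a : NC) :
    derM M (x j * a) = lin M j * a + x j * derM M a := by
  induction a using word_induction with
  | hw l => rw [← word_cons, derM, ofWords_word, ofWords_word, derWord]
  | h0 => simp
  | hadd a b ha hb => simp only [mul_add, map_add, ha, hb]; abel
  | hsmul c a ha => simp only [mul_smul_comm, map_smul, ha, smul_add]

theorem derM_lin_mul (M g : Matrix (Fin 2) (Fin 2) ℚ) (j : Fin 2) (a : NC) :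
    derM M (lin g j * a) = lin (M * g) j * a + lin g j * derM M a := by
  simp only [lin, Fin.sum_univ_two, add_mul, smul_mul_assoc, map_add, map_smul, derM_x_mul,
    Matrix.mul_apply]
  module

/-- A commutator of derivations is a derivation, determined by its values on the letters. The
commutation rules of `E`, `F` and `H` are instances. -/
theorem derM_derM (M M' : Matrix (Fin 2) (Fin 2) ℚ) (a : NC) :
    derM M (derM M' a) - derM M' (derM M a) = derM (M * M' - M' * M) a := by
  induction a using word_induction with
  | hw l =>
    induction l with
    | nil => simp [word_nil, derM_one]
    | cons j l ih =>
      simp only [word_cons, derM_x_mul, map_add, derM_lin_mul]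
      rw [← ih]
      simp only [lin, Matrix.sub_apply, sub_smul, Finset.sum_sub_distrib, sub_mul, mul_sub]
      abel
  | h0 => simp
  | hadd a b ha hb => simp only [map_add, ← ha, ← hb]; abel
  | hsmul c a ha => simp only [map_smul, ← ha, smul_sub]

theorem derM_diagonal_word (d : Fin 2 → ℚ) (l : List (Fin 2)) :
    derM (Matrix.diagonal d) (word l) = (l.count 0 * d 0 + l.count 1 * d 1) • word l := by
  induction l with
  | nil => simp [word_nil, derM_one]
  | cons i l ih =>
    rw [word_cons, derM_x_mul, ih, lin]
    fin_cases i <;> simp [Matrix.diagonal_apply] <;> module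

/-- Leibniz rule for powers: because M² = 0, `derM M` kills `lin M j`, so only two terms survive. -/
theorem derM_pow_x_mul {M : Matrix (Fin 2) (Fin 2) ℚ} (hM : M * M = 0) (j : Fin 2) (a : NC) (i : ℕ) :
    (derM M ^ (i + 1)) (x j * a) =
      x j * (derM M ^ (i + 1)) a + ((i : ℚ) + 1) • (lin M j * (derM M ^ i) a) := by
  have hl : ∀ (n : ℕ) (b : NC), (derM M ^ n) (lin M j * b) = lin M j * (derM M ^ n) b := by
    intro n
    induction n with
    | zero => simp
    | succ n ih =>
      intro b
      rw [pow_succ, Module.End.mul_apply, derM_lin_mul, hM, Module.End.mul_apply, ← ih]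
      simp [lin]
  induction i generalizing a with
  | zero => simp [derM_x_mul, add_comm]
  | succ i ih =>
    rw [pow_succ, Module.End.mul_apply, derM_x_mul, map_add, ih, hl, ← Module.End.mul_apply,
      ← pow_succ, ← Module.End.mul_apply, ← pow_succ]
    push_cast
    module

/-- Since M² = 0, the matrix 1 + tM is exp(tM), and substitution by it is the exponential of t ·
`derM M`. On a word the series stops; any cutoff beyond the length is allowed, which the induction
exploits. -/
theorem rhoA_one_add_word {M : Matrix (Fin 2) (Fin 2) ℚ} (hM : M * M = 0) (t : ℚ)
    (l : List (Fin 2)) (K : ℕ) (hK : l.length < K) :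
    rhoA (1 + t • M) (word l) =
      ∑ i ∈ Finset.range K, t ^ i • ((i.factorial : ℚ)⁻¹ • (derM M ^ i) (word l)) := by
  induction l generalizing K with
  | nil =>
    obtain ⟨K, rfl⟩ : ∃ k, K = k + 1 := ⟨K - 1, by simp at hK; omega⟩
    rw [Finset.sum_range_succ', Finset.sum_eq_zero]
    · simp [word_nil]
    · intro i _
      rw [word_nil, pow_succ (derM M), Module.End.mul_apply, derM_one]
      simp
  | cons j l ih =>
    obtain ⟨K, rfl⟩ : ∃ k, K = k + 1 := ⟨K - 1, by simp at hK; omega⟩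
    simp only [List.length_cons, add_lt_add_iff_right] at hK
    have hlin : lin (1 + t • M) j = x j + t • lin M j := by
      fin_cases j <;> simp [lin, Matrix.one_apply, Fin.sum_univ_two, add_smul, mul_smul] <;> module
    -- The induction hypothesis is used at two cutoffs: the factor t · `lin M j` raises the exponent
    -- by one, so the shorter sum lines up with the tail of the longer one.
    have hsplit : (x j + t • lin M j) * rhoA (1 + t • M) (word l) =
        x j * (∑ i ∈ Finset.range (K + 1),
          t ^ i • ((i.factorial : ℚ)⁻¹ • (derM M ^ i) (word l))) +
        (t • lin M j) * (∑ i ∈ Finset.range K,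
          t ^ i • ((i.factorial : ℚ)⁻¹ • (derM M ^ i) (word l))) := by
      rw [← ih (K + 1) (by omega), ← ih K hK, add_mul]
    rw [word_cons, map_mul, rhoA_x, hlin, hsplit, Finset.sum_range_succ' _ K,
      Finset.sum_range_succ' _ K, mul_add, Finset.mul_sum, Finset.mul_sum, add_right_comm,
      ← Finset.sum_add_distrib]
    congr 1
    · refine Finset.sum_congr rfl fun i _ => ?_
      rw [derM_pow_x_mul hM]
      have h : ((i + 1).factorial : ℚ)⁻¹ * ((i : ℚ) + 1) = (i.factorial : ℚ)⁻¹ := by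
        rw [Nat.factorial_succ]
        push_cast
        field_simp
      rw [smul_add, smul_add, smul_smul _ ((i : ℚ) + 1), h]
      simp only [mul_smul_comm, smul_mul_assoc, smul_smul]
      rw [pow_succ t]
      congr 2
      ring
    · simp

theorem rhoA_one_add {M : Matrix (Fin 2) (Fin 2) ℚ} (hM : M * M = 0) (t : ℚ) {N : ℕ} {a : NC}
    (ha : a ∈ deg N) (K : ℕ) (hK : N < K) :
    rhoA (1 + t • M) a =
      ∑ i ∈ Finset.range K, t ^ i • ((i.factorial : ℚ)⁻¹ • (derM M ^ i) a) := by
  have h := eqOn_supp (f := (rhoA (1 + t • M)).toLinearMap)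
    (g := ∑ i ∈ Finset.range K, t ^ i • ((i.factorial : ℚ)⁻¹ • (derM M ^ i)))
    (fun l hl => ?_) ha
  · simpa using h
  · simpa using rhoA_one_add_word hM t l K (by simp at hl; omega)

/-! ### The invariant form -/

/-- The bilinear form for which the words are orthonormal. -/
def form : LinearMap.BilinForm ℚ NC := ofWords cf

theorem form_word (l : List (Fin 2)) (a : NC) : form (word l) a = cf l a := by
  rw [form, ofWords_word]

theorem form_symm (a b : NC) : form a b = form b a := by
  have : form = form.flip := by
    refine hom_ext fun l => hom_ext fun m => ?_
    change _ = form (word m) (word l)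
    rw [form_word, form_word, cf_word, cf_word]
    simp only [eq_comm]
  conv_lhs => rw [this]
  rfl

theorem form_self_nonneg (a : NC) : 0 ≤ form a a := by
  rw [form, ofWords_apply, Finsupp.sum, LinearMap.sum_apply]
  exact Finset.sum_nonneg fun l _ => mul_self_nonneg _

theorem eq_zero_of_form_self {a : NC} (h : form a a = 0) : a = 0 := by
  rw [form, ofWords_apply, Finsupp.sum, LinearMap.sum_apply] at h
  have h := (Finset.sum_eq_zero_iff_of_nonneg fun l _ => mul_self_nonneg (cf l a)).1 h
  refine ext_cf fun l => ?_
  rw [map_zero]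
  by_cases hl : l ∈ (wordBasis.repr a).support
  · exact mul_self_eq_zero.1 (h l hl)
  · exact (Finsupp.notMem_support_iff (f := wordBasis.repr a)).1 hl

theorem form_x_mul (i j : Fin 2) (a b : NC) :
    form (x i * a) (x j * b) = if i = j then form a b else 0 := by
  induction a using word_induction with
  | hw l =>
    rw [← word_cons, form_word, form_word, cf_cons_x_mul]
    simp only [eq_comm]
  | h0 => simp
  | hadd a a' ha ha' => simp only [mul_add, map_add, LinearMap.add_apply, ha, ha']; split_ifs <;> simp
  | hsmul c a ha => simp only [mul_smul_comm, map_smul, LinearMap.smul_apply, ha]; split_ifs <;> simp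

theorem form_one_x_mul (j : Fin 2) (b : NC) : form 1 (x j * b) = 0 := by
  rw [← word_nil, form_word, cf_nil_x_mul]

theorem form_ext {f g h k : NC →ₗ[ℚ] NC}
    (H : ∀ l m, form (f (word l)) (g (word m)) = form (h (word l)) (k (word m))) (a b : NC) :
    form (f a) (g b) = form (h a) (k b) := by
  have : form.compl₁₂ f g = form.compl₁₂ h k := hom_ext fun l => hom_ext fun m => H l m
  exact DFunLike.congr_fun (DFunLike.congr_fun this a) b

theorem form_lin_mul (g : Matrix (Fin 2) (Fin 2) ℚ) (i j : Fin 2) (a b : NC) :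
    form (lin g i * a) (x j * b) = g j i * form a b := by
  simp only [lin, Finset.sum_mul, map_sum, LinearMap.sum_apply, smul_mul_assoc, map_smul,
    LinearMap.smul_apply, form_x_mul]
  simp

theorem form_lin_mul' (g : Matrix (Fin 2) (Fin 2) ℚ) (i j : Fin 2) (a b : NC) :
    form (x i * a) (lin g j * b) = g i j * form a b := by
  rw [form_symm, form_lin_mul, form_symm]

/-- Transposition preserves invertibility, so this adjunction is what makes orthogonal complements
of stable subspaces stable (`orth_stable`). -/
theorem form_rhoA (g : Matrix (Fin 2) (Fin 2) ℚ) (a b : NC) :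
    form (rhoA g a) b = form a (rhoA g.transpose b) := by
  refine form_ext (f := (rhoA g).toLinearMap) (g := LinearMap.id) (h := LinearMap.id)
    (k := (rhoA g.transpose).toLinearMap) (fun l m => ?_) a b
  simp only [AlgHom.toLinearMap_apply, LinearMap.id_apply]
  induction l generalizing m with
  | nil =>
    rw [word_nil, map_one (rhoA _)]
    cases m with
    | nil => rw [word_nil, map_one (rhoA _)]
    | cons j m =>
      rw [word_cons, map_mul (rhoA _), rhoA_x, form_one_x_mul]
      simp [lin, add_mul, form_one_x_mul]
  | cons i l ih =>
    cases m with
    | nil =>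
      rw [word_nil, map_one (rhoA _), word_cons, map_mul (rhoA _), rhoA_x, form_symm,
        form_symm (x i * _)]
      simp [lin, add_mul, form_one_x_mul]
    | cons j m =>
      rw [word_cons, word_cons, map_mul (rhoA _), map_mul (rhoA _), rhoA_x, rhoA_x, form_lin_mul, form_lin_mul', ih]
      rfl

theorem form_derM (M : Matrix (Fin 2) (Fin 2) ℚ) (a b : NC) :
    form (derM M a) b = form a (derM M.transpose b) := by
  refine form_ext (f := derM M) (g := LinearMap.id) (h := LinearMap.id)
    (k := derM M.transpose) (fun l m => ?_) a b
  simp only [LinearMap.id_apply]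
  induction l generalizing m with
  | nil =>
    rw [word_nil, derM_one]
    cases m with
    | nil => simp [word_nil, derM_one]
    | cons j m =>
      rw [word_cons, derM_x_mul]
      simp [lin, add_mul, form_one_x_mul]
  | cons i l ih =>
    cases m with
    | nil =>
      rw [word_nil, derM_one, word_cons, derM_x_mul, form_symm]
      simp [lin, add_mul, form_one_x_mul]
    | cons j m =>
      rw [word_cons, word_cons, derM_x_mul, derM_x_mul]
      simp only [map_add, LinearMap.add_apply, form_lin_mul, form_lin_mul', form_x_mul, ih]
      rw [Matrix.transpose_apply]

end NC

/-- If a polynomial with vector coefficients takes values in a subspace, then its coefficients lie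
in that subspace. -/
theorem mem_of_forall_sum_pow_smul_mem {V : Type*} [AddCommGroup V] [Module ℚ V]
    (U : Submodule ℚ V) (v : ℕ → V) (K : ℕ)
    (h : ∀ t : ℚ, t ≠ 0 → ∑ i ∈ Finset.range K, t ^ i • v i ∈ U) {i : ℕ} (hi : i < K) :
    v i ∈ U := by
  rw [← Submodule.Quotient.mk_eq_zero, ← Module.forall_dual_apply_eq_zero_iff ℚ]
  intro f
  -- Modulo `U` and after a functional, the hypothesis says that this scalar polynomial vanishes at
  -- every nonzero t.
  let P : Polynomial ℚ := ∑ i ∈ Finset.range K,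
    Polynomial.C (f (Submodule.Quotient.mk (v i))) * Polynomial.X ^ i
  have hP : P = 0 := by
    refine Polynomial.eq_zero_of_infinite_isRoot _ (Set.Infinite.mono (s := {0}ᶜ) ?_
      (Set.finite_singleton _).infinite_compl)
    intro t ht
    have := congrArg f ((Submodule.Quotient.mk_eq_zero U).2 (h t ht))
    rw [← Submodule.mkQ_apply] at this
    simp only [map_sum, map_smul, map_zero, smul_eq_mul] at this
    simp only [P, Set.mem_ofPred_eq, Polynomial.IsRoot.def, Polynomial.eval_finsetSum,
      Polynomial.eval_mul, Polynomial.eval_C, Polynomial.eval_pow, Polynomial.eval_X]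
    rw [← this]
    exact Finset.sum_congr rfl fun i _ => mul_comm _ _
  have hc := congrArg (fun p => Polynomial.coeff p i) hP
  simpa [P, Polynomial.coeff_C_mul, Polynomial.coeff_X_pow, hi] using hc

end

section

namespace NC

/-! ### Highest weight vectors -/

/-- The raising operator. -/
def E : NC →ₗ[ℚ] NC := derM (Matrix.single 0 1 1)

/-- The lowering operator. -/
def F : NC →ₗ[ℚ] NC := derM (Matrix.single 1 0 1)

/-- Stability under `GL_2(ℚ)`. -/
def Stable (U : Submodule ℚ NC) : Prop :=
  ∀ g : Matrix (Fin 2) (Fin 2) ℚ, g.det ≠ 0 → ∀ a ∈ U, rhoA g a ∈ U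

theorem upper_sq : (Matrix.single 0 1 1 : Matrix (Fin 2) (Fin 2) ℚ) * Matrix.single 0 1 1 = 0 := by
  simp

theorem lower_sq : (Matrix.single 1 0 1 : Matrix (Fin 2) (Fin 2) ℚ) * Matrix.single 1 0 1 = 0 := by
  simp

theorem det_upper (t : ℚ) :
    (1 + t • Matrix.single 0 1 1 : Matrix (Fin 2) (Fin 2) ℚ).det = 1 := by
  simp [Matrix.det_fin_two]

theorem det_lower (t : ℚ) :
    (1 + t • Matrix.single 1 0 1 : Matrix (Fin 2) (Fin 2) ℚ).det = 1 := by
  simp [Matrix.det_fin_two]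

/-- The transvections 1 + tM act on `a` by a polynomial in t with linear coefficient `derM M a`;
stability for all t puts each coefficient in `U`. -/
theorem derM_mem_of_stable {M : Matrix (Fin 2) (Fin 2) ℚ} (hM : M * M = 0)
    (hdet : ∀ t : ℚ, (1 + t • M).det = 1) {U : Submodule ℚ NC} {N : ℕ} (hUN : U ≤ deg N)
    (hU : Stable U) {a : NC} (ha : a ∈ U) : derM M a ∈ U := by
  have := mem_of_forall_sum_pow_smul_mem U
    (fun i => (i.factorial : ℚ)⁻¹ • (derM M ^ i) a) (N + 2) (fun t _ => ?_) (i := 1) (by omega)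
  · simpa using this
  · rw [← rhoA_one_add hM t (hUN ha) (N + 2) (by omega)]
    exact hU _ (by rw [hdet]; exact one_ne_zero) a ha

theorem E_mem {U : Submodule ℚ NC} {N : ℕ} (hUN : U ≤ deg N) (hU : Stable U) {a : NC}
    (ha : a ∈ U) : E a ∈ U :=
  derM_mem_of_stable upper_sq det_upper hUN hU ha

theorem F_mem {U : Submodule ℚ NC} {N : ℕ} (hUN : U ≤ deg N) (hU : Stable U) {a : NC}
    (ha : a ∈ U) : F a ∈ U :=
  derM_mem_of_stable lower_sq det_lower hUN hU ha

/-- Row reduction: an invertible matrix over a field is a product of diagonal matrices and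
transvections. -/
theorem stable_of_generators {U : Submodule ℚ NC}
    (hd : ∀ d : Fin 2 → ℚ, ∀ a ∈ U, rhoA (Matrix.diagonal d) a ∈ U)
    (hu : ∀ t : ℚ, ∀ a ∈ U, rhoA (1 + t • Matrix.single 0 1 1) a ∈ U)
    (hl : ∀ t : ℚ, ∀ a ∈ U, rhoA (1 + t • Matrix.single 1 0 1) a ∈ U) : Stable U := by
  intro g hg
  refine Matrix.diagonal_transvection_induction_of_det_ne_zero
    (fun g => ∀ a ∈ U, rhoA g a ∈ U) g hg (fun D _ => hd D) (fun t => ?_) fun A B _ _ h1 h2 a ha => ?_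
  · obtain ⟨i, j, hij, c⟩ := t
    have := hu c
    have := hl c
    fin_cases i <;> fin_cases j <;>
      first
      | exact absurd rfl hij
      | simp_all [Matrix.TransvectionStruct.toMatrix, Matrix.transvection]
  · rw [rhoA_mul]
    exact h1 _ (h2 a ha)

theorem Stable.inf {U U' : Submodule ℚ NC} (h : Stable U) (h' : Stable U') : Stable (U ⊓ U') :=
  fun g hg a ha => ⟨h g hg a ha.1, h' g hg a ha.2⟩

theorem form_E (a b : NC) : form (E a) b = form a (F b) := by
  rw [E, form_derM, Matrix.transpose_single, F]

theorem form_F (a b : NC) : form (F a) b = form a (E b) := by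
  rw [form_symm, ← form_E, form_symm]

/-- The weight operator. -/
def H : NC →ₗ[ℚ] NC := derM (Matrix.diagonal ![1, -1])

theorem E_F (a : NC) : E (F a) = F (E a) + H a := by
  rw [← sub_eq_iff_eq_add', E, F, H, derM_derM]
  congr 2
  ext i j
  fin_cases i <;> fin_cases j <;> simp

theorem H_F (a : NC) : H (F a) = F (H a) - (2 : ℚ) • F a := by
  have : H (F a) - F (H a) = derM ((-2 : ℚ) • Matrix.single 1 0 1) a := by
    rw [H, F, derM_derM]
    congr 2
    ext i j
    fin_cases i <;> fin_cases j <;> simp [Matrix.single_apply, Matrix.mul_apply]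
    norm_num
  rw [← sub_eq_zero, sub_sub_eq_add_sub, add_sub_right_comm, this, F]
  have : ∀ (c : ℚ) (M : Matrix (Fin 2) (Fin 2) ℚ), derM (c • M) = c • derM M := by
    intro c M
    refine hom_ext fun l => ?_
    induction l with
    | nil => simp [word_nil, derM_one]
    | cons i l ih =>
      rw [word_cons, derM_x_mul, ih, LinearMap.smul_apply, LinearMap.smul_apply, derM_x_mul]
      simp [lin, add_mul, mul_smul]
  rw [this]
  simp

theorem H_of_mem {N a : ℕ} {y : NC} (hy : y ∈ wt N a) : H y = (2 * a - N : ℚ) • y := by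
  refine eqOn_supp (f := H) (g := (2 * a - N : ℚ) • LinearMap.id) ?_ hy
  rintro l ⟨hl, ha⟩
  rw [H, derM_diagonal_word]
  have h2 : l.count 0 + l.count 1 = l.length := by
    clear hl ha
    induction l with
    | nil => rfl
    | cons i l ih => fin_cases i <;> simp <;> omega
  have : (l.count 1 : ℚ) = N - a := by
    rw [eq_sub_iff_add_eq']; exact_mod_cast (by omega)
  simp only [this, ha]
  simp
  ring_nf

theorem E_word_mem (l : List (Fin 2)) : E (word l) ∈ wt l.length (l.count 0 + 1) := by
  induction l with
  | nil => rw [word_nil, E, derM_one]; exact zero_mem _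
  | cons i l ih =>
    rw [word_cons, E, derM_x_mul]
    refine add_mem ?_ ?_
    · fin_cases i
      · simp [lin]
      · have : lin (Matrix.single 0 1 1) 1 = x 0 := by simp [lin]
        simp only [Fin.mk_one, this, ← word_cons]
        exact word_mem_supp (by simp)
    · refine mul_mem_supp (S := {[i]}) ?_ (word_mem_supp rfl) ih
      rintro _ rfl t ⟨h1, h2⟩
      fin_cases i <;> simp [h1, h2]

theorem E_mem_wt {N a : ℕ} {y : NC} (hy : y ∈ wt N a) : E y ∈ wt N (a + 1) := by
  refine map_supp_le ?_ hy
  rintro l ⟨rfl, rfl⟩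
  exact E_word_mem l

theorem F_word_mem (l : List (Fin 2)) (a : ℕ) (ha : l.count 0 ≤ a + 1) :
    F (word l) ∈ supp {m | m.length = l.length ∧ m.count 0 + 1 = l.count 0} := by
  induction l generalizing a with
  | nil => rw [word_nil, F, derM_one]; exact zero_mem _
  | cons i l ih =>
    rw [word_cons, F, derM_x_mul]
    refine add_mem ?_ ?_
    · fin_cases i
      · have : lin (Matrix.single 1 0 1) 0 = x 1 := by simp [lin]
        simp only [Fin.zero_eta, this, ← word_cons]
        exact word_mem_supp (by simp)
      · simp [lin]
    · refine mul_mem_supp (S := {[i]}) ?_ (word_mem_supp rfl) (ih (l.count 0) (by omega))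
      rintro _ rfl t ⟨h1, h2⟩
      fin_cases i <;> simp [h1, h2]

theorem F_mem_wt {N a : ℕ} {y : NC} (hy : y ∈ wt N (a + 1)) : F y ∈ wt N a := by
  refine map_supp_le ?_ hy
  rintro l ⟨rfl, h⟩
  refine supp_mono ?_ (F_word_mem l a h.le)
  rintro m ⟨h1, h2⟩
  exact ⟨h1, by omega⟩

theorem F_of_mem_wt_zero {N : ℕ} {y : NC} (hy : y ∈ wt N 0) : F y = 0 := by
  have := map_supp_le (f := F) (U := ⊥) ?_ hy
  · simpa using this
  · rintro l ⟨rfl, h⟩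
    have := F_word_mem l 0 (by omega)
    rw [h, show {m : List (Fin 2) | m.length = l.length ∧ m.count 0 + 1 = 0} = ∅ by ext; simp] at this
    simpa [supp] using this

theorem exists_F_mem_wt {N a : ℕ} {y : NC} (hy : y ∈ wt N a) : ∃ b, F y ∈ wt N b := by
  cases a with
  | zero => exact ⟨0, by rw [F_of_mem_wt_zero hy]; exact zero_mem _⟩
  | succ a => exact ⟨a, F_mem_wt hy⟩

theorem exists_pow_F_mem_wt {N a : ℕ} {y : NC} (hy : y ∈ wt N a) (i : ℕ) :
    ∃ b, (F ^ i) y ∈ wt N b := by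
  induction i with
  | zero => exact ⟨a, hy⟩
  | succ i ih =>
    obtain ⟨b, hb⟩ := ih
    rw [pow_succ', Module.End.mul_apply]
    exact exists_F_mem_wt hb

/-- The usual sl_2 recursion; the weight of `v` is 2a − N, the number of letters 0 minus the number
of letters 1. -/
theorem E_pow_F {N a : ℕ} {v : NC} (hv : v ∈ wt N a) (hE : E v = 0) (i : ℕ) :
    E ((F ^ (i + 1)) v) = ((i + 1 : ℚ) * (2 * a - N - i)) • (F ^ i) v := by
  have hH : ∀ i : ℕ, H ((F ^ i) v) = (2 * a - N - 2 * i : ℚ) • (F ^ i) v := by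
    intro i
    induction i with
    | zero => simp [H_of_mem hv]
    | succ i ih =>
      rw [pow_succ', Module.End.mul_apply, H_F, ih]
      push_cast
      rw [map_smul]
      module
  induction i with
  | zero => simp [E_F, hE, H_of_mem hv]
  | succ i ih =>
    rw [pow_succ' F (i + 1), Module.End.mul_apply, E_F, ih, hH, map_smul, pow_succ' F i,
      Module.End.mul_apply]
    push_cast
    module

/-! ### Weight decomposition -/

/-- The projection onto a weight space. -/
def pr (N a : ℕ) : NC →ₗ[ℚ] NC := proj {l | l.length = N ∧ l.count 0 = a}

theorem pr_mem (N a : ℕ) (y : NC) : pr N a y ∈ wt N a := proj_mem _ y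

theorem pr_of_mem {N a : ℕ} {y : NC} (h : y ∈ wt N a) : pr N a y = y := proj_of_mem h

theorem pr_of_mem_of_ne {N a b : ℕ} {y : NC} (h : y ∈ wt N a) (hab : a ≠ b) : pr N b y = 0 :=
  proj_eq_zero (Set.disjoint_left.2 fun _ h1 h2 => hab (h2.2.symm.trans h1.2)) h

theorem sum_pr {N : ℕ} {y : NC} (hy : y ∈ deg N) :
    ∑ a ∈ Finset.range (N + 1), pr N a y = y := by
  have := eqOn_supp (f := ∑ a ∈ Finset.range (N + 1), pr N a) (g := LinearMap.id) ?_ hy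
  · simpa using this
  · rintro l rfl
    have hw : word l ∈ wt l.length (l.count 0) := word_mem_supp ⟨rfl, rfl⟩
    rw [LinearMap.sum_apply, Finset.sum_eq_single (l.count 0)]
    · exact pr_of_mem hw
    · exact fun b _ hb => pr_of_mem_of_ne hw hb.symm
    · intro h
      exact absurd (Finset.mem_range.2 (Nat.lt_succ_of_le List.count_le_length)) h

theorem rhoA_diagonal_of_mem (d : Fin 2 → ℚ) {N a : ℕ} {y : NC} (hy : y ∈ wt N a) :
    rhoA (Matrix.diagonal d) y = (d 0 ^ a * d 1 ^ (N - a)) • y := by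
  refine eqOn_supp (f := (rhoA (Matrix.diagonal d)).toLinearMap)
    (g := (d 0 ^ a * d 1 ^ (N - a)) • LinearMap.id) ?_ hy
  rintro l ⟨rfl, rfl⟩
  have h2 : l.count 1 = l.length - l.count 0 := by
    have : l.count 0 + l.count 1 = l.length := by
      clear hy
      induction l with
      | nil => rfl
      | cons i l ih => fin_cases i <;> simp <;> omega
    omega
  rw [AlgHom.toLinearMap_apply, rhoA_diagonal_word, h2]
  rfl

/-- On the weight a part diag(t, 1) acts by t^a, so the weight components are the coefficients of a
polynomial in t with values in `U`. -/
theorem pr_mem_of_stable {U : Submodule ℚ NC} {N : ℕ} (hUN : U ≤ deg N) (hU : Stable U) {y : NC}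
    (hy : y ∈ U) (a : ℕ) : pr N a y ∈ U := by
  by_cases ha : a < N + 1
  · refine mem_of_forall_sum_pow_smul_mem U (fun a => pr N a y) (N + 1) (fun t ht => ?_) ha
    have := hU (Matrix.diagonal ![t, 1]) (by simpa using ht) y hy
    rw [← sum_pr (hUN hy), map_sum] at this
    have e : ∑ a ∈ Finset.range (N + 1), t ^ a • pr N a y =
        ∑ a ∈ Finset.range (N + 1), rhoA (Matrix.diagonal ![t, 1]) (pr N a y) :=
      Finset.sum_congr rfl fun a _ => by
        rw [rhoA_diagonal_of_mem _ (pr_mem N a y)]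
        simp
    rw [e]
    exact this
  · have : pr N a y = 0 := by
      rw [← sum_pr (hUN hy), map_sum]
      refine Finset.sum_eq_zero fun b hb => pr_of_mem_of_ne (pr_mem N b y) ?_
      rintro rfl
      exact ha (Finset.mem_range.1 hb)
    rw [this]
    exact U.zero_mem

theorem E_pr {N : ℕ} {y : NC} (hy : y ∈ deg N) (a : ℕ) : E (pr N a y) = pr N (a + 1) (E y) := by
  suffices h : E.comp (pr N a) y = (pr N (a + 1)).comp E y from h
  refine eqOn_supp (S := {l | l.length = N}) (fun l hl => ?_) hy
  obtain rfl : l.length = N := hl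
  rw [LinearMap.comp_apply, LinearMap.comp_apply]
  have hw : word l ∈ wt l.length (l.count 0) := word_mem_supp ⟨rfl, rfl⟩
  by_cases h : l.count 0 = a
  · subst h
    rw [pr_of_mem hw, pr_of_mem (E_mem_wt hw)]
  · rw [pr_of_mem_of_ne hw h, pr_of_mem_of_ne (E_mem_wt hw) (by omega), map_zero]

theorem finrank_eq_sum_wt {X : Submodule ℚ NC} {N : ℕ} (hXN : X ≤ deg N)
    (hX : ∀ y ∈ X, ∀ a, pr N a y ∈ X) :
    Module.finrank ℚ X = ∑ a ∈ Finset.range (N + 1), Module.finrank ℚ ↥(X ⊓ wt N a) := by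
  let f : X →ₗ[ℚ] (∀ a : Fin (N + 1), ↥(X ⊓ wt N a)) :=
    LinearMap.pi fun a => ((pr N a).restrict (p := X) (q := X ⊓ wt N a)
      fun y hy => ⟨hX y hy a, pr_mem N a y⟩)
  have hf : ∀ (y : X) (a : Fin (N + 1)), ((f y a : ↥(X ⊓ wt N a)) : NC) = pr N a y :=
    fun _ _ => rfl
  have hbij : Function.Bijective f := by
    constructor
    · rw [injective_iff_map_eq_zero]
      intro y hy
      refine Subtype.ext ?_
      rw [← sum_pr (hXN y.2)]
      refine Finset.sum_eq_zero fun a ha => ?_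
      rw [← hf y ⟨a, Finset.mem_range.1 ha⟩, hy]
      rfl
    · intro z
      refine ⟨⟨∑ a, (z a : NC), X.sum_mem fun a _ => (z a).2.1⟩, ?_⟩
      funext b
      refine Subtype.ext ?_
      rw [hf, map_sum, Finset.sum_eq_single b]
      · exact pr_of_mem (z b).2.2
      · intro a _ hab
        exact pr_of_mem_of_ne (z a).2.2 fun h => hab (Fin.ext h)
      · simp
  have : ∀ a, FiniteDimensional ℚ ↥(X ⊓ wt N a) := fun a =>
    Submodule.finiteDimensional_inf_right _ _
  rw [(LinearEquiv.ofBijective f hbij).finrank_eq, Module.finrank_pi_fintype,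
    Finset.sum_range fun a => Module.finrank ℚ ↥(X ⊓ wt N a)]

/-! ### Multiplicities -/

/-- If Ey = 0 then ⟨Fy, Fy⟩ = ⟨y, EFy⟩ = (2a − N)⟨y, y⟩, with a negative factor; positivity forces y
= 0. So there are no highest weight vectors below the middle weight. -/
theorem eq_zero_of_E_eq_zero {N a : ℕ} (h : 2 * a < N) {y : NC} (hy : y ∈ wt N a)
    (hE : E y = 0) : y = 0 := by
  have h1 : form (F y) (F y) = (2 * a - N : ℚ) * form y y := by
    rw [form_F, E_F, hE, map_zero, zero_add, H_of_mem hy, map_smul, smul_eq_mul]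
  have h2 := form_self_nonneg (F y)
  have h3 := form_self_nonneg y
  have h4 : (2 * a - N : ℚ) < 0 := by
    rw [sub_neg]; exact_mod_cast h
  refine eq_zero_of_form_self ?_
  nlinarith

theorem eq_zero_of_F_eq_zero {N a : ℕ} (h : N < 2 * a) {y : NC} (hy : y ∈ wt N a)
    (hF : F y = 0) : y = 0 := by
  have h1 : form (E y) (E y) = -(2 * a - N : ℚ) * form y y := by
    have := E_F y
    rw [hF, map_zero, H_of_mem hy, eq_comm, add_eq_zero_iff_eq_neg] at this
    rw [form_E, this, map_neg, map_smul, smul_eq_mul, neg_mul]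
  have h2 := form_self_nonneg (E y)
  have h3 := form_self_nonneg y
  have h4 : 0 < (2 * a - N : ℚ) := by
    rw [sub_pos]; exact_mod_cast h
  refine eq_zero_of_form_self ?_
  nlinarith

/-- On weight a + 1, above the middle, `F` is injective, and then so is E ∘ F, since EFy = 0 gives
⟨Fy, Fy⟩ = 0. An injective endomorphism in finite dimension is onto, so `E` is onto and rank–nullity
applies. -/
theorem finrank_hw_wt {U : Submodule ℚ NC} {N : ℕ} (hUN : U ≤ deg N) (hU : Stable U) {a : ℕ}
    (ha : N ≤ 2 * a) :
    Module.finrank ℚ ↥(U ⊓ wt N a ⊓ LinearMap.ker E) + Module.finrank ℚ ↥(U ⊓ wt N (a + 1)) =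
      Module.finrank ℚ ↥(U ⊓ wt N a) := by
  have : ∀ a, FiniteDimensional ℚ ↥(U ⊓ wt N a) := fun a =>
    Submodule.finiteDimensional_inf_right _ _
  let e : ↥(U ⊓ wt N a) →ₗ[ℚ] ↥(U ⊓ wt N (a + 1)) := E.restrict fun y hy =>
    ⟨E_mem hUN hU hy.1, E_mem_wt hy.2⟩
  let f : ↥(U ⊓ wt N (a + 1)) →ₗ[ℚ] ↥(U ⊓ wt N a) := F.restrict fun y hy =>
    ⟨F_mem hUN hU hy.1, F_mem_wt hy.2⟩
  have hinj : Function.Injective (e.comp f) := by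
    rw [injective_iff_map_eq_zero]
    intro y hy
    have h : E (F y.1) = 0 := congrArg Subtype.val hy
    refine Subtype.ext (eq_zero_of_F_eq_zero (by omega) y.2.2 (eq_zero_of_form_self ?_))
    rw [form_F, h, map_zero]
  have hsurj : Function.Surjective e := by
    have := LinearMap.injective_iff_surjective.1 hinj
    rw [LinearMap.coe_comp] at this
    exact this.of_comp
  have h := e.finrank_range_add_finrank_ker
  rw [LinearMap.range_eq_top.2 hsurj, finrank_top] at h
  have hk : LinearMap.ker e = (U ⊓ wt N a ⊓ LinearMap.ker E).comap (U ⊓ wt N a).subtype := by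
    ext y
    simp only [LinearMap.mem_ker, Submodule.mem_comap, Submodule.subtype_apply, Submodule.mem_inf]
    exact ⟨fun h => ⟨y.2, congrArg Subtype.val h⟩, fun h => Subtype.ext h.2⟩
  rw [hk, (Submodule.comapSubtypeEquivOfLe inf_le_left).finrank_eq] at h
  omega

theorem wt_eq_bot {N a : ℕ} (h : N < a) : wt N a = ⊥ := by
  have : {l : List (Fin 2) | l.length = N ∧ l.count 0 = a} = ∅ := by
    ext l
    simp only [Set.mem_ofPred_eq, Set.mem_empty_iff_false, iff_false]
    rintro ⟨rfl, rfl⟩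
    exact absurd List.count_le_length (not_le.2 h)
  rw [wt, supp, this]
  simp

/-- Highest weight vectors occur only in weights at least ⌈N/2⌉, and from there `finrank_hw_wt`
telescopes up to the zero space of weight N + 1. Equivalently, each irreducible meets the middle
weight space in a line. -/
theorem finrank_hw {U : Submodule ℚ NC} {N : ℕ} (hUN : U ≤ deg N) (hU : Stable U) :
    Module.finrank ℚ ↥(U ⊓ LinearMap.ker E) = Module.finrank ℚ ↥(U ⊓ wt N ((N + 1) / 2)) := by
  rw [finrank_eq_sum_wt (N := N) (inf_le_left.trans hUN)]
  · have hcomm : ∀ a, Module.finrank ℚ ↥(U ⊓ LinearMap.ker E ⊓ wt N a) =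
        Module.finrank ℚ ↥(U ⊓ wt N a ⊓ LinearMap.ker E) := fun a => by rw [inf_right_comm]
    rw [Finset.sum_congr rfl fun a _ => hcomm a]
    have hlow : ∀ a, 2 * a < N → Module.finrank ℚ ↥(U ⊓ wt N a ⊓ LinearMap.ker E) = 0 := by
      intro a ha
      have : U ⊓ wt N a ⊓ LinearMap.ker E = ⊥ := by
        rw [eq_bot_iff]
        rintro y ⟨⟨_, h1⟩, h2⟩
        exact eq_zero_of_E_eq_zero ha h1 h2
      rw [this, finrank_bot]
    have key : ∀ k, k ≤ N + 1 - (N + 1) / 2 →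
        Module.finrank ℚ ↥(U ⊓ wt N ((N + 1) / 2)) =
          ∑ a ∈ Finset.range k, Module.finrank ℚ ↥(U ⊓ wt N ((N + 1) / 2 + a) ⊓ LinearMap.ker E) +
            Module.finrank ℚ ↥(U ⊓ wt N ((N + 1) / 2 + k)) := by
      intro k
      induction k with
      | zero => simp
      | succ k ih =>
        intro hk
        rw [ih (by omega), Finset.sum_range_succ, add_assoc, ← add_assoc _ k,
          finrank_hw_wt hUN hU (by omega)]
    rw [key _ le_rfl, wt_eq_bot (a := (N + 1) / 2 + (N + 1 - (N + 1) / 2)) (by omega), inf_bot_eq,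
      finrank_bot, add_zero]
    conv_lhs => rw [show N + 1 = (N + 1) / 2 + (N + 1 - (N + 1) / 2) by omega,
      Finset.sum_range_add]
    rw [Finset.sum_eq_zero fun a ha => hlow a (by have := Finset.mem_range.1 ha; omega), zero_add]
  · rintro y ⟨h1, h2⟩ a
    refine ⟨pr_mem_of_stable hUN hU h1 a, ?_⟩
    change E (pr N a y) = 0
    rw [E_pr (hUN h1), LinearMap.mem_ker.1 h2, map_zero]

/-- Positive definiteness makes the form nondegenerate on `X`, so the functional that `u` induces on
`X` is represented by an element of `X`. -/
theorem exists_orthogonal (X : Submodule ℚ NC) [FiniteDimensional ℚ X] (u : NC) :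
    ∃ y ∈ X, ∀ v ∈ X, form v (u - y) = 0 := by
  let f : X →ₗ[ℚ] Module.Dual ℚ X := (form.domRestrict₁₂ X X)
  have hinj : Function.Injective f := by
    rw [injective_iff_map_eq_zero]
    intro y hy
    exact Subtype.ext (eq_zero_of_form_self (DFunLike.congr_fun hy y))
  have hsurj : Function.Surjective f :=
    (LinearMap.injective_iff_surjective_of_finrank_eq_finrank
      Subspace.dual_finrank_eq.symm).1 hinj
  obtain ⟨y, hy⟩ := hsurj ((form u).comp X.subtype)
  refine ⟨y, y.2, fun v hv => ?_⟩
  have := DFunLike.congr_fun hy ⟨v, hv⟩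
  change form y v = form u v at this
  rw [map_sub, form_symm v, form_symm v, this, sub_self]

/-- The orthogonal complement of `X` in `U`. -/
def orth (X U : Submodule ℚ NC) : Submodule ℚ NC where
  carrier := {u | u ∈ U ∧ ∀ v ∈ X, form v u = 0}
  add_mem' h1 h2 := ⟨U.add_mem h1.1 h2.1, fun v hv => by rw [map_add, h1.2 v hv, h2.2 v hv, add_zero]⟩
  zero_mem' := ⟨U.zero_mem, fun v _ => map_zero _⟩
  smul_mem' c u h := ⟨U.smul_mem c h.1, fun v hv => by rw [map_smul, h.2 v hv, smul_zero]⟩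

theorem orth_stable {X U : Submodule ℚ NC} (hX : Stable X) (hU : Stable U) : Stable (orth X U) :=
  fun g hg a ha => ⟨hU g hg a ha.1, fun v hv => by
    rw [form_symm, form_rhoA, form_symm]
    exact ha.2 _ (hX _ (by rwa [Matrix.det_transpose]) v hv)⟩

theorem pow_E_eq_zero {N : ℕ} {y : NC} (hy : y ∈ deg N) : (E ^ (N + 1)) y = 0 := by
  have key : ∀ (k a : ℕ) (y : NC), y ∈ wt N a → (E ^ k) y ∈ wt N (a + k) := by
    intro k
    induction k with
    | zero => exact fun a y h => h
    | succ k ih =>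
      intro a y h
      rw [pow_succ', Module.End.mul_apply]
      exact E_mem_wt (ih a y h)
  rw [← sum_pr hy, map_sum]
  refine Finset.sum_eq_zero fun a _ => ?_
  have := key (N + 1) a _ (pr_mem N a y)
  rwa [wt_eq_bot (by omega), Submodule.mem_bot] at this

/-- Apply `E` up to the last nonzero vector and take a nonzero weight component of it; `E` shifts
the weight grading, so it still kills the component. -/
theorem exists_hw {U : Submodule ℚ NC} {N : ℕ} (hUN : U ≤ deg N) (hU : Stable U) (h0 : U ≠ ⊥) :
    ∃ a, ∃ v ∈ U, v ∈ wt N a ∧ E v = 0 ∧ v ≠ 0 := by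
  obtain ⟨y, hy, hy0⟩ := (Submodule.ne_bot_iff U).1 h0
  have hmem : ∀ k, (E ^ k) y ∈ U := by
    intro k
    induction k with
    | zero => exact hy
    | succ k ih => rw [pow_succ', Module.End.mul_apply]; exact E_mem hUN hU ih
  classical
  have hex : ∃ k, (E ^ k) y = 0 := ⟨N + 1, pow_E_eq_zero (hUN hy)⟩
  obtain ⟨k, hk⟩ : ∃ k, Nat.find hex = k + 1 := by
    refine Nat.exists_eq_succ_of_ne_zero fun h => hy0 ?_
    have := Nat.find_spec hex
    rwa [h] at this
  have hz : (E ^ k) y ≠ 0 := Nat.find_min hex (by omega)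
  have hEz : E ((E ^ k) y) = 0 := by
    rw [← Module.End.mul_apply, ← pow_succ', ← hk]
    exact Nat.find_spec hex
  obtain ⟨a, ha⟩ : ∃ a, pr N a ((E ^ k) y) ≠ 0 := by
    by_contra! h
    refine hz ?_
    rw [← sum_pr (hUN (hmem k))]
    exact Finset.sum_eq_zero fun a _ => h a
  refine ⟨a, pr N a ((E ^ k) y), pr_mem_of_stable hUN hU (hmem k) a, pr_mem N a _, ?_, ha⟩
  rw [E_pr (hUN (hmem k)), hEz, map_zero]

/-- The orthogonal complement of `U'` in `U` is stable and nonzero, so it contains a highest weight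
vector, which by definiteness is not in `U'`. -/
theorem hw_lt {U U' : Submodule ℚ NC} {N : ℕ} (hUN : U ≤ deg N) (hU : Stable U) (hU' : Stable U')
    (h : U' < U) : U' ⊓ LinearMap.ker E < U ⊓ LinearMap.ker E := by
  refine lt_of_le_of_ne (inf_le_inf_right _ h.le) fun heq => ?_
  have : FiniteDimensional ℚ U' := Submodule.finiteDimensional_of_le (h.le.trans hUN)
  have hne : orth U' U ≠ ⊥ := by
    obtain ⟨u, hu, hu'⟩ := SetLike.exists_of_lt h
    obtain ⟨y, hy, horth⟩ := exists_orthogonal U' u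
    refine (Submodule.ne_bot_iff _).2 ⟨u - y, ⟨U.sub_mem hu (h.le hy), horth⟩, fun h0 => hu' ?_⟩
    rw [sub_eq_zero.1 h0]
    exact hy
  obtain ⟨a, v, hv, -, hE, hv0⟩ := exists_hw (U := orth U' U) (fun _ hy => hUN hy.1)
    (orth_stable hU' hU) hne
  have hv' : v ∈ U' ⊓ LinearMap.ker E := heq ▸ ⟨hv.1, hE⟩
  exact hv0 (eq_zero_of_form_self (hv.2 v hv'.1))

/-- The span of the vectors obtained from `v` by lowering. -/
def hwSpan (v : NC) : Submodule ℚ NC := Submodule.span ℚ (Set.range fun i : ℕ => (F ^ i) v)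

theorem pow_F_mem_hwSpan (v : NC) (i : ℕ) : (F ^ i) v ∈ hwSpan v := Submodule.subset_span ⟨i, rfl⟩

theorem hwSpan_le {v : NC} {U : Submodule ℚ NC} (h : ∀ i, (F ^ i) v ∈ U) : hwSpan v ≤ U :=
  Submodule.span_le.2 (by rintro _ ⟨i, rfl⟩; exact h i)

theorem derM_pow_mem {X : Submodule ℚ NC} {M : Matrix (Fin 2) (Fin 2) ℚ}
    (h : ∀ y ∈ X, derM M y ∈ X) {y : NC} (hy : y ∈ X) (i : ℕ) : (derM M ^ i) y ∈ X := by
  induction i with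
  | zero => exact hy
  | succ i ih => rw [pow_succ', Module.End.mul_apply]; exact h _ ih

theorem rhoA_one_add_mem {X : Submodule ℚ NC} {N : ℕ} (hX : X ≤ deg N)
    {M : Matrix (Fin 2) (Fin 2) ℚ} (hM : M * M = 0) (h : ∀ y ∈ X, derM M y ∈ X) (t : ℚ) {y : NC}
    (hy : y ∈ X) : rhoA (1 + t • M) y ∈ X := by
  rw [rhoA_one_add hM t (hX hy) (N + 1) (by omega)]
  exact X.sum_mem fun i _ => X.smul_mem _ (X.smul_mem _ (derM_pow_mem h hy i))

theorem hwSpan_le_deg {N a : ℕ} {v : NC} (hv : v ∈ wt N a) : hwSpan v ≤ deg N :=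
  hwSpan_le fun i => by
    obtain ⟨b, hb⟩ := exists_pow_F_mem_wt hv i
    exact wt_le_deg N b hb

/-- The vectors F^i v are weight vectors and `E_pow_F` sends each back to a multiple of its
predecessor; closure under `E` and `F` exponentiates to the transvections. -/
theorem hwSpan_stable {N a : ℕ} {v : NC} (hv : v ∈ wt N a) (hE : E v = 0) :
    Stable (hwSpan v) := by
  have hle := hwSpan_le_deg hv
  refine stable_of_generators (fun d y hy => ?_)
    (fun t y hy => rhoA_one_add_mem hle upper_sq (fun y hy => ?_) t hy)
    (fun t y hy => rhoA_one_add_mem hle lower_sq (fun y hy => ?_) t hy)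
  · have : hwSpan v ≤ (hwSpan v).comap (rhoA (Matrix.diagonal d)).toLinearMap := by
      refine hwSpan_le fun i => ?_
      obtain ⟨b, hb⟩ := exists_pow_F_mem_wt hv i
      rw [Submodule.mem_comap, AlgHom.toLinearMap_apply, rhoA_diagonal_of_mem d hb]
      exact Submodule.smul_mem _ _ (pow_F_mem_hwSpan v i)
    exact this hy
  · have : hwSpan v ≤ (hwSpan v).comap E := by
      refine hwSpan_le fun i => ?_
      rw [Submodule.mem_comap]
      cases i with
      | zero => rw [pow_zero, Module.End.one_apply, hE]; exact zero_mem _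
      | succ i => rw [E_pow_F hv hE]; exact Submodule.smul_mem _ _ (pow_F_mem_hwSpan v i)
    exact this hy
  · have : hwSpan v ≤ (hwSpan v).comap F := by
      refine hwSpan_le fun i => ?_
      rw [Submodule.mem_comap, ← Module.End.mul_apply, ← pow_succ']
      exact pow_F_mem_hwSpan v (i + 1)
    exact this hy

/-- Take the orthogonal complement of the span of all F^i v. If w is a highest weight vector with
⟨v, w⟩ = 0, then w is orthogonal to every F^i v because F is adjoint to E; so a single linear
condition on highest weight vectors is imposed. -/
theorem exists_stable_lt {U : Submodule ℚ NC} {N : ℕ} (hUN : U ≤ deg N) (hU : Stable U)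
    (h0 : U ≠ ⊥) : ∃ U' < U, Stable U' ∧ Module.finrank ℚ ↥(U ⊓ LinearMap.ker E) ≤
      Module.finrank ℚ ↥(U' ⊓ LinearMap.ker E) + 1 := by
  obtain ⟨a, v, hvU, hv, hE, hv0⟩ := exists_hw hUN hU h0
  have : FiniteDimensional ℚ U := Submodule.finiteDimensional_of_le hUN
  have : FiniteDimensional ℚ ↥(U ⊓ LinearMap.ker E) := Submodule.finiteDimensional_inf_left _ _
  refine ⟨orth (hwSpan v) U, lt_of_le_of_ne (fun _ hy => hy.1) fun heq => ?_,
    orth_stable (hwSpan_stable hv hE) hU, ?_⟩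
  · have hv' : v ∈ orth (hwSpan v) U := heq.symm ▸ hvU
    exact hv0 (eq_zero_of_form_self (hv'.2 v (pow_F_mem_hwSpan v 0)))
  · let f : ↥(U ⊓ LinearMap.ker E) →ₗ[ℚ] ℚ := (form v).comp (Submodule.subtype _)
    have h := f.finrank_range_add_finrank_ker
    have h1 : Module.finrank ℚ (LinearMap.range f) ≤ 1 :=
      (Submodule.finrank_le _).trans (Module.finrank_self ℚ).le
    have hk : (LinearMap.ker f).map (Submodule.subtype _) ≤
        orth (hwSpan v) U ⊓ LinearMap.ker E := by
      rintro _ ⟨⟨w, hwU, hwE⟩, hw, rfl⟩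
      have hw : form v w = 0 := hw
      refine ⟨⟨hwU, fun y hy => ?_⟩, hwE⟩
      have : hwSpan v ≤ LinearMap.ker (form w) := by
        refine hwSpan_le fun i => ?_
        rw [LinearMap.mem_ker, form_symm]
        cases i with
        | zero => exact hw
        | succ i =>
          rw [pow_succ', Module.End.mul_apply, form_F, LinearMap.mem_ker.1 hwE, map_zero]
      rw [Submodule.subtype_apply, form_symm]
      exact this hy
    have : FiniteDimensional ℚ ↥(orth (hwSpan v) U ⊓ LinearMap.ker E) :=
      Submodule.finiteDimensional_of_le (S₂ := U) fun y hy => hy.1.1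
    have h2 := Submodule.finrank_mono hk
    rw [LinearEquiv.finrank_eq (Submodule.equivMapOfInjective _
      (Submodule.injective_subtype _) _).symm] at h2
    omega

end NC

end

section

open NC

/-! ### Representations realized in the free associative algebra -/

/-- A realization of `ρ ⊗ det^k` on a space of elements of degree `N` of the free associative
algebra. -/
structure Model {V : Type*} [AddCommGroup V] [Module ℚ V]
    (ρ : Representation ℚ (GL (Fin 2) ℚ) V) (N k : ℕ) where
  /-- the embedding -/
  j : V →ₗ[ℚ] NC
  inj : Function.Injective j
  range_le : LinearMap.range j ≤ deg N
  comp : ∀ g v, g.1.det ^ k • j (ρ g v) = rhoA g.1 (j v)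

namespace Model

variable {V : Type*} [AddCommGroup V] [Module ℚ V] {ρ : Representation ℚ (GL (Fin 2) ℚ) V}
  {N k : ℕ} (m : Model ρ N k)

theorem det_ne_zero (g : GL (Fin 2) ℚ) : g.1.det ≠ 0 :=
  ((Matrix.isUnit_iff_isUnit_det _).1 g.isUnit).ne_zero

include m in
theorem finiteDimensional : FiniteDimensional ℚ V := by
  have : FiniteDimensional ℚ (LinearMap.range m.j) :=
    Submodule.finiteDimensional_of_le m.range_le
  exact FiniteDimensional.of_injective m.j.rangeRestrict fun a b h =>
    m.inj (congrArg Subtype.val h)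

/-- The image of a subrepresentation. -/
def img (S : Subrepresentation ρ) : Submodule ℚ NC := S.toSubmodule.map m.j

theorem img_le (S : Subrepresentation ρ) : m.img S ≤ deg N :=
  LinearMap.map_le_range.trans m.range_le

theorem img_stable (S : Subrepresentation ρ) : Stable (m.img S) := by
  rintro g hg _ ⟨v, hv, rfl⟩
  have := m.comp (Matrix.GeneralLinearGroup.mkOfDetNeZero g hg) v
  change _ = rhoA g (m.j v) at this
  rw [← this]
  exact Submodule.smul_mem _ _ ⟨_, S.apply_mem_toSubmodule _ hv, rfl⟩

/-- The subrepresentation of the vectors with image in a stable subspace. -/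
def preimg (U : Submodule ℚ NC) (hU : Stable U) : Subrepresentation ρ where
  toSubmodule := U.comap m.j
  apply_mem_toSubmodule g v hv := by
    have := hU g.1 (det_ne_zero g) _ hv
    rw [← m.comp] at this
    exact (Submodule.smul_mem_iff U (pow_ne_zero k (det_ne_zero g))).1 this

theorem img_preimg {U : Submodule ℚ NC} (hU : Stable U) (hle : U ≤ LinearMap.range m.j) :
    m.img (m.preimg U hU) = U :=
  Submodule.map_comap_eq_of_le hle

theorem img_top : m.img ⊤ = LinearMap.range m.j := Submodule.map_top _

theorem img_lt_img {S T : Subrepresentation ρ} : m.img S < m.img T ↔ S < T := by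
  have h : ∀ S T : Subrepresentation ρ, m.img S ≤ m.img T ↔ S ≤ T := fun S T =>
    Submodule.map_le_map_iff_of_injective m.inj _ _
  rw [lt_iff_le_not_ge, lt_iff_le_not_ge, h, h]

-- The complement of a subrepresentation is pulled back from the orthogonal complement of its image.
include m in
theorem isSemisimple : ρ.IsSemisimpleRepresentation := by
  refine ⟨fun S => ?_⟩
  have hst := orth_stable (m.img_stable S) (m.img_stable ⊤)
  have : FiniteDimensional ℚ (m.img S) := Submodule.finiteDimensional_of_le (m.img_le S)
  refine ⟨m.preimg _ hst, ?_, ?_⟩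
  · rw [disjoint_iff_inf_le]
    rintro v ⟨h1, h2⟩
    have : m.j v = 0 := eq_zero_of_form_self (h2.2 _ ⟨v, h1, rfl⟩)
    exact m.inj (this.trans (map_zero _).symm)
  · rw [codisjoint_iff_le_sup]
    intro v _
    obtain ⟨_, ⟨s, hs, rfl⟩, hy⟩ := exists_orthogonal (m.img S) (m.j v)
    have hsub : v - s ∈ (m.preimg _ hst).toSubmodule :=
      ⟨⟨v - s, trivial, rfl⟩, fun w hw => by rw [map_sub]; exact hy w hw⟩
    have := Submodule.add_mem_sup hs hsub
    rwa [add_sub_cancel] at this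

/-- The dimension of the space of highest weight vectors is strictly increasing along chains by
`hw_lt`, and `exists_stable_lt` provides a chain along which it drops by exactly one each time. -/
theorem height_eq (S : Subrepresentation ρ) :
    Order.height S = (Module.finrank ℚ ↥(m.img S ⊓ LinearMap.ker E) : ℕ∞) := by
  have hfd : ∀ S : Subrepresentation ρ, FiniteDimensional ℚ ↥(m.img S ⊓ LinearMap.ker E) :=
    fun S => Submodule.finiteDimensional_of_le (inf_le_left.trans (m.img_le S))
  refine le_antisymm ?_ ?_
  · have hmono : StrictMono fun S : Subrepresentation ρ =>
        Module.finrank ℚ ↥(m.img S ⊓ LinearMap.ker E) := fun S T h =>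
      Submodule.finrank_lt_finrank_of_lt
        (hw_lt (m.img_le T) (m.img_stable T) (m.img_stable S) (m.img_lt_img.2 h))
    have := Order.height_le_height_apply_of_strictMono _ hmono S
    rwa [Order.height_nat] at this
  · induction hn : Module.finrank ℚ ↥(m.img S ⊓ LinearMap.ker E) generalizing S with
    | zero => simp
    | succ n ih =>
      have h0 : m.img S ≠ ⊥ := by
        intro h
        rw [h, bot_inf_eq, finrank_bot] at hn
        omega
      obtain ⟨U', hlt, hst, hrank⟩ := exists_stable_lt (m.img_le S) (m.img_stable S) h0
      have himg := m.img_preimg hst (hlt.le.trans LinearMap.map_le_range)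
      have hS : m.preimg U' hst < S := m.img_lt_img.1 (by rwa [himg])
      obtain ⟨T, hT, hTn⟩ : ∃ T < S, (n : ℕ∞) ≤ Order.height T := by
        refine ⟨m.preimg U' hst, hS, ?_⟩
        have hlt' := Submodule.finrank_lt_finrank_of_lt
          (hw_lt (m.img_le S) (m.img_stable S) hst hlt)
        refine ih _ ?_
        rw [himg]
        omega
      push_cast
      exact (add_le_add_left hTn 1).trans (Order.height_add_one_le hT)

theorem irreducibleCount_eq : irreducibleCount ρ =
    (Module.finrank ℚ ↥(LinearMap.range m.j ⊓ wt N ((N + 1) / 2)) : ℕ∞) := by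
  rw [irreducibleCount, Module.length_eq_height,
    ← finrank_hw m.range_le (m.img_top ▸ m.img_stable ⊤), ← m.img_top, ← m.height_eq]
  -- The length is the height of the top submodule over the group algebra, and such submodules are
  -- the subrepresentations.
  rw [← Order.height_orderIso Subrepresentation.subrepresentationSubmoduleOrderIso,
    map_top]

end Model

end

section

open NC

/-! ### Intertwining maps out of the irreducible representations -/

theorem add_induction_homogeneous {m : ℕ} {V : Type*} [AddCommGroup V] [Module ℚ V]
    {f g : MvPolynomial (Fin 2) ℚ →ₗ[ℚ] V}
    (h : ∀ p q, p + q = m → f (MvPolynomial.X 0 ^ p * MvPolynomial.X 1 ^ q) =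
      g (MvPolynomial.X 0 ^ p * MvPolynomial.X 1 ^ q))
    {P : MvPolynomial (Fin 2) ℚ} (hP : P ∈ MvPolynomial.homogeneousSubmodule (Fin 2) ℚ m) :
    f P = g P := by
  rw [MvPolynomial.mem_homogeneousSubmodule] at hP
  rw [P.as_sum, map_sum, map_sum]
  refine Finset.sum_congr rfl fun d hd => ?_
  have hdeg := hP (MvPolynomial.mem_support_iff.1 hd)
  have e : MvPolynomial.monomial d (MvPolynomial.coeff d P) =
      MvPolynomial.coeff d P • (MvPolynomial.X 0 ^ d 0 * MvPolynomial.X 1 ^ d 1) := by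
    rw [MvPolynomial.monomial_eq, Finsupp.prod_fintype _ _ (by simp), Fin.prod_univ_two,
      MvPolynomial.smul_eq_C_mul]
  rw [e, map_smul, map_smul, h]
  rw [← hdeg, Finsupp.weight_apply, Finsupp.sum_fintype _ _ (by simp)]
  simp

theorem monomial_mem {m p q : ℕ} (h : p + q = m) :
    (MvPolynomial.X 0 ^ p * MvPolynomial.X 1 ^ q : MvPolynomial (Fin 2) ℚ) ∈
      MvPolynomial.homogeneousSubmodule (Fin 2) ℚ m := by
  subst h
  exact (MvPolynomial.isHomogeneous_X_pow 0 p).mul (MvPolynomial.isHomogeneous_X_pow 1 q)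

theorem subst_monomial (g : Matrix (Fin 2) (Fin 2) ℚ) (p q : ℕ) :
    subst g (MvPolynomial.X 0 ^ p * MvPolynomial.X 1 ^ q) =
      (g 0 0 • MvPolynomial.X 0 + g 1 0 • MvPolynomial.X 1) ^ p *
        (g 0 1 • MvPolynomial.X 0 + g 1 1 • MvPolynomial.X 1) ^ q := by
  simp [subst, MvPolynomial.smul_eq_C_mul]

theorem subst_diagonal (d : Fin 2 → ℚ) (p q : ℕ) :
    subst (Matrix.diagonal d) (MvPolynomial.X 0 ^ p * MvPolynomial.X 1 ^ q) =
      (d 0 ^ p * d 1 ^ q) • (MvPolynomial.X 0 ^ p * MvPolynomial.X 1 ^ q) := by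
  rw [subst_monomial]
  simp only [Matrix.diagonal_apply_eq, smul_pow, ne_eq, zero_ne_one, not_false_eq_true,
    Matrix.diagonal_apply_ne, one_ne_zero, zero_smul, add_zero, zero_add]
  rw [smul_mul_smul_comm]

theorem subst_upper (t : ℚ) (p q : ℕ) :
    subst (1 + t • Matrix.single 0 1 1) (MvPolynomial.X 0 ^ p * MvPolynomial.X 1 ^ q) =
      ∑ i ∈ Finset.range (q + 1), t ^ i • ((q.choose i : ℚ) •
        (MvPolynomial.X 0 ^ (p + i) * MvPolynomial.X 1 ^ (q - i))) := by
  rw [subst_monomial]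
  simp only [Matrix.add_apply, Matrix.smul_apply, Matrix.single_apply, Matrix.one_apply]
  simp only [Fin.isValue, ↓reduceIte, and_false, one_ne_zero, zero_ne_one, smul_eq_mul,
    mul_zero, mul_one, add_zero, zero_add, one_smul, zero_smul, and_self, false_and]
  rw [add_pow, Finset.mul_sum]
  refine Finset.sum_congr rfl fun i _ => ?_
  rw [smul_pow, pow_add, MvPolynomial.smul_eq_C_mul, MvPolynomial.smul_eq_C_mul,
    MvPolynomial.smul_eq_C_mul]
  rw [map_natCast]
  ring

theorem subst_lower (t : ℚ) (p q : ℕ) :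
    subst (1 + t • Matrix.single 1 0 1) (MvPolynomial.X 0 ^ p * MvPolynomial.X 1 ^ q) =
      ∑ i ∈ Finset.range (p + 1), t ^ i • ((p.choose i : ℚ) •
        (MvPolynomial.X 0 ^ (p - i) * MvPolynomial.X 1 ^ (q + i))) := by
  rw [subst_monomial]
  simp only [Matrix.add_apply, Matrix.smul_apply, Matrix.single_apply, Matrix.one_apply]
  simp only [Fin.isValue, ↓reduceIte, and_false, one_ne_zero, zero_ne_one, smul_eq_mul,
    mul_zero, mul_one, add_zero, zero_add, one_smul, zero_smul, and_self, false_and]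
  rw [add_comm, add_pow, Finset.sum_mul]
  refine Finset.sum_congr rfl fun i _ => ?_
  rw [smul_pow, pow_add, MvPolynomial.smul_eq_C_mul, MvPolynomial.smul_eq_C_mul,
    MvPolynomial.smul_eq_C_mul]
  rw [map_natCast]
  ring

/-- The property is multiplicative in g, so the torus and the two root subgroups suffice. The
exponent `c` records the twist by a power of det. -/
theorem hom_equivariant_of_generators {m c : ℕ} {f : MvPolynomial (Fin 2) ℚ →ₗ[ℚ] NC}
    (hd : ∀ d : Fin 2 → ℚ, ∀ p q, p + q = m →
      rhoA (Matrix.diagonal d) (f (MvPolynomial.X 0 ^ p * MvPolynomial.X 1 ^ q)) =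
        ((d 0 * d 1) ^ c * (d 0 ^ p * d 1 ^ q)) • f (MvPolynomial.X 0 ^ p * MvPolynomial.X 1 ^ q))
    (hu : ∀ t : ℚ, ∀ p q, p + q = m →
      rhoA (1 + t • Matrix.single 0 1 1) (f (MvPolynomial.X 0 ^ p * MvPolynomial.X 1 ^ q)) =
        ∑ i ∈ Finset.range (q + 1), t ^ i • ((q.choose i : ℚ) •
          f (MvPolynomial.X 0 ^ (p + i) * MvPolynomial.X 1 ^ (q - i))))
    (hl : ∀ t : ℚ, ∀ p q, p + q = m →
      rhoA (1 + t • Matrix.single 1 0 1) (f (MvPolynomial.X 0 ^ p * MvPolynomial.X 1 ^ q)) =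
        ∑ i ∈ Finset.range (p + 1), t ^ i • ((p.choose i : ℚ) •
          f (MvPolynomial.X 0 ^ (p - i) * MvPolynomial.X 1 ^ (q + i))))
    {g : Matrix (Fin 2) (Fin 2) ℚ} (hg : g.det ≠ 0) {P : MvPolynomial (Fin 2) ℚ}
    (hP : P ∈ MvPolynomial.homogeneousSubmodule (Fin 2) ℚ m) :
    rhoA g (f P) = g.det ^ c • f (subst g P) := by
  have lift : ∀ g : Matrix (Fin 2) (Fin 2) ℚ, (∀ p q, p + q = m →
      rhoA g (f (MvPolynomial.X 0 ^ p * MvPolynomial.X 1 ^ q)) =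
        g.det ^ c • f (subst g (MvPolynomial.X 0 ^ p * MvPolynomial.X 1 ^ q))) →
      ∀ P ∈ MvPolynomial.homogeneousSubmodule (Fin 2) ℚ m,
        rhoA g (f P) = g.det ^ c • f (subst g P) := by
    intro g h P hP
    exact add_induction_homogeneous (f := (rhoA g).toLinearMap.comp f)
      (g := g.det ^ c • f.comp (subst g).toLinearMap) h hP
  refine Matrix.diagonal_transvection_induction_of_det_ne_zero
    (fun g => ∀ P ∈ MvPolynomial.homogeneousSubmodule (Fin 2) ℚ m,
      rhoA g (f P) = g.det ^ c • f (subst g P)) g hg (fun D _ => ?_) (fun t => ?_)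
      (fun A B _ _ hA hB P hP => ?_) P hP
  · refine lift _ fun p q h => ?_
    rw [hd D p q h, subst_diagonal, map_smul, smul_smul, Matrix.det_diagonal, Fin.prod_univ_two]
  · obtain ⟨i, j, hij, s⟩ := t
    have h1 := lift (1 + s • Matrix.single 0 1 1) fun p q h => by
      rw [hu s p q h, subst_upper, det_upper, one_pow, one_smul]
      simp only [map_sum, map_smul]
    have h2 := lift (1 + s • Matrix.single 1 0 1) fun p q h => by
      rw [hl s p q h, subst_lower, det_lower, one_pow, one_smul]
      simp only [map_sum, map_smul]
    rw [Matrix.smul_single, smul_eq_mul, mul_one] at h1 h2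
    fin_cases i <;> fin_cases j
    · exact absurd rfl hij
    · exact h1
    · exact h2
    · exact absurd rfl hij
  · rw [rhoA_mul, AlgHom.comp_apply, hB P hP, map_smul, hA _ (subst_mem B m hP), subst_mul,
      AlgHom.comp_apply, smul_smul, Matrix.det_mul, mul_pow, mul_comm]

/-- For t ≠ 0 the equation can be divided by t, and the constant coefficient of what remains is E y.
-/
theorem E_eq_zero_of_fixed {N : ℕ} {y : NC} (hy : y ∈ deg N)
    (h : ∀ t : ℚ, rhoA (1 + t • Matrix.single 0 1 1) y = y) : E y = 0 := by
  have := mem_of_forall_sum_pow_smul_mem (⊥ : Submodule ℚ NC)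
    (fun i => ((i + 1).factorial : ℚ)⁻¹ • (E ^ (i + 1)) y) (N + 1) (fun t ht => ?_) (i := 0)
    (by omega)
  · simpa using this
  · have h1 := rhoA_one_add upper_sq t hy (N + 2) (by omega)
    rw [h t, Finset.sum_range_succ'] at h1
    have h2 : t • ∑ i ∈ Finset.range (N + 1),
        t ^ i • (((i + 1).factorial : ℚ)⁻¹ • (E ^ (i + 1)) y) = 0 := by
      rw [Finset.smul_sum]
      simp only [smul_smul, ← mul_assoc, ← pow_succ'] at h1 ⊢
      simpa [E] using h1
    rw [Submodule.mem_bot]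
    exact (smul_eq_zero.1 h2).resolve_left ht

/-- A single torus element separates the weights, since the powers of 2 are distinct. -/
theorem mem_wt_of_torus {N a : ℕ} {y : NC} (hy : y ∈ deg N)
    (h : rhoA (Matrix.diagonal ![2, 1]) y = (2 ^ a : ℚ) • y) : y ∈ wt N a := by
  have hpr : ∀ b, b ≠ a → pr N b y = 0 := by
    intro b hb
    have h1 : pr N b (rhoA (Matrix.diagonal ![2, 1]) y) = (2 ^ b : ℚ) • pr N b y := by
      refine eqOn_supp (f := (pr N b).comp (rhoA (Matrix.diagonal ![2, 1])).toLinearMap)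
        (g := (2 ^ b : ℚ) • pr N b) (S := {l | l.length = N}) (fun l hl => ?_) hy
      obtain rfl : l.length = N := hl
      have hw : word l ∈ wt l.length (l.count 0) := word_mem_supp ⟨rfl, rfl⟩
      rw [LinearMap.comp_apply, AlgHom.toLinearMap_apply, rhoA_diagonal_of_mem _ hw,
        LinearMap.smul_apply, map_smul]
      by_cases hc : l.count 0 = b
      · subst hc; simp
      · rw [pr_of_mem_of_ne hw hc, smul_zero, smul_zero]
    rw [h, map_smul, ← sub_eq_zero, ← sub_smul] at h1
    refine (smul_eq_zero.1 h1).resolve_left fun h0 => hb ?_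
    have : (2 : ℚ) ^ a = 2 ^ b := sub_eq_zero.1 h0
    exact (Nat.pow_right_injective (le_refl 2) (by exact_mod_cast this)).symm
  rw [← sum_pr hy]
  refine Submodule.sum_mem _ fun b _ => ?_
  by_cases hb : b = a
  · subst hb; exact pr_mem N b y
  · rw [hpr b hb]; exact zero_mem _

/-- The map `X_0^p X_1^q ↦ p! / m! • F^q v`. -/
def lowerMap (m : ℕ) (v : NC) : MvPolynomial (Fin 2) ℚ →ₗ[ℚ] NC :=
  (MvPolynomial.basisMonomials (Fin 2) ℚ).constr ℚ fun d =>
    ((d 0).factorial / m.factorial : ℚ) • (F ^ d 1) v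

/-- The coefficient is forced: on binary forms, lowering X_0^m q times gives (m!/p!) X_0^p X_1^q
when p + q = m. -/
theorem lowerMap_monomial (m : ℕ) (v : NC) (p q : ℕ) :
    lowerMap m v (MvPolynomial.X 0 ^ p * MvPolynomial.X 1 ^ q) =
      (p.factorial / m.factorial : ℚ) • (F ^ q) v := by
  have : (MvPolynomial.X 0 ^ p * MvPolynomial.X 1 ^ q : MvPolynomial (Fin 2) ℚ) =
      MvPolynomial.basisMonomials (Fin 2) ℚ (Finsupp.single 0 p + Finsupp.single 1 q) := by
    simp [MvPolynomial.X_pow_eq_monomial, MvPolynomial.monomial_mul]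
  rw [this, lowerMap, Module.Basis.constr_basis]
  simp

theorem pow_F_mem_wt {N a : ℕ} {v : NC} (hv : v ∈ wt N a) {i : ℕ} (hi : i ≤ a) :
    (F ^ i) v ∈ wt N (a - i) := by
  induction i with
  | zero => exact hv
  | succ i ih =>
    have h := ih (by omega)
    rw [show a - i = a - (i + 1) + 1 by omega] at h
    rw [pow_succ', Module.End.mul_apply]
    exact F_mem_wt h

/-- `E` kills F^{m+1} v, because the factor 2a − N − m in `E_pow_F` is zero, and its weight lies
below the middle, so it vanishes. When a = m there is no such weight, but then F^m v has weight 0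
and `F` kills it. -/
theorem pow_F_eq_zero {N a m : ℕ} {v : NC} (hv : v ∈ wt N a) (hE : E v = 0) (ha : N + m = 2 * a)
    {i : ℕ} (hi : m < i) : (F ^ i) v = 0 := by
  have h0 : (F ^ (m + 1)) v = 0 := by
    by_cases hv0 : v = 0
    · rw [hv0, map_zero]
    have haN : a ≤ N := by
      by_contra h
      rw [wt_eq_bot (by omega)] at hv
      exact hv0 hv
    by_cases hm : a = m
    · subst hm
      have := pow_F_mem_wt hv (le_refl a)
      rw [Nat.sub_self] at this
      rw [pow_succ', Module.End.mul_apply, F_of_mem_wt_zero this]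
    · refine eq_zero_of_E_eq_zero (a := a - (m + 1)) (by omega) (pow_F_mem_wt hv (by omega)) ?_
      rw [E_pow_F hv hE]
      have : (2 * a - N - m : ℚ) = 0 := by
        have : (N + m : ℚ) = 2 * a := by exact_mod_cast ha
        linarith
      rw [this, mul_zero, zero_smul]
  obtain ⟨k, rfl⟩ := Nat.exists_eq_add_of_lt hi
  rw [show m + k + 1 = k + (m + 1) by ring, pow_add, Module.End.mul_apply, h0, map_zero]

theorem pow_E_pow_F {N a m : ℕ} {v : NC} (hv : v ∈ wt N a) (hE : E v = 0) (ha : N + m = 2 * a)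
    {p q i : ℕ} (hpq : p + q = m) (hi : i ≤ q) :
    (E ^ i) ((F ^ q) v) =
      ((q.descFactorial i : ℚ) * ((p + i).descFactorial i : ℚ)) • (F ^ (q - i)) v := by
  induction i with
  | zero => simp
  | succ i ih =>
    obtain ⟨r, hr⟩ : ∃ r, q - i = r + 1 := ⟨q - i - 1, by omega⟩
    rw [pow_succ', Module.End.mul_apply, ih (by omega), map_smul, hr, E_pow_F hv hE, smul_smul,
      show q - (i + 1) = r by omega]
    congr 1
    have h1 : (q.descFactorial (i + 1) : ℚ) = (r + 1) * q.descFactorial i := by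
      rw [Nat.descFactorial_succ, hr]; push_cast; ring
    have h2 : ((p + (i + 1)).descFactorial (i + 1) : ℚ) =
        (p + i + 1) * ((p + i).descFactorial i : ℚ) := by
      rw [← add_assoc, Nat.succ_descFactorial_succ]; push_cast; ring
    have h3 : (2 * a - N - r : ℚ) = p + i + 1 := by
      have e1 : (N + m : ℚ) = 2 * a := by exact_mod_cast ha
      have e2 : (m : ℚ) = p + (r + 1 + i) := by
        exact_mod_cast (by omega : m = p + (r + 1 + i))
      linarith
    rw [h1, h2, h3]
    ring

theorem pow_E_pow_F_eq_zero {N a m : ℕ} {v : NC} (hv : v ∈ wt N a) (hE : E v = 0)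
    (ha : N + m = 2 * a) {q i : ℕ} (hqm : q ≤ m) (hi : q < i) : (E ^ i) ((F ^ q) v) = 0 := by
  obtain ⟨k, rfl⟩ := Nat.exists_eq_add_of_lt hi
  rw [show q + k + 1 = k + 1 + q by ring, pow_add, Module.End.mul_apply,
    pow_E_pow_F hv hE ha (Nat.sub_add_cancel hqm) le_rfl, map_smul, Nat.sub_self, pow_zero,
    Module.End.one_apply, pow_succ, Module.End.mul_apply, hE, map_zero, smul_zero]

/-- The vectors (p!/m!) F^q v transform like X_0^p X_1^q: E^i/i! and F^i/i! act on them with the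
binomial coefficients of `subst_upper` and `subst_lower`, and the powers running past the ends of
the string vanish. -/
theorem rhoA_lowerMap {N a m c : ℕ} {v : NC} (hv : v ∈ wt N a) (hE : E v = 0)
    (ha : N + m = 2 * a) (hc : m + c = a) {g : Matrix (Fin 2) (Fin 2) ℚ}
    (hg : g.det ≠ 0) {P : MvPolynomial (Fin 2) ℚ}
    (hP : P ∈ MvPolynomial.homogeneousSubmodule (Fin 2) ℚ m) :
    rhoA g (lowerMap m v P) = g.det ^ c • lowerMap m v (subst g P) := by
  have hm0 : (m.factorial : ℚ) ≠ 0 := by positivity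
  refine hom_equivariant_of_generators (fun d p q hpq => ?_) (fun t p q hpq => ?_)
    (fun t p q hpq => ?_) hg hP
  · rw [lowerMap_monomial, map_smul, rhoA_diagonal_of_mem d (pow_F_mem_wt hv (by omega : q ≤ a)),
      show N - (a - q) = c + q by omega, show a - q = c + p by omega]
    rw [smul_comm]
    congr 1
    ring
  · have hdeg : (F ^ q) v ∈ deg N := wt_le_deg _ _ (pow_F_mem_wt hv (by omega : q ≤ a))
    rw [lowerMap_monomial, map_smul, rhoA_one_add upper_sq t hdeg (N + 1) (by omega),
      show N + 1 = q + 1 + (N - q) by omega, Finset.sum_range_add]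
    rw [Finset.sum_eq_zero (s := Finset.range (N - q)), add_zero, Finset.smul_sum]
    · refine Finset.sum_congr rfl fun i hi => ?_
      have hi : i ≤ q := Nat.lt_succ_iff.1 (Finset.mem_range.1 hi)
      change _ • t ^ i • ((i.factorial : ℚ)⁻¹ • (E ^ i) ((F ^ q) v)) = _
      rw [pow_E_pow_F hv hE ha hpq hi, lowerMap_monomial, smul_smul, smul_smul, smul_smul,
        smul_smul, smul_smul]
      congr 1
      have h1 : (q.descFactorial i : ℚ) = i.factorial * q.choose i := by
        exact_mod_cast Nat.descFactorial_eq_factorial_mul_choose q i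
      have h2 : (p.factorial : ℚ) * (p + i).descFactorial i = (p + i).factorial := by
        have := Nat.factorial_mul_descFactorial (Nat.le_add_left i p)
        rw [Nat.add_sub_cancel] at this
        exact_mod_cast this
      have hi0 : (i.factorial : ℚ) ≠ 0 := by positivity
      rw [h1, ← h2]
      field_simp
    · intro i _
      change t ^ _ • ((_ : ℚ)⁻¹ • (E ^ _) ((F ^ q) v)) = 0
      rw [pow_E_pow_F_eq_zero hv hE ha (by omega) (by omega), smul_zero, smul_zero]
  · have hdeg : (F ^ q) v ∈ deg N := wt_le_deg _ _ (pow_F_mem_wt hv (by omega : q ≤ a))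
    rw [lowerMap_monomial, map_smul, rhoA_one_add lower_sq t hdeg (N + 1) (by omega),
      show N + 1 = p + 1 + (N - p) by omega, Finset.sum_range_add]
    rw [Finset.sum_eq_zero (s := Finset.range (N - p)), add_zero, Finset.smul_sum]
    · refine Finset.sum_congr rfl fun i hi => ?_
      have hi : i ≤ p := Nat.lt_succ_iff.1 (Finset.mem_range.1 hi)
      change _ • t ^ i • ((i.factorial : ℚ)⁻¹ • (F ^ i) ((F ^ q) v)) = _
      rw [← Module.End.mul_apply, ← pow_add, lowerMap_monomial, smul_smul, smul_smul, smul_smul,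
        smul_smul, add_comm i q]
      congr 1
      have h1 : (p.factorial : ℚ) = p.choose i * i.factorial * (p - i).factorial := by
        exact_mod_cast (Nat.choose_mul_factorial_mul_factorial hi).symm
      have hi0 : (i.factorial : ℚ) ≠ 0 := by positivity
      rw [h1]
      field_simp
    · intro i _
      change t ^ _ • ((_ : ℚ)⁻¹ • (F ^ _) ((F ^ q) v)) = 0
      rw [← Module.End.mul_apply, ← pow_add, pow_F_eq_zero hv hE ha (by omega), smul_zero,
        smul_zero]

theorem lowerMap_mem {m : ℕ} {v : NC} {U : Submodule ℚ NC} (h : ∀ i, (F ^ i) v ∈ U)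
    (P : MvPolynomial (Fin 2) ℚ) : lowerMap m v P ∈ U := by
  rw [lowerMap, Module.Basis.constr_apply]
  exact U.sum_mem fun d _ => U.smul_mem _ (U.smul_mem _ (h _))

/-! ### Multiplicities as numbers of highest weight vectors -/

namespace Model

variable {V : Type*} [AddCommGroup V] [Module ℚ V] {ρ : Representation ℚ (GL (Fin 2) ℚ) V}
  {N k : ℕ} (M : Model ρ N k)

/-- The projection of the polynomials to the forms of degree `m`. -/
def formPart (m : ℕ) :
    MvPolynomial (Fin 2) ℚ →ₗ[ℚ] MvPolynomial.homogeneousSubmodule (Fin 2) ℚ m :=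
  (MvPolynomial.homogeneousComponent m).codRestrict _
    fun p => MvPolynomial.homogeneousComponent_mem m p

theorem formPart_of_mem {m : ℕ} {p : MvPolynomial (Fin 2) ℚ}
    (hp : p ∈ MvPolynomial.homogeneousSubmodule (Fin 2) ℚ m) : formPart m p = ⟨p, hp⟩ := by
  refine Subtype.ext ?_
  change MvPolynomial.homogeneousComponent m p = p
  rw [MvPolynomial.homogeneousComponent_of_mem hp, if_pos rfl]

theorem W_apply (a b : ℕ) (g : GL (Fin 2) ℚ) {p : MvPolynomial (Fin 2) ℚ}
    (hp : p ∈ MvPolynomial.homogeneousSubmodule (Fin 2) ℚ (a - b)) :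
    W a b g ⟨p, hp⟩ = g.1.det ^ b • ⟨subst g.1 p, subst_mem g.1 _ hp⟩ := rfl

/-- An intertwining map as a map from polynomials to the free associative algebra. -/
def flat {a b : ℕ} (f : (W a b).IntertwiningMap ρ) : MvPolynomial (Fin 2) ℚ →ₗ[ℚ] NC :=
  M.j.comp (f.toLinearMap.comp (formPart (a - b)))

theorem flat_of_mem {a b : ℕ} (f : (W a b).IntertwiningMap ρ) {p : MvPolynomial (Fin 2) ℚ}
    (hp : p ∈ MvPolynomial.homogeneousSubmodule (Fin 2) ℚ (a - b)) :
    M.flat f p = M.j (f ⟨p, hp⟩) := by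
  rw [flat, LinearMap.comp_apply, LinearMap.comp_apply, formPart_of_mem hp]
  rfl

theorem rhoA_flat {a b : ℕ} (f : (W a b).IntertwiningMap ρ) {g : Matrix (Fin 2) (Fin 2) ℚ}
    (hg : g.det ≠ 0) {p : MvPolynomial (Fin 2) ℚ}
    (hp : p ∈ MvPolynomial.homogeneousSubmodule (Fin 2) ℚ (a - b)) :
    rhoA g (M.flat f p) = g.det ^ (k + b) • M.flat f (subst g p) := by
  let g' := Matrix.GeneralLinearGroup.mkOfDetNeZero g hg
  have h1 := M.comp g' (f ⟨p, hp⟩)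
  have h2 : f (W a b g' ⟨p, hp⟩) = ρ g' (f ⟨p, hp⟩) := LinearMap.congr_fun (f.isIntertwining' g') _
  rw [← h2, W_apply, map_smul, map_smul, smul_smul, ← pow_add] at h1
  rw [M.flat_of_mem f hp, M.flat_of_mem f (subst_mem g _ hp)]
  exact h1.symm

/-- The space of highest weight vectors. -/
def hw (a : ℕ) : Submodule ℚ NC := LinearMap.range M.j ⊓ wt N a ⊓ LinearMap.ker E

/-- The form X_0^{a−b} is fixed by upper unipotents and has torus weight a − b; the twists by det^b
and det^k raise the weight to a + k. -/
theorem flat_mem_hw {a b : ℕ} (hba : b ≤ a) (hN : a + b + 2 * k = N)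
    (f : (W a b).IntertwiningMap ρ) : M.flat f (MvPolynomial.X 0 ^ (a - b)) ∈ M.hw (a + k) := by
  have hp : (MvPolynomial.X 0 ^ (a - b) : MvPolynomial (Fin 2) ℚ) ∈
      MvPolynomial.homogeneousSubmodule (Fin 2) ℚ (a - b) := by
    simpa using monomial_mem (p := a - b) (q := 0) rfl
  have hr : M.flat f (MvPolynomial.X 0 ^ (a - b)) ∈ LinearMap.range M.j := ⟨_, rfl⟩
  refine ⟨⟨hr, mem_wt_of_torus (M.range_le hr) ?_⟩, E_eq_zero_of_fixed (M.range_le hr) fun t => ?_⟩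
  · rw [M.rhoA_flat f (by simp) hp]
    have := subst_diagonal ![2, 1] (a - b) 0
    rw [pow_zero, mul_one] at this
    rw [this, map_smul, smul_smul]
    simp only [Matrix.det_diagonal, Fin.prod_univ_two, Matrix.cons_val_zero, Matrix.cons_val_one,
      mul_one, one_pow, ← pow_add]
    congr 2
    omega
  · rw [M.rhoA_flat f (by rw [det_upper]; exact one_ne_zero) hp, det_upper, one_pow, one_smul]
    have := subst_upper t (a - b) 0
    simp only [pow_zero, mul_one, zero_add, Finset.sum_range_one, Nat.choose_self, Nat.cast_one,
      add_zero, one_smul, Nat.sub_self] at this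
    rw [this]

/-- Lower transvections applied to X_0^{a−b} have nonzero multiples of all the monomials as
coefficients in t, so the image of X_0^{a−b} determines the map. -/
theorem flat_eq_zero {a b : ℕ} (f : (W a b).IntertwiningMap ρ)
    (h : M.flat f (MvPolynomial.X 0 ^ (a - b)) = 0) : f = 0 := by
  have hp : (MvPolynomial.X 0 ^ (a - b) : MvPolynomial (Fin 2) ℚ) ∈
      MvPolynomial.homogeneousSubmodule (Fin 2) ℚ (a - b) := by
    simpa using monomial_mem (p := a - b) (q := 0) rfl
  have key : ∀ i < a - b + 1, M.flat f (MvPolynomial.X 0 ^ (a - b - i) * MvPolynomial.X 1 ^ i) = 0 := by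
    intro i hi
    have := mem_of_forall_sum_pow_smul_mem (⊥ : Submodule ℚ NC)
      (fun i => ((a - b).choose i : ℚ) •
        M.flat f (MvPolynomial.X 0 ^ (a - b - i) * MvPolynomial.X 1 ^ i)) (a - b + 1)
      (fun t _ => ?_) hi
    · exact (smul_eq_zero.1 this).resolve_left
        (Nat.cast_ne_zero.2 (Nat.choose_pos (by omega)).ne')
    · have h1 := M.rhoA_flat f (g := 1 + t • Matrix.single 1 0 1)
        (by rw [det_lower]; exact one_ne_zero) hp
      have h2 := subst_lower t (a - b) 0
      rw [pow_zero, mul_one] at h2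
      rw [h, map_zero, det_lower, one_pow, one_smul, h2, map_sum] at h1
      simp only [map_smul, zero_add] at h1
      exact h1.symm
  refine Representation.IntertwiningMap.ext (LinearMap.ext fun ⟨p, hp⟩ => M.inj
    ((M.flat_of_mem f hp).symm.trans ?_))
  have := add_induction_homogeneous (f := M.flat f) (g := 0) (fun p q hpq => ?_) hp
  · rw [this]
    exact (map_zero M.j).symm
  · rw [show p = a - b - q by omega]
    exact key q (by omega)

theorem exists_flat_eq {a b : ℕ} (hba : b ≤ a) (hN : a + b + 2 * k = N) {v : NC}
    (hv : v ∈ M.hw (a + k)) :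
    ∃ f : (W a b).IntertwiningMap ρ, M.flat f (MvPolynomial.X 0 ^ (a - b)) = v := by
  have hst : Stable (LinearMap.range M.j) := M.img_top ▸ M.img_stable ⊤
  have hF : ∀ i, (F ^ i) v ∈ LinearMap.range M.j := by
    intro i
    induction i with
    | zero => exact hv.1.1
    | succ i ih => rw [pow_succ', Module.End.mul_apply]; exact F_mem M.range_le hst ih
  obtain ⟨f, hf⟩ : ∃ f : MvPolynomial.homogeneousSubmodule (Fin 2) ℚ (a - b) →ₗ[ℚ] V,
      ∀ p, M.j (f p) = lowerMap (a - b) v p.1 := by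
    let e := LinearEquiv.ofInjective M.j M.inj
    exact ⟨e.symm.toLinearMap.comp (((lowerMap (a - b) v).codRestrict _ (lowerMap_mem hF)).comp
      (Submodule.subtype _)), fun p => congrArg Subtype.val (e.apply_symm_apply
      ((lowerMap (a - b) v).codRestrict _ (lowerMap_mem hF) p.1))⟩
  have hint : ∀ g, f ∘ₗ W a b g = ρ g ∘ₗ f := fun g => LinearMap.ext fun ⟨p, hp⟩ => M.inj (by
    have h := rhoA_lowerMap (m := a - b) (c := k + b) hv.1.2 hv.2 (by omega) (by omega)
      (det_ne_zero g) hp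
    have h2 := M.comp g (f ⟨p, hp⟩)
    rw [hf, h, pow_add, mul_smul] at h2
    rw [LinearMap.comp_apply, LinearMap.comp_apply, W_apply, map_smul, map_smul, hf]
    exact (smul_right_injective NC (pow_ne_zero k (det_ne_zero g)) h2).symm)
  refine ⟨⟨f, hint⟩, ?_⟩
  have hp : (MvPolynomial.X 0 ^ (a - b) : MvPolynomial (Fin 2) ℚ) ∈
      MvPolynomial.homogeneousSubmodule (Fin 2) ℚ (a - b) := by
    simpa using monomial_mem (p := a - b) (q := 0) rfl
  rw [M.flat_of_mem _ hp]
  refine (hf ⟨_, hp⟩).trans ?_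
  have := lowerMap_monomial (a - b) v (a - b) 0
  rw [pow_zero, mul_one] at this
  change lowerMap (a - b) v (MvPolynomial.X 0 ^ (a - b)) = v
  rw [this, div_self (by positivity)]
  simp

/-- Evaluation at X_0^{a−b} identifies intertwining maps with highest weight vectors of weight a +
k, which `finrank_hw_wt` counts. -/
theorem mult_eq {a b : ℕ} (hba : b ≤ a) (hN : a + b + 2 * k = N) :
    mult ρ a b + Module.finrank ℚ ↥(LinearMap.range M.j ⊓ wt N (a + k + 1)) =
      Module.finrank ℚ ↥(LinearMap.range M.j ⊓ wt N (a + k)) := by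
  let Φ : (W a b).IntertwiningMap ρ →ₗ[ℚ] M.hw (a + k) :=
    { toFun := fun f => ⟨M.flat f (MvPolynomial.X 0 ^ (a - b)), M.flat_mem_hw hba hN f⟩
      map_add' := fun f g => Subtype.ext (map_add M.j _ _)
      map_smul' := fun c f => Subtype.ext (map_smul M.j _ _) }
  have hΦ : Function.Bijective Φ := by
    constructor
    · rw [injective_iff_map_eq_zero]
      exact fun f hf => M.flat_eq_zero f (congrArg Subtype.val hf)
    · rintro ⟨v, hv⟩
      obtain ⟨f, hf⟩ := M.exists_flat_eq hba hN hv
      exact ⟨f, Subtype.ext hf⟩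
  rw [mult, (LinearEquiv.ofBijective Φ hΦ).finrank_eq]
  exact finrank_hw_wt M.range_le (M.img_top ▸ M.img_stable ⊤) (by omega)

end Model

end

section

open NC

/-! ### Existence and uniqueness of rational forms -/

theorem exists_polynomial_rhoA {N : ℕ} {y : NC} (hy : y ∈ deg N) (l : Module.Dual ℚ NC) :
    ∃ P : MvPolynomial (Fin 2 × Fin 2) ℚ, P.IsHomogeneous N ∧
      ∀ g : Matrix (Fin 2) (Fin 2) ℚ,
        l (rhoA g y) = MvPolynomial.eval (fun p => g p.1 p.2) P := by
  refine supp_induction (S := {l | l.length = N}) (P := fun y => ∃ P : MvPolynomial (Fin 2 × Fin 2) ℚ,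
    P.IsHomogeneous N ∧ ∀ g : Matrix (Fin 2) (Fin 2) ℚ,
      l (rhoA g y) = MvPolynomial.eval (fun p => g p.1 p.2) P) (fun w hw => ?_) ?_ ?_ ?_ hy
  · obtain rfl : w.length = N := hw
    clear hy
    induction w generalizing l with
    | nil => exact ⟨MvPolynomial.C (l 1), MvPolynomial.isHomogeneous_C _ _, fun g => by
        rw [word_nil, map_one (rhoA g), MvPolynomial.eval_C]⟩
    | cons i w ih =>
      choose P hP hPe using fun r => ih (l.comp (LinearMap.mulLeft ℚ (x r)))
      refine ⟨∑ r, MvPolynomial.X (r, i) * P r, ?_, fun g => ?_⟩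
      · refine MvPolynomial.IsHomogeneous.sum _ _ _ fun r _ => ?_
        rw [List.length_cons, add_comm]
        exact (MvPolynomial.isHomogeneous_X ℚ (r, i)).mul (hP r)
      · rw [word_cons, map_mul (rhoA g), rhoA_x, lin, Finset.sum_mul, map_sum, map_sum]
        refine Finset.sum_congr rfl fun r _ => ?_
        rw [smul_mul_assoc, map_smul, smul_eq_mul, map_mul (MvPolynomial.eval _), MvPolynomial.eval_X,
          ← hPe]
        rfl
  · exact ⟨0, MvPolynomial.isHomogeneous_zero _ _ _, fun g => by simp⟩
  · rintro a b ⟨P, hP, hPe⟩ ⟨Q, hQ, hQe⟩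
    exact ⟨P + Q, hP.add hQ, fun g => by rw [map_add, map_add, hPe, hQe, map_add]⟩
  · rintro c a ⟨P, hP, hPe⟩
    exact ⟨MvPolynomial.C c * P, hP.C_mul c, fun g => by
      rw [map_smul, map_smul, hPe, map_mul, MvPolynomial.eval_C, smul_eq_mul]⟩

theorem Model.isAlgebraic {V : Type*} [AddCommGroup V] [Module ℚ V]
    {ρ : Representation ℚ (GL (Fin 2) ℚ) V} {n k : ℕ} (M : Model ρ (n + 2 * k) k) :
    IsAlgebraicOfDegree ρ n := by
  refine ⟨k, fun v l => ?_⟩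
  obtain ⟨r, hr⟩ := LinearMap.exists_leftInverse_of_injective M.j (LinearMap.ker_eq_bot.2 M.inj)
  obtain ⟨P, hP, hPe⟩ := exists_polynomial_rhoA (M.range_le ⟨v, rfl⟩) (l.comp r)
  refine ⟨P, hP, fun g => ?_⟩
  rw [← hPe, ← M.comp, LinearMap.comp_apply, map_smul, map_smul, smul_eq_mul,
    ← LinearMap.comp_apply r, hr, LinearMap.id_apply]

theorem exists_model {V : Type*} [AddCommGroup V] [Module ℚ V] {j : V →ₗ[ℚ] NC} {N : ℕ}
    (k : ℕ) (inj : Function.Injective j) (hle : LinearMap.range j ≤ deg N)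
    (hst : Stable (LinearMap.range j)) :
    ∃ ρ : Representation ℚ (GL (Fin 2) ℚ) V, ∃ M : Model ρ N k, M.j = j := by
  have hex : ∀ g : GL (Fin 2) ℚ, ∃ f : V →ₗ[ℚ] V, ∀ v, g.1.det ^ k • j (f v) = rhoA g.1 (j v) := by
    intro g
    let e := LinearEquiv.ofInjective j inj
    have hmem : ∀ v, (rhoA g.1) (j v) ∈ LinearMap.range j :=
      fun v => hst _ (Model.det_ne_zero g) _ ⟨v, rfl⟩
    let f := (g.1.det ^ k)⁻¹ • e.symm.toLinearMap.comp
      (((rhoA g.1).toLinearMap.comp j).codRestrict _ hmem)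
    refine ⟨f, fun v => ?_⟩
    have h : j (e.symm ⟨rhoA g.1 (j v), hmem v⟩) = rhoA g.1 (j v) :=
      congrArg Subtype.val (e.apply_symm_apply ⟨rhoA g.1 (j v), hmem v⟩)
    change _ • j ((g.1.det ^ k)⁻¹ • e.symm ⟨rhoA g.1 (j v), hmem v⟩) = _
    rw [map_smul, h, smul_smul, mul_inv_cancel₀ (pow_ne_zero _ (Model.det_ne_zero g)), one_smul]
  choose f hf using hex
  have huniq : ∀ (g : GL (Fin 2) ℚ) (v w : V), g.1.det ^ k • j w = rhoA g.1 (j v) → f g v = w :=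
    fun g v w h => inj (smul_right_injective NC (pow_ne_zero k (Model.det_ne_zero g))
      ((hf g v).trans h.symm))
  refine ⟨{ toFun := f, map_one' := ?_, map_mul' := ?_ }, ⟨j, inj, hle, hf⟩, rfl⟩
  · refine LinearMap.ext fun v => huniq _ _ _ ?_
    simp [rhoA_one]
  · refine fun g h => LinearMap.ext fun v => huniq _ _ _ ?_
    rw [Units.val_mul, Matrix.det_mul, mul_pow, rhoA_mul, AlgHom.comp_apply, ← hf h, map_smul,
      ← hf g, Module.End.mul_apply, smul_smul, mul_comm]

theorem exists_polynomial_eval (A : Matrix (Fin 2) (Fin 2) (Polynomial ℚ))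
    (P : MvPolynomial (Fin 2 × Fin 2) ℚ) : ∃ q : Polynomial ℚ, ∀ t,
      q.eval t = MvPolynomial.eval (fun p => (A p.1 p.2).eval t) P := by
  refine ⟨MvPolynomial.aeval (fun p => A p.1 p.2) P, fun t => ?_⟩
  induction P using MvPolynomial.induction_on with
  | C a => simp
  | add p q hp hq => rw [map_add, Polynomial.eval_add, hp, hq, map_add]
  | mul_X p i hp => rw [map_mul, Polynomial.eval_mul, hp, map_mul]; simp

theorem eval_det (A : Matrix (Fin 2) (Fin 2) (Polynomial ℚ)) (t : ℚ) :
    A.det.eval t = (A.map (Polynomial.eval t)).det := by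
  simp [Matrix.det_fin_two]

/-! ### Algebraic representations are determined on integral transvections -/

section Uniqueness

variable {V : Type*} [AddCommGroup V] [Module ℚ V] {ρ σ : Representation ℚ (GL (Fin 2) ℚ) V}
  {n : ℕ}

/-- Clearing both powers of det turns each matrix coefficient of the difference along the curve into
a polynomial in t that has infinitely many zeros. -/
theorem eq_along_curve (hρ : IsAlgebraicOfDegree ρ n) (hσ : IsAlgebraicOfDegree σ n)
    (A : Matrix (Fin 2) (Fin 2) (Polynomial ℚ)) {T : Set ℚ} (hT : T.Infinite)
    (h : ∀ t ∈ T, ∃ g : GL (Fin 2) ℚ, g.1 = A.map (Polynomial.eval t) ∧ ρ g = σ g) {t : ℚ}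
    {g : GL (Fin 2) ℚ} (hg : g.1 = A.map (Polynomial.eval t)) : ρ g = σ g := by
  obtain ⟨k, hk⟩ := hρ
  obtain ⟨k', hk'⟩ := hσ
  refine LinearMap.ext fun v => ?_
  rw [← sub_eq_zero, ← Module.forall_dual_apply_eq_zero_iff ℚ]
  intro l
  obtain ⟨P, -, hP⟩ := hk v l
  obtain ⟨Q, -, hQ⟩ := hk' v l
  obtain ⟨p, hp⟩ := exists_polynomial_eval A P
  obtain ⟨q, hq⟩ := exists_polynomial_eval A Q
  have key : ∀ (t : ℚ) (g : GL (Fin 2) ℚ), g.1 = A.map (Polynomial.eval t) →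
      (A.det ^ k' * p - A.det ^ k * q).eval t = g.1.det ^ (k + k') * l (ρ g v - σ g v) := by
    intro t g hg
    rw [Polynomial.eval_sub, Polynomial.eval_mul, Polynomial.eval_mul, Polynomial.eval_pow,
      Polynomial.eval_pow, eval_det, hp, hq, ← hg, map_sub]
    have h1 := hP g
    have h2 := hQ g
    simp only [hg, Matrix.map_apply] at h1 h2
    rw [← h1, ← h2, hg]
    ring
  have h0 : A.det ^ k' * p - A.det ^ k * q = 0 := by
    refine Polynomial.eq_zero_of_infinite_isRoot _ (hT.mono fun t ht => ?_)
    obtain ⟨g, hg, hgρ⟩ := h t ht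
    rw [Set.mem_ofPred_eq, Polynomial.IsRoot.def, key t g hg, hgρ, sub_self, map_zero, mul_zero]
  have h1 := key t g hg
  rw [h0, Polynomial.eval_zero] at h1
  exact (mul_eq_zero.1 h1.symm).resolve_left (pow_ne_zero _ (Model.det_ne_zero g))

theorem eval_smul_of_isHomogeneous {ι : Type*} {P : MvPolynomial ι ℚ} {d : ℕ}
    (hP : P.IsHomogeneous d) (c : ℚ) (f : ι → ℚ) :
    MvPolynomial.eval (fun i => c * f i) P = c ^ d * MvPolynomial.eval f P := by
  rw [MvPolynomial.eval_eq, MvPolynomial.eval_eq, Finset.mul_sum]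
  refine Finset.sum_congr rfl fun m hm => ?_
  have h : m.degree = d := by
    rw [Finsupp.degree_eq_weight_one]; exact hP (MvPolynomial.mem_support_iff.1 hm)
  simp only [mul_pow, Finset.prod_mul_distrib, Finset.prod_pow_eq_pow_sum]
  rw [← h, Finsupp.degree_apply]
  ring

/-- Homogeneity gives c^{n+2k}, and det^k accounts for c^{2k} of it. -/
theorem scalar_apply (hρ : IsAlgebraicOfDegree ρ n) {g : GL (Fin 2) ℚ} {c : ℚ}
    (hg : g.1 = Matrix.diagonal fun _ => c) (v : V) : ρ g v = c ^ n • v := by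
  obtain ⟨k, hk⟩ := hρ
  rw [← sub_eq_zero, ← Module.forall_dual_apply_eq_zero_iff ℚ]
  intro l
  obtain ⟨P, hP, hPe⟩ := hk v l
  have hdet : g.1.det = c ^ 2 := by rw [hg]; simp [Matrix.det_diagonal]
  have hc : c ≠ 0 := by
    rintro rfl
    exact Model.det_ne_zero g (by rw [hdet]; simp)
  have h1 := hPe g
  have h2 := hPe 1
  have h3 : MvPolynomial.eval (fun p => g.1 p.1 p.2) P =
      c ^ (n + 2 * k) * MvPolynomial.eval (fun p => (1 : GL (Fin 2) ℚ).1 p.1 p.2) P := by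
    rw [← eval_smul_of_isHomogeneous hP, hg]
    congr 2
    funext p
    simp [Matrix.diagonal_apply, Matrix.one_apply]
  rw [h3, ← h2, hdet] at h1
  rw [map_one ρ, Units.val_one, Matrix.det_one, one_pow, one_mul, Module.End.one_apply, ← pow_mul,
    pow_add, mul_comm (c ^ n), mul_assoc] at h1
  rw [map_sub, mul_left_cancel₀ (pow_ne_zero _ hc) h1, map_smul, smul_eq_mul, sub_self]

/-- Integral points are dense in the root subgroups, which generate SL_2(ℚ), and the degree fixes
scalars. Scalars and SL_2(ℚ) do not generate GL_2(ℚ); they reach diag(t, 1) for squares t, and the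
remaining t follow from another density argument. -/
theorem rep_ext (hρ : IsAlgebraicOfDegree ρ n) (hσ : IsAlgebraicOfDegree σ n)
    (hu : ∀ m : ℤ, ∀ g : GL (Fin 2) ℚ, g.1 = 1 + (m : ℚ) • Matrix.single 0 1 1 → ρ g = σ g)
    (hl : ∀ m : ℤ, ∀ g : GL (Fin 2) ℚ, g.1 = 1 + (m : ℚ) • Matrix.single 1 0 1 → ρ g = σ g) :
    ρ = σ := by
  have hinf : (Set.range fun m : ℤ => (m : ℚ)).Infinite :=
    Set.infinite_range_of_injective Int.cast_injective
  have hu' : ∀ (t : ℚ) (g : GL (Fin 2) ℚ), g.1 = 1 + t • Matrix.single 0 1 1 → ρ g = σ g := by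
    intro t g hg
    refine eq_along_curve hρ hσ !![1, Polynomial.X; 0, 1] hinf ?_ (t := t) (g := g) ?_
    · rintro _ ⟨m, rfl⟩
      have hd : (1 + (m : ℚ) • Matrix.single 0 1 1 : Matrix (Fin 2) (Fin 2) ℚ).det ≠ 0 := by
        rw [det_upper]; exact one_ne_zero
      refine ⟨Matrix.GeneralLinearGroup.mkOfDetNeZero _ hd, ?_, hu m _ rfl⟩
      change 1 + (m : ℚ) • Matrix.single 0 1 1 = _
      ext i j
      fin_cases i <;> fin_cases j <;> simp
    · rw [hg]
      ext i j
      fin_cases i <;> fin_cases j <;> simp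
  have hl' : ∀ (t : ℚ) (g : GL (Fin 2) ℚ), g.1 = 1 + t • Matrix.single 1 0 1 → ρ g = σ g := by
    intro t g hg
    refine eq_along_curve hρ hσ !![1, 0; Polynomial.X, 1] hinf ?_ (t := t) (g := g) ?_
    · rintro _ ⟨m, rfl⟩
      have hd : (1 + (m : ℚ) • Matrix.single 1 0 1 : Matrix (Fin 2) (Fin 2) ℚ).det ≠ 0 := by
        rw [det_lower]; exact one_ne_zero
      refine ⟨Matrix.GeneralLinearGroup.mkOfDetNeZero _ hd, ?_, hl m _ rfl⟩
      change 1 + (m : ℚ) • Matrix.single 1 0 1 = _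
      ext i j
      fin_cases i <;> fin_cases j <;> simp
    · rw [hg]
      ext i j
      fin_cases i <;> fin_cases j <;> simp
  let u : ℚ → GL (Fin 2) ℚ := fun t => Matrix.GeneralLinearGroup.mkOfDetNeZero
    (1 + t • Matrix.single 0 1 1) (by rw [det_upper]; exact one_ne_zero)
  let w : ℚ → GL (Fin 2) ℚ := fun t => Matrix.GeneralLinearGroup.mkOfDetNeZero
    (1 + t • Matrix.single 1 0 1) (by rw [det_lower]; exact one_ne_zero)
  have hu2 : ∀ t, ρ (u t) = σ (u t) := fun t => hu' t _ rfl
  have hl2 : ∀ t, ρ (w t) = σ (w t) := fun t => hl' t _ rfl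
  have hscal : ∀ (c : ℚ) (g : GL (Fin 2) ℚ), g.1 = (Matrix.diagonal fun _ => c) → ρ g = σ g :=
    fun c g hg => LinearMap.ext fun v => by rw [scalar_apply hρ hg, scalar_apply hσ hg]
  have hd : ∀ (t : ℚ) (g : GL (Fin 2) ℚ), g.1 = Matrix.diagonal ![t, 1] → ρ g = σ g := by
    intro t g hg
    refine eq_along_curve hρ hσ (Matrix.diagonal ![Polynomial.X, 1])
      (T := Set.range fun m : ℕ => ((m : ℚ) + 1) ^ 2) ?_ ?_ (t := t) (g := g) ?_
    · refine Set.infinite_range_of_injective fun a b hab => ?_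
      have := (pow_left_inj₀ (by positivity) (by positivity) two_ne_zero).1 hab
      exact_mod_cast add_right_cancel this
    · rintro _ ⟨m, rfl⟩
      have hs : (m + 1 : ℚ) ≠ 0 := by positivity
      change ∃ g : GL (Fin 2) ℚ, g.1 = (Matrix.diagonal ![Polynomial.X, 1]).map
        (Polynomial.eval ((m + 1 : ℚ) ^ 2)) ∧ _
      generalize (m + 1 : ℚ) = s at hs ⊢
      let z : GL (Fin 2) ℚ := Matrix.GeneralLinearGroup.mkOfDetNeZero (Matrix.diagonal fun _ => s)
        (by simpa using hs)
      -- Here u(s) w(−1/s) u(s) is a Weyl element; times the inverse of the one for s = 1 it is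
      -- diag(s, 1/s), and the scalar s turns this into diag(s², 1).
      refine ⟨z * (u s * w (-s⁻¹) * u s * u (-1) * w 1 * u (-1)), ?_, ?_⟩
      · change (Matrix.diagonal fun _ => s) * _ = _
        change _ * ((1 + s • Matrix.single 0 1 1) * (1 + (-s⁻¹) • Matrix.single 1 0 1) *
          (1 + s • Matrix.single 0 1 1) * (1 + (-1 : ℚ) • Matrix.single 0 1 1) *
          (1 + (1 : ℚ) • Matrix.single 1 0 1) * (1 + (-1 : ℚ) • Matrix.single 0 1 1)) = _
        ext i j
        fin_cases i <;> fin_cases j <;>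
          simp [Matrix.mul_apply, Fin.sum_univ_two, Matrix.one_apply, Matrix.single_apply] <;> field_simp <;> simp
      · simp only [map_mul, hu2, hl2, hscal s z rfl]
    · rw [hg]
      ext i j
      fin_cases i <;> fin_cases j <;> simp
  have main : ∀ M : Matrix (Fin 2) (Fin 2) ℚ, M.det ≠ 0 →
      ∀ g : GL (Fin 2) ℚ, g.1 = M → ρ g = σ g := by
    intro M hM
    refine Matrix.diagonal_transvection_induction_of_det_ne_zero
      (fun M => ∀ g : GL (Fin 2) ℚ, g.1 = M → ρ g = σ g) M hM (fun D hD g hg => ?_)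
      (fun t g hg => ?_) (fun A B hA hB h1 h2 g hg => ?_)
    · rw [Matrix.det_diagonal, Fin.prod_univ_two] at hD
      have h0 := left_ne_zero_of_mul hD
      have h1 := right_ne_zero_of_mul hD
      let z : GL (Fin 2) ℚ := Matrix.GeneralLinearGroup.mkOfDetNeZero
        (Matrix.diagonal fun _ => D 1) (by simpa using h1)
      let y : GL (Fin 2) ℚ := Matrix.GeneralLinearGroup.mkOfDetNeZero
        (Matrix.diagonal ![D 0 / D 1, 1]) (by simpa using ⟨h0, h1⟩)
      have e : g = z * y := by
        refine Units.ext ?_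
        rw [hg]
        change _ = (Matrix.diagonal fun _ => D 1) * Matrix.diagonal ![D 0 / D 1, 1]
        ext i j
        fin_cases i <;> fin_cases j <;> simp
        field_simp
      rw [e, map_mul, map_mul, hscal _ z rfl, hd _ y rfl]
    · obtain ⟨i, j, hij, s⟩ := t
      fin_cases i <;> fin_cases j
      · exact absurd rfl hij
      · exact hu' s g (hg.trans (by simp [Matrix.TransvectionStruct.toMatrix, Matrix.transvection]))
      · exact hl' s g (hg.trans (by simp [Matrix.TransvectionStruct.toMatrix, Matrix.transvection]))
      · exact absurd rfl hij
    · have e : g = Matrix.GeneralLinearGroup.mkOfDetNeZero A hA *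
          Matrix.GeneralLinearGroup.mkOfDetNeZero B hB := Units.ext hg
      rw [e, map_mul, map_mul, h1 _ rfl, h2 _ rfl]
  exact MonoidHom.ext fun g => main g.1 (Model.det_ne_zero g) g rfl

end Uniqueness

/-- The integral transvection with the entry `m` at `(i, j)`. -/
def intTransvection (i j : Fin 2) (hij : i ≠ j) (m : ℤ) : GL (Fin 2) ℤ :=
  Matrix.GeneralLinearGroup.mk'' (Matrix.transvection i j m)
    (by rw [Matrix.det_transvection_of_ne i j hij]; exact isUnit_one)

/-- One equivariant embedding settles both claims: it defines a rational form, and any other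
rational form agrees with it on the integral transvections, realised by `htr`, hence everywhere by
`rep_ext`. -/
theorem rational_form_models {A : Type*} [CommGroup A] (act : B 2 → A →* A) {n k : ℕ}
    {j : ℚ ⊗[ℤ] Additive A →ₗ[ℚ] NC} (inj : Function.Injective j)
    (hle : LinearMap.range j ≤ deg (n + 2 * k)) (hst : Stable (LinearMap.range j))
    (heq : ∀ (φ : B 2) (g : GL (Fin 2) ℤ), Induces 2 φ g → ∀ x : A,
      (g.1.det : ℚ) ^ k • j (1 ⊗ₜ Additive.ofMul (act φ x)) =
        rhoA (g.1.map (Int.cast : ℤ → ℚ)) (j (1 ⊗ₜ Additive.ofMul x)))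
    (htr : ∀ (i j : Fin 2) (hij : i ≠ j) (m : ℤ), ∃ φ, Induces 2 φ (intTransvection i j hij m)) :
    (∃ ρ, IsRationalForm act n ρ) ∧ ∀ ρ, IsRationalForm act n ρ →
      ∃ M : Model ρ (n + 2 * k) k, M.j = j := by
  obtain ⟨ρ, M, hM⟩ := exists_model k inj hle hst
  have hρ : IsRationalForm act n ρ := by
    refine ⟨M.isAlgebraic, fun φ g hφ q x => M.inj ?_⟩
    have h := M.comp (Matrix.GeneralLinearGroup.map (Int.castRingHom ℚ) g) (q ⊗ₜ Additive.ofMul x)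
    have hdet : (Matrix.GeneralLinearGroup.map (Int.castRingHom ℚ) g).1.det = (g.1.det : ℚ) :=
      (Int.cast_det g.1).symm
    have hq : ∀ y : A, q ⊗ₜ[ℤ] Additive.ofMul y = q • ((1 : ℚ) ⊗ₜ[ℤ] Additive.ofMul y) :=
      fun y => by rw [TensorProduct.smul_tmul', smul_eq_mul, mul_one]
    have h0 : (g.1.det : ℚ) ≠ 0 := hdet ▸ Model.det_ne_zero _
    refine smul_right_injective NC (pow_ne_zero k h0) ?_
    change (g.1.det : ℚ) ^ k • _ = (g.1.det : ℚ) ^ k • _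
    rw [hdet] at h
    rw [h, hM, hq, hq, map_smul, map_smul, map_smul, smul_comm, heq φ g hφ x]
    rfl
  refine ⟨⟨ρ, hρ⟩, fun σ hσ => ?_⟩
  have hag : ∀ (a b : Fin 2) (hab : a ≠ b) (m : ℤ) (g : GL (Fin 2) ℚ),
      g.1 = Matrix.transvection a b (m : ℚ) → σ g = ρ g := by
    intro a b hab m g hg
    obtain ⟨φ, hφ⟩ := htr a b hab m
    have e : g = Matrix.GeneralLinearGroup.map (Int.castRingHom ℚ) (intTransvection a b hab m) := by
      refine Units.ext (hg.trans ?_)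
      ext i j
      change _ = ((Matrix.transvection a b m i j : ℤ) : ℚ)
      simp [Matrix.transvection, Matrix.one_apply, Matrix.single_apply]
    refine LinearMap.ext fun y => ?_
    induction y using TensorProduct.induction_on with
    | zero => simp
    | tmul q x =>
      obtain ⟨x, rfl⟩ := Additive.ofMul.surjective x
      rw [e, hσ.extends_act φ _ hφ, hρ.extends_act φ _ hφ]
    | add y z hy hz => rw [map_add, map_add, hy, hz]
  obtain rfl : σ = ρ := by
    refine rep_ext hσ.algebraic hρ.algebraic (fun m g hg => hag 0 1 (by decide) m g ?_)
      (fun m g hg => hag 1 0 (by decide) m g ?_)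
    · simp [hg, Matrix.transvection]
    · simp [hg, Matrix.transvection]
  exact ⟨M, hM⟩

end

section

namespace NC

/-! ### Primitive elements and the Dynkin operator -/

section lift

variable {R : Type*} [Ring R] [Algebra ℚ R]

/-- The algebra homomorphism with prescribed values on the letters. -/
def lift (f : Fin 2 → R) : NC →ₐ[ℚ] R := MonoidAlgebra.lift ℚ R _ (FreeMonoid.lift f)

@[simp] theorem lift_x (f : Fin 2 → R) (i : Fin 2) : lift f (x i) = f i := by
  rw [lift, x, word, MonoidAlgebra.lift_single, one_smul]
  rfl

end lift

/-- The counit. -/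
def eps : NC →ₐ[ℚ] ℚ := lift fun _ => 0

@[simp] theorem eps_x (i : Fin 2) : eps (x i) = 0 := lift_x _ i

theorem eps_eq (a : NC) : eps a = cf [] a := by
  have : eps.toLinearMap = cf [] := by
    refine hom_ext fun l => ?_
    cases l with
    | nil => simp [word_nil]; rw [← word_nil, cf_word, if_pos rfl]
    | cons i l =>
      rw [AlgHom.toLinearMap_apply, word_cons, map_mul eps, eps_x, zero_mul, cf_nil_x_mul]
  exact LinearMap.congr_fun this a

/-- The coproduct for which the letters are primitive. -/
def cop : NC →ₐ[ℚ] NC ⊗[ℚ] NC := lift fun i => x i ⊗ₜ 1 + 1 ⊗ₜ x i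

@[simp] theorem cop_x (i : Fin 2) : cop (x i) = x i ⊗ₜ 1 + 1 ⊗ₜ x i := lift_x _ i

/-- The primitive elements. -/
def prim : Submodule ℚ NC :=
  LinearMap.eqLocus cop.toLinearMap
    ((TensorProduct.mk ℚ NC NC).flip 1 + TensorProduct.mk ℚ NC NC 1)

theorem mem_prim {p : NC} : p ∈ prim ↔ cop p = p ⊗ₜ 1 + 1 ⊗ₜ p := Iff.rfl

theorem x_mem_prim (i : Fin 2) : x i ∈ prim := cop_x i

theorem bracket_mem_prim {p q : NC} (hp : p ∈ prim) (hq : q ∈ prim) : p * q - q * p ∈ prim := by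
  rw [mem_prim] at *
  rw [map_sub, map_mul cop, map_mul cop, hp, hq]
  simp only [add_mul, mul_add, Algebra.TensorProduct.tmul_mul_tmul, one_mul, mul_one,
    TensorProduct.sub_tmul, TensorProduct.tmul_sub]
  abel

theorem cop_rhoA (g : Matrix (Fin 2) (Fin 2) ℚ) (a : NC) :
    cop (rhoA g a) = Algebra.TensorProduct.map (rhoA g) (rhoA g) (cop a) := by
  refine DFunLike.congr_fun (f := cop.comp (rhoA g))
    (g := (Algebra.TensorProduct.map (rhoA g) (rhoA g)).comp cop) (algHom_ext fun i => ?_) a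
  rw [AlgHom.comp_apply, AlgHom.comp_apply, rhoA_x, cop_x, map_add, Algebra.TensorProduct.map_tmul,
    Algebra.TensorProduct.map_tmul, map_one, rhoA_x, lin, map_sum, TensorProduct.sum_tmul,
    TensorProduct.tmul_sum, ← Finset.sum_add_distrib]
  exact Finset.sum_congr rfl fun r _ => by
    rw [map_smul, cop_x, smul_add, TensorProduct.smul_tmul', TensorProduct.tmul_smul]

theorem prim_stable : Stable prim := by
  intro g _ p hp
  rw [mem_prim] at *
  rw [cop_rhoA, hp, map_add, Algebra.TensorProduct.map_tmul, Algebra.TensorProduct.map_tmul,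
    map_one]

/-- The homogeneous Lie elements of degree `n`. -/
def lie (n : ℕ) : Submodule ℚ NC := prim ⊓ deg n

theorem deg_stable (n : ℕ) : Stable (deg n) := fun g _ _ h => rhoA_mem_deg g h

theorem lie_le (n : ℕ) : lie n ≤ deg n := inf_le_right

theorem lie_stable (n : ℕ) : Stable (lie n) := prim_stable.inf (deg_stable n)

/-- The right-normed brackets of the letters. -/
def dynWord : List (Fin 2) → NC
  | [] => 0
  | i :: l => x i * dynWord l - dynWord l * x i + cf [] (word l) • x i

/-- The Dynkin operator. -/
def dyn : NC →ₗ[ℚ] NC := ofWords dynWord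

theorem dyn_one : dyn 1 = 0 := by rw [dyn, ← word_nil, ofWords_word, dynWord]

/-- The last term makes `dyn` fix single letters; since `dyn 1 = 0`, the bracket alone would
annihilate them. -/
theorem dyn_x_mul (i : Fin 2) (a : NC) :
    dyn (x i * a) = x i * dyn a - dyn a * x i + cf [] a • x i := by
  refine DFunLike.congr_fun (f := dyn ∘ₗ LinearMap.mulLeft ℚ (x i))
    (g := LinearMap.mulLeft ℚ (x i) ∘ₗ dyn - LinearMap.mulRight ℚ (x i) ∘ₗ dyn +
      (cf []).smulRight (x i)) (hom_ext fun l => ?_) a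
  simp only [LinearMap.comp_apply, LinearMap.mulLeft_apply, LinearMap.add_apply,
    LinearMap.sub_apply, LinearMap.mulRight_apply, LinearMap.smulRight_apply]
  rw [← word_cons, dyn, ofWords_word, ofWords_word, dynWord]

theorem dyn_mem_prim (a : NC) : dyn a ∈ prim := by
  induction a using word_induction with
  | hw l =>
    induction l with
    | nil => rw [word_nil, dyn_one]; exact zero_mem _
    | cons i l ih =>
      rw [word_cons, dyn_x_mul]
      exact add_mem (bracket_mem_prim (x_mem_prim i) ih) (Submodule.smul_mem _ _ (x_mem_prim i))
  | h0 => simp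
  | hadd a b ha hb => rw [map_add]; exact add_mem ha hb
  | hsmul c a ha => rw [map_smul]; exact Submodule.smul_mem _ _ ha

theorem x_mem_deg (i : Fin 2) : x i ∈ deg 1 := word_mem_supp rfl

theorem dyn_mem_deg {n : ℕ} {a : NC} (ha : a ∈ deg n) : dyn a ∈ deg n := by
  refine map_supp_le ?_ ha
  rintro l rfl
  clear ha
  induction l with
  | nil => rw [word_nil, dyn_one]; exact zero_mem _
  | cons i l ih =>
    rw [word_cons, dyn_x_mul]
    refine add_mem (sub_mem ?_ (mul_mem_deg ih (x_mem_deg i))) ?_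
    · rw [List.length_cons, add_comm]; exact mul_mem_deg (x_mem_deg i) ih
    · rw [cf_word]
      split_ifs with h
      · rw [h, one_smul]; exact x_mem_deg i
      · rw [zero_smul]; exact zero_mem _

theorem counit_cop (a : NC) :
    TensorProduct.lid ℚ NC (LinearMap.rTensor NC (cf []) (cop a)) = a := by
  have h : ((Algebra.TensorProduct.lid ℚ NC).toAlgHom.comp
      ((Algebra.TensorProduct.map eps (AlgHom.id ℚ NC)).comp cop)) = AlgHom.id ℚ NC :=
    algHom_ext fun i => by simp
  have h2 : ∀ t : NC ⊗[ℚ] NC, (Algebra.TensorProduct.lid ℚ NC)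
      (Algebra.TensorProduct.map eps (AlgHom.id ℚ NC) t) =
        TensorProduct.lid ℚ NC (LinearMap.rTensor NC (cf []) t) := by
    intro t
    induction t using TensorProduct.induction_on with
    | zero => simp
    | tmul a b => simp [eps_eq]
    | add s t hs ht => simp only [map_add, hs, ht]
  rw [← h2]
  exact DFunLike.congr_fun h a

/-- Multiplication ∘ (`dyn` ⊗ id) ∘ `cop` is the degree operator: prefixing a letter x_i multiplies
the previous value by x_i and, through the letter term of `dyn` and the counit, adds one further
copy of the word. -/
theorem dyn_cop_word (l : List (Fin 2)) :
    LinearMap.mul' ℚ NC (LinearMap.rTensor NC dyn (cop (word l))) = (l.length : ℚ) • word l := by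
  have key : ∀ (i : Fin 2) (t : NC ⊗[ℚ] NC),
      LinearMap.mul' ℚ NC (LinearMap.rTensor NC dyn ((x i ⊗ₜ 1 + 1 ⊗ₜ x i) * t)) =
        x i * LinearMap.mul' ℚ NC (LinearMap.rTensor NC dyn t) +
          x i * TensorProduct.lid ℚ NC (LinearMap.rTensor NC (cf []) t) := by
    intro i t
    induction t using TensorProduct.induction_on with
    | zero => simp
    | tmul a b =>
      simp only [add_mul, Algebra.TensorProduct.tmul_mul_tmul, one_mul, map_add,
        LinearMap.rTensor_tmul, LinearMap.mul'_apply, dyn_x_mul, TensorProduct.lid_tmul, sub_mul,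
        smul_mul_assoc, mul_smul_comm, mul_assoc]
      abel
    | add s t hs ht =>
      rw [mul_add, map_add, map_add, hs, ht, map_add, map_add, map_add, map_add, mul_add, mul_add]
      abel
  induction l with
  | nil => simp [word_nil, Algebra.TensorProduct.one_def, dyn_one]
  | cons i l ih =>
    rw [word_cons, map_mul cop, cop_x, key, ih, counit_cop, List.length_cons, mul_smul_comm]
    push_cast
    rw [add_smul, one_smul]

/-- Dynkin–Specht–Wever: on p ⊗ 1 + 1 ⊗ p the operator of `dyn_cop_word` reduces to `dyn p`. -/
theorem dyn_of_mem_lie {n : ℕ} {p : NC} (hp : p ∈ lie n) : dyn p = (n : ℚ) • p := by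
  have h : LinearMap.mul' ℚ NC (LinearMap.rTensor NC dyn (cop p)) = (n : ℚ) • p := by
    refine eqOn_supp (f := LinearMap.mul' ℚ NC ∘ₗ LinearMap.rTensor NC dyn ∘ₗ cop.toLinearMap)
      (g := (n : ℚ) • LinearMap.id) ?_ hp.2
    rintro l rfl
    exact dyn_cop_word l
  rw [mem_prim.1 hp.1] at h
  simpa [dyn_one] using h

theorem lie_eq_map {n : ℕ} (hn : n ≠ 0) : lie n = (deg n).map dyn := by
  refine le_antisymm (fun p hp => ?_) ?_
  · refine ⟨(n : ℚ)⁻¹ • p, Submodule.smul_mem _ _ hp.2, ?_⟩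
    rw [map_smul, dyn_of_mem_lie hp, smul_smul, inv_mul_cancel₀ (by exact_mod_cast hn), one_smul]
  · rintro _ ⟨a, ha, rfl⟩
    exact ⟨dyn_mem_prim a, dyn_mem_deg ha⟩

/-! ### Contraction of the coproduct with a functional -/

/-- The contraction of the left factor of the coproduct with the coefficient of `u`. -/
def del (u : List (Fin 2)) : NC →ₗ[ℚ] NC :=
  (TensorProduct.lid ℚ NC).toLinearMap ∘ₗ LinearMap.rTensor NC (cf u) ∘ₗ cop.toLinearMap

/-- All words of p are at least as long as u, so u arises in the product only as itself times the
empty word. -/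
theorem cf_mul_of_length_le {u : List (Fin 2)} {p : NC} (hp : p ∈ supp {l | u.length ≤ l.length})
    (a : NC) : cf u (p * a) = cf u p * cf [] a := by
  refine eqOn_supp (f := cf u ∘ₗ LinearMap.mulRight ℚ a) (g := cf [] a • cf u) ?_ hp |>.trans
    (mul_comm _ _)
  intro l hl
  refine DFunLike.congr_fun (f := cf u ∘ₗ LinearMap.mulLeft ℚ (word l))
    (g := cf u (word l) • cf []) (hom_ext fun m => ?_) a |>.trans (mul_comm _ _)
  simp only [LinearMap.comp_apply, LinearMap.mulLeft_apply, LinearMap.smul_apply, ← word_append,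
    cf_word, smul_eq_mul]
  rcases eq_or_ne m [] with rfl | hm
  · simp
  · have : l ++ m ≠ u := by
      rintro rfl
      have h1 := List.length_pos_iff.2 hm
      have h2 : (l ++ m).length ≤ l.length := hl
      rw [List.length_append] at h2
      omega
    simp [this, hm]

/-- In the coproduct of p·a the part with 1 ⊗ p passes through, and the part with p ⊗ 1 contributes
only via the empty word, where the counit returns a. For y with `cf u y = 1` and other generators in
the kernel of `cf u`, `del u` thus behaves like d/dy. -/
theorem del_mul {u : List (Fin 2)} {p : NC} (hp : p ∈ prim)
    (hp' : p ∈ supp {l | u.length ≤ l.length}) (a : NC) :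
    del u (p * a) = p * del u a + cf u p • a := by
  have key : ∀ t : NC ⊗[ℚ] NC,
      TensorProduct.lid ℚ NC (LinearMap.rTensor NC (cf u) ((p ⊗ₜ 1 + 1 ⊗ₜ p) * t)) =
        p * TensorProduct.lid ℚ NC (LinearMap.rTensor NC (cf u) t) +
          cf u p • TensorProduct.lid ℚ NC (LinearMap.rTensor NC (cf []) t) := by
    intro t
    induction t using TensorProduct.induction_on with
    | zero => simp
    | tmul a b =>
      simp only [add_mul, Algebra.TensorProduct.tmul_mul_tmul, one_mul, map_add,
        LinearMap.rTensor_tmul, TensorProduct.lid_tmul, cf_mul_of_length_le hp', mul_smul_comm,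
        smul_smul]
      abel
    | add s t hs ht =>
      rw [mul_add, map_add, map_add, hs, ht, map_add, map_add, map_add, map_add, mul_add, smul_add]
      abel
  change TensorProduct.lid ℚ NC (LinearMap.rTensor NC (cf u) (cop (p * a))) = _
  rw [map_mul cop, mem_prim.1 hp, key, counit_cop]
  rfl

theorem del_one {u : List (Fin 2)} (hu : u ≠ []) : del u 1 = 0 := by
  change TensorProduct.lid ℚ NC (LinearMap.rTensor NC (cf u) (cop 1)) = 0
  rw [map_one, Algebra.TensorProduct.one_def, LinearMap.rTensor_tmul, TensorProduct.lid_tmul,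
    ← word_nil, cf_word, if_neg (Ne.symm hu), zero_smul]

end NC

end

section

namespace NC

/-! ### Graded subalgebras generated by Lie elements -/

theorem mul_mem_wt {M N a b : ℕ} {y z : NC} (hy : y ∈ wt M a) (hz : z ∈ wt N b) :
    y * z ∈ wt (M + N) (a + b) :=
  mul_mem_supp (by rintro s ⟨rfl, rfl⟩ t ⟨rfl, rfl⟩; exact ⟨by simp, by simp⟩) hy hz

theorem one_mem_wt : (1 : NC) ∈ wt 0 0 := word_mem_supp ⟨rfl, rfl⟩

theorem pr_word (N a : ℕ) (l : List (Fin 2)) :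
    pr N a (word l) = if l.length = N ∧ l.count 0 = a then word l else 0 := by
  by_cases h : l.length = N ∧ l.count 0 = a
  · rw [if_pos h, pr_of_mem (word_mem_supp h)]
  · rw [if_neg h, pr, proj, ofWords_word, if_neg]
    exact h

theorem pr_mul_of_mem_wt {M a : ℕ} {y : NC} (hy : y ∈ wt M a) (N b : ℕ) (z : NC) :
    pr N b (y * z) = if M ≤ N ∧ a ≤ b then y * pr (N - M) (b - a) z else 0 := by
  by_cases h : M ≤ N ∧ a ≤ b
  · rw [if_pos h]
    refine eqOn_supp (f := pr N b ∘ₗ LinearMap.mulRight ℚ z)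
      (g := LinearMap.mulRight ℚ (pr (N - M) (b - a) z)) ?_ hy
    rintro l ⟨rfl, rfl⟩
    refine DFunLike.congr_fun (f := pr N b ∘ₗ LinearMap.mulLeft ℚ (word l))
      (g := LinearMap.mulLeft ℚ (word l) ∘ₗ pr (N - l.length) (b - l.count 0))
      (hom_ext fun m => ?_) z
    simp only [LinearMap.comp_apply, LinearMap.mulLeft_apply]
    rw [← word_append, pr_word, pr_word, List.length_append, List.count_append]
    have : l.length + m.length = N ∧ List.count 0 l + List.count 0 m = b ↔
        m.length = N - l.length ∧ List.count 0 m = b - List.count 0 l := by omega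
    simp only [this]
    split_ifs
    · rw [word_append]
    · rw [mul_zero]
  · rw [if_neg h]
    refine eqOn_supp (f := pr N b ∘ₗ LinearMap.mulRight ℚ z) (g := 0) ?_ hy
    rintro l ⟨rfl, rfl⟩
    refine DFunLike.congr_fun (f := pr N b ∘ₗ LinearMap.mulLeft ℚ (word l))
      (g := 0) (hom_ext fun m => ?_) z
    simp only [LinearMap.comp_apply, LinearMap.mulLeft_apply, LinearMap.zero_apply]
    rw [← word_append, pr_word, List.length_append, List.count_append, if_neg]
    omega

/-- Monomials in bihomogeneous generators are bihomogeneous, so the subalgebra is graded. -/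
theorem pr_mem_adjoin {S : Set NC} (hS : ∀ p ∈ S, ∃ N a, p ∈ wt N a) {b : NC}
    (hb : b ∈ Algebra.adjoin ℚ S) (N a : ℕ) : pr N a b ∈ Algebra.adjoin ℚ S := by
  have hb' : b ∈ Submodule.span ℚ (Submonoid.closure S : Set NC) := by
    rw [← Algebra.adjoin_eq_span]; exact hb
  induction hb' using Submodule.span_induction with
  | mem z hz =>
    have hw : ∃ N a, z ∈ wt N a := by
      induction hz using Submonoid.closure_induction with
      | mem p hp => exact hS p hp
      | one => exact ⟨0, 0, one_mem_wt⟩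
      | mul p q hp hq h1 h2 =>
        have mem : ∀ p ∈ Submonoid.closure S, p ∈ Algebra.adjoin ℚ S := fun p hp =>
          (Submonoid.closure_le (S := (Algebra.adjoin ℚ S).toSubmonoid)).2
            Algebra.subset_adjoin hp
        obtain ⟨N, a, h1⟩ := h1 (mem p hp)
        obtain ⟨M, b, h2⟩ := h2 (mem q hq)
        exact ⟨_, _, mul_mem_wt h1 h2⟩
    obtain ⟨M, c, hw⟩ := hw
    by_cases h : M = N ∧ c = a
    · obtain ⟨rfl, rfl⟩ := h
      rwa [pr_of_mem hw]
    · have : pr N a z = 0 := by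
        refine proj_eq_zero (Set.disjoint_left.2 ?_) hw
        rintro l ⟨rfl, rfl⟩ ⟨h1, h2⟩
        exact h ⟨h1.symm, h2.symm⟩
      rw [this]
      exact zero_mem _
  | zero => rw [map_zero]; exact zero_mem _
  | add p q hp hq h1 h2 =>
    rw [map_add]
    rw [← Algebra.adjoin_eq_span] at hp hq
    exact add_mem (h1 hp) (h2 hq)
  | smul c p hp h =>
    rw [map_smul]
    rw [← Algebra.adjoin_eq_span] at hp
    exact Subalgebra.smul_mem _ (h hp) c

/-! ### Splitting off one generator of lowest degree -/

section Elimination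

variable {S : Set NC} {y : NC} {u : List (Fin 2)}

theorem del_adjoin (hu : u ≠ [])
    (hS : ∀ p ∈ S, p ∈ prim ∧ p ∈ supp {l | u.length ≤ l.length} ∧ cf u p = 0) {c : NC}
    (hc : c ∈ Algebra.adjoin ℚ S) : del u c = 0 := by
  have h : ∀ a, del u (c * a) = c * del u a := by
    induction hc using Algebra.adjoin_induction with
    | mem p hp => intro a; rw [del_mul (hS p hp).1 (hS p hp).2.1, (hS p hp).2.2, zero_smul, add_zero]
    | algebraMap r => intro a; rw [← Algebra.smul_def, ← Algebra.smul_def, map_smul]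
    | add p q _ _ h1 h2 => intro a; rw [add_mul, map_add, h1, h2, add_mul]
    | mul p q _ _ h1 h2 => intro a; rw [mul_assoc, h1, h2, mul_assoc]
  rw [← mul_one c, h, del_one hu, mul_zero]

theorem pow_del_mul (hy : y ∈ prim) (hy' : y ∈ supp {l | u.length ≤ l.length}) (hu : cf u y = 1)
    (k : ℕ) (a : NC) :
    (del u ^ (k + 1)) (y * a) = y * (del u ^ (k + 1)) a + ((k : ℚ) + 1) • (del u ^ k) a := by
  induction k with
  | zero => simp [del_mul hy hy', hu]
  | succ k ih =>
    rw [pow_succ', Module.End.mul_apply, ih, map_add, map_smul, del_mul hy hy', hu, one_smul,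
      ← Module.End.mul_apply, ← pow_succ', ← Module.End.mul_apply, ← pow_succ']
    push_cast
    module

/-- Local nilpotence of d/dy passes through each generator: a factor y raises the exponent by one, a
factor from `S` leaves it unchanged. -/
theorem exists_pow_del_eq_zero (hu : u ≠ [])
    (hS : ∀ p ∈ S, p ∈ prim ∧ p ∈ supp {l | u.length ≤ l.length} ∧ cf u p = 0)
    (hy : y ∈ prim) (hy' : y ∈ supp {l | u.length ≤ l.length}) (huy : cf u y = 1) {b : NC}
    (hb : b ∈ Algebra.adjoin ℚ (insert y S)) : ∃ k, (del u ^ k) b = 0 := by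
  have mono : ∀ {a k l}, k ≤ l → (del u ^ k) a = 0 → (del u ^ l) a = 0 := by
    intro a k l h h0
    rw [← Nat.sub_add_cancel h, pow_add, Module.End.mul_apply, h0, map_zero]
  have h : ∀ a, (∃ k, (del u ^ k) a = 0) → ∃ k, (del u ^ k) (b * a) = 0 := by
    induction hb using Algebra.adjoin_induction with
    | mem p hp =>
      rintro a ⟨k, hk⟩
      rcases hp with rfl | hp
      · refine ⟨k + 1, ?_⟩
        rw [pow_del_mul hy hy' huy, hk, mono (Nat.le_succ k) hk, mul_zero, smul_zero, add_zero]
      · refine ⟨k, ?_⟩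
        have : ∀ k, (del u ^ k) (p * a) = p * (del u ^ k) a := by
          intro k
          induction k with
          | zero => simp
          | succ k ih =>
            rw [pow_succ', Module.End.mul_apply, ih, del_mul (hS p hp).1 (hS p hp).2.1,
              (hS p hp).2.2, zero_smul, add_zero, Module.End.mul_apply]
        rw [this, hk, mul_zero]
    | algebraMap r =>
      rintro a ⟨k, hk⟩
      exact ⟨k, by rw [← Algebra.smul_def, map_smul, hk, smul_zero]⟩
    | add p q _ _ h1 h2 =>
      intro a ha
      obtain ⟨k, hk⟩ := h1 a ha
      obtain ⟨l, hl⟩ := h2 a ha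
      refine ⟨max k l, ?_⟩
      rw [add_mul, map_add, mono (le_max_left k l) hk, mono (le_max_right k l) hl, add_zero]
    | mul p q _ _ h1 h2 => intro a ha; rw [mul_assoc]; exact h1 _ (h2 a ha)
  rw [← mul_one b]
  exact h 1 ⟨1, by rw [pow_one, del_one hu]⟩

/-- If k + 1 were the least exponent killing a, then applying `del u ^ (k + 1)` to y·a would leave k
+ 1 times the nonzero `del u ^ k` of a, although `del u` kills y·a. -/
theorem eq_zero_of_del_mul (hy : y ∈ prim) (hy' : y ∈ supp {l | u.length ≤ l.length})
    (huy : cf u y = 1) {a : NC} (ha : ∃ k, (del u ^ k) a = 0) (h : del u (y * a) = 0) : a = 0 := by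
  classical
  rcases hk : Nat.find ha with _ | k
  · have := Nat.find_spec ha
    rw [hk] at this
    simpa using this
  · exfalso
    have h1 := Nat.find_spec ha
    have h2 := Nat.find_min ha (m := k) (by omega)
    rw [hk] at h1
    have h3 := pow_del_mul hy hy' huy k a
    rw [pow_succ, Module.End.mul_apply, h, map_zero, ← pow_succ, h1, mul_zero, zero_add] at h3
    exact h2 ((smul_eq_zero.1 h3.symm).resolve_left (by positivity))

theorem commutator_mem_adjoin (hyS : ∀ p ∈ S, p * y - y * p ∈ Algebra.adjoin ℚ S) {c : NC}
    (hc : c ∈ Algebra.adjoin ℚ S) : c * y - y * c ∈ Algebra.adjoin ℚ S := by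
  induction hc using Algebra.adjoin_induction with
  | mem p hp => exact hyS p hp
  | algebraMap r => rw [(Algebra.commutes r y).symm, sub_self]; exact zero_mem _
  | add p q _ _ h1 h2 =>
    have : (p + q) * y - y * (p + q) = (p * y - y * p) + (q * y - y * q) := by noncomm_ring
    rw [this]; exact add_mem h1 h2
  | mul p q hp hq h1 h2 =>
    have : p * q * y - y * (p * q) = p * (q * y - y * q) + (p * y - y * p) * q := by noncomm_ring
    rw [this]; exact add_mem (mul_mem hp h2) (mul_mem h1 hq)

/-- The sum `adjoin S` + y·B contains 1 and is closed under right multiplication by generators: c·y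
= (c·y − y·c) + y·c, and the commutator stays in `adjoin S`. -/
theorem exists_eq_add_mul (hyS : ∀ p ∈ S, p * y - y * p ∈ Algebra.adjoin ℚ S) {b : NC}
    (hb : b ∈ Algebra.adjoin ℚ (insert y S)) :
    ∃ c ∈ Algebra.adjoin ℚ S, ∃ b' ∈ Algebra.adjoin ℚ (insert y S), b = c + y * b' := by
  have hle : Algebra.adjoin ℚ S ≤ Algebra.adjoin ℚ (insert y S) :=
    Algebra.adjoin_mono (Set.subset_insert y S)
  have hyB : y ∈ Algebra.adjoin ℚ (insert y S) := Algebra.subset_adjoin (Set.mem_insert y S)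
  let D : Submodule ℚ NC := Subalgebra.toSubmodule (Algebra.adjoin ℚ S) ⊔
    (Subalgebra.toSubmodule (Algebra.adjoin ℚ (insert y S))).map (LinearMap.mulLeft ℚ y)
  have hD : ∀ {e}, e ∈ D ↔ ∃ c ∈ Algebra.adjoin ℚ S,
      ∃ b' ∈ Algebra.adjoin ℚ (insert y S), e = c + y * b' := by
    intro e
    rw [Submodule.mem_sup]
    constructor
    · rintro ⟨c, hc, _, ⟨b', hb', rfl⟩, rfl⟩
      exact ⟨c, hc, b', hb', rfl⟩
    · rintro ⟨c, hc, b', hb', rfl⟩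
      exact ⟨c, hc, _, ⟨b', hb', rfl⟩, rfl⟩
  rw [← hD]
  have key : ∀ e ∈ D, e * b ∈ D := by
    induction hb using Algebra.adjoin_induction with
    | mem p hp =>
      intro e he
      obtain ⟨c, hc, b', hb', rfl⟩ := hD.1 he
      have hpB := Algebra.subset_adjoin (R := ℚ) hp
      rcases hp with rfl | hp
      · exact hD.2 ⟨_, commutator_mem_adjoin hyS hc, c + b' * p, add_mem (hle hc) (mul_mem hb' hpB),
          by noncomm_ring⟩
      · exact hD.2 ⟨_, mul_mem hc (Algebra.subset_adjoin hp), b' * p, mul_mem hb' hpB,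
          by noncomm_ring⟩
    | algebraMap r => intro e he; rw [← Algebra.commutes, ← Algebra.smul_def]; exact D.smul_mem r he
    | add p q _ _ h1 h2 => intro e he; rw [mul_add]; exact add_mem (h1 e he) (h2 e he)
    | mul p q _ _ h1 h2 => intro e he; rw [← mul_assoc]; exact h2 _ (h1 e he)
  rw [← one_mul b]
  exact key 1 (hD.2 ⟨1, one_mem _, 0, zero_mem _, by simp⟩)

theorem supp_le_of_wt {N a : ℕ} (h : u.length ≤ N) : wt N a ≤ supp {l | u.length ≤ l.length} :=
  supp_mono fun l hl => by rw [Set.mem_ofPred_eq, hl.1]; exact h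

/-- B is the direct sum of `adjoin S` and y·B, with b ↦ y·b injective on B. For c + y·b = 0, apply
`del u`: it kills c, and `eq_zero_of_del_mul` gives b = 0. Bihomogeneity cuts the splitting down to
each bidegree. -/
theorem finrank_adjoin_insert (hu : u ≠ [])
    (hS : ∀ p ∈ S, p ∈ prim ∧ cf u p = 0 ∧ ∃ N a, u.length ≤ N ∧ p ∈ wt N a)
    (hy : y ∈ prim) {m : ℕ} (hym : y ∈ wt u.length m) (huy : cf u y = 1)
    (hyS : ∀ p ∈ S, p * y - y * p ∈ Algebra.adjoin ℚ S) (N a : ℕ) :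
    Module.finrank ℚ ↥(Subalgebra.toSubmodule (Algebra.adjoin ℚ (insert y S)) ⊓ wt N a) =
      Module.finrank ℚ ↥(Subalgebra.toSubmodule (Algebra.adjoin ℚ S) ⊓ wt N a) +
      if u.length ≤ N ∧ m ≤ a then
        Module.finrank ℚ ↥(Subalgebra.toSubmodule (Algebra.adjoin ℚ (insert y S)) ⊓
          wt (N - u.length) (a - m)) else 0 := by
  have hS' : ∀ p ∈ S, p ∈ prim ∧ p ∈ supp {l | u.length ≤ l.length} ∧ cf u p = 0 := by
    intro p hp
    obtain ⟨h1, h2, N, a, h3, h4⟩ := hS p hp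
    exact ⟨h1, supp_le_of_wt h3 h4, h2⟩
  have hy' := supp_le_of_wt le_rfl hym
  have hle : Algebra.adjoin ℚ S ≤ Algebra.adjoin ℚ (insert y S) :=
    Algebra.adjoin_mono (Set.subset_insert y S)
  have hgS : ∀ p ∈ S, ∃ N a, p ∈ wt N a := fun p hp => by
    obtain ⟨_, _, N, a, _, h⟩ := hS p hp
    exact ⟨N, a, h⟩
  have hgB : ∀ p ∈ insert y S, ∃ N a, p ∈ wt N a := by
    rintro p (rfl | hp)
    exacts [⟨_, _, hym⟩, hgS p hp]
  have hdec : ∀ b ∈ Algebra.adjoin ℚ (insert y S), b ∈ wt N a →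
      ∃ c ∈ Algebra.adjoin ℚ S, c ∈ wt N a ∧ ∃ b' ∈ Algebra.adjoin ℚ (insert y S),
        b = c + if u.length ≤ N ∧ m ≤ a then y * pr (N - u.length) (a - m) b' else 0 := by
    intro b hb hbw
    obtain ⟨c, hc, b', hb', e⟩ := exists_eq_add_mul hyS hb
    refine ⟨_, pr_mem_adjoin hgS hc N a, pr_mem N a c, b', hb', ?_⟩
    rw [← pr_mul_of_mem_wt hym, ← map_add, ← e, pr_of_mem hbw]
  split_ifs with h
  · let f : (↥(Subalgebra.toSubmodule (Algebra.adjoin ℚ S) ⊓ wt N a) ×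
        ↥(Subalgebra.toSubmodule (Algebra.adjoin ℚ (insert y S)) ⊓
          wt (N - u.length) (a - m))) →ₗ[ℚ] NC :=
      (Submodule.subtype _).coprod (LinearMap.mulLeft ℚ y ∘ₗ Submodule.subtype _)
    have hf : ∀ c b, f (c, b) = c.1 + y * b.1 := fun c b => by
      simp [f, LinearMap.coprod_apply]
    have hinj : Function.Injective f := by
      rw [← LinearMap.ker_eq_bot, LinearMap.ker_eq_bot']
      rintro ⟨c, b⟩ h0
      rw [hf] at h0
      have hc := del_adjoin hu hS' c.2.1
      have h1 := congrArg (del u) h0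
      rw [map_add, hc, zero_add, map_zero] at h1
      have hb0 := eq_zero_of_del_mul hy hy' huy (exists_pow_del_eq_zero hu hS' hy hy' huy b.2.1) h1
      rw [hb0, mul_zero, add_zero] at h0
      exact Prod.ext (Subtype.ext h0) (Subtype.ext hb0)
    have hrange : LinearMap.range f =
        Subalgebra.toSubmodule (Algebra.adjoin ℚ (insert y S)) ⊓ wt N a := by
      refine le_antisymm ?_ ?_
      · rintro _ ⟨⟨c, b⟩, rfl⟩
        rw [hf]
        refine ⟨(Algebra.adjoin ℚ (insert y S)).add_mem (hle c.2.1)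
          ((Algebra.adjoin ℚ (insert y S)).mul_mem (Algebra.subset_adjoin (Set.mem_insert y S))
            b.2.1), add_mem c.2.2 ?_⟩
        have := mul_mem_wt hym b.2.2
        rwa [Nat.add_sub_cancel' h.1, Nat.add_sub_cancel' h.2] at this
      · rintro b ⟨hb, hbw⟩
        obtain ⟨c, hc, hcw, b', hb', e⟩ := hdec b hb hbw
        rw [if_pos h] at e
        exact ⟨(⟨c, hc, hcw⟩, ⟨_, pr_mem_adjoin hgB hb' _ _, pr_mem _ _ _⟩), by rw [hf, e]⟩
    have := fun U : Submodule ℚ NC => fun N a =>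
      Submodule.finiteDimensional_of_le (inf_le_right : U ⊓ wt N a ≤ wt N a)
    rw [← hrange, LinearMap.finrank_range_of_inj hinj, Module.finrank_prod]
  · rw [add_zero]
    refine congrArg (fun U : Submodule ℚ NC => Module.finrank ℚ U)
      (le_antisymm ?_ (inf_le_inf_right _ hle))
    rintro b ⟨hb, hbw⟩
    obtain ⟨c, hc, hcw, b', hb', e⟩ := hdec b hb hbw
    rw [if_neg h, add_zero] at e
    exact e ▸ ⟨hc, hcw⟩

end Elimination

end NC

end

section

namespace NC

/-! ### Hilbert series -/

/-- The homogeneous elements of `U` of degree `d` together with all the homogeneous primitive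
elements of degree greater than `d`. -/
def gens (d : ℕ) (U : Submodule ℚ NC) : Set NC :=
  {p | ∃ a, p ∈ U ⊓ wt d a} ∪ {p | ∃ n a, d < n ∧ p ∈ prim ⊓ wt n a}

/-- The bigraded Hilbert series of a subalgebra. -/
def hilb (B : Subalgebra ℚ NC) : PowerSeries (PowerSeries ℚ) :=
  PowerSeries.mk fun N => PowerSeries.mk fun a =>
    (Module.finrank ℚ ↥(Subalgebra.toSubmodule B ⊓ wt N a) : ℚ)

/-- The monomial of bidegree `(d, m)`. -/
def monom (d m : ℕ) : PowerSeries (PowerSeries ℚ) :=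
  PowerSeries.X ^ d * PowerSeries.C (PowerSeries.X ^ m)

theorem coeff_monom_mul (d m : ℕ) (f : PowerSeries (PowerSeries ℚ)) (N a : ℕ) :
    (PowerSeries.coeff N (monom d m * f)).coeff a =
      if d ≤ N ∧ m ≤ a then (f.coeff (N - d)).coeff (a - m) else 0 := by
  rw [monom, mul_assoc, PowerSeries.coeff_X_pow_mul']
  by_cases h : d ≤ N
  · rw [if_pos h, PowerSeries.coeff_C_mul, PowerSeries.coeff_X_pow_mul']
    simp [h]
  · simp [h]

theorem hilb_adjoin_insert {S : Set NC} {y : NC} {u : List (Fin 2)} (hu : u ≠ [])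
    (hS : ∀ p ∈ S, p ∈ prim ∧ cf u p = 0 ∧ ∃ N a, u.length ≤ N ∧ p ∈ wt N a)
    (hy : y ∈ prim) {m : ℕ} (hym : y ∈ wt u.length m) (huy : cf u y = 1)
    (hyS : ∀ p ∈ S, p * y - y * p ∈ Algebra.adjoin ℚ S) :
    hilb (Algebra.adjoin ℚ (insert y S)) * (1 - monom u.length m) =
      hilb (Algebra.adjoin ℚ S) := by
  rw [mul_sub, mul_one, mul_comm _ (monom _ _), sub_eq_iff_eq_add]
  ext N a
  rw [map_add, map_add, coeff_monom_mul]
  simp only [hilb, PowerSeries.coeff_mk]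
  rw [finrank_adjoin_insert hu hS hy hym huy hyS N a]
  push_cast
  rfl

theorem finrank_inf_ker {U : Submodule ℚ NC} {d m : ℕ} {f : NC →ₗ[ℚ] ℚ} {y : NC}
    (hy : y ∈ U ⊓ wt d m) (hfy : f y = 1) :
    Module.finrank ℚ ↥(U ⊓ wt d m) = Module.finrank ℚ ↥(U ⊓ LinearMap.ker f ⊓ wt d m) + 1 := by
  have : FiniteDimensional ℚ ↥(U ⊓ wt d m) := Submodule.finiteDimensional_of_le inf_le_right
  let φ : ↥(U ⊓ wt d m) →ₗ[ℚ] ℚ := f.domRestrict _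
  have hs : LinearMap.range φ = ⊤ := by
    rw [LinearMap.range_eq_top]
    intro c
    exact ⟨c • ⟨y, hy⟩, by rw [map_smul]; change c • f y = c; rw [hfy, smul_eq_mul, mul_one]⟩
  have hk : (LinearMap.ker φ).map (Submodule.subtype _) = U ⊓ LinearMap.ker f ⊓ wt d m := by
    ext z
    constructor
    · rintro ⟨⟨z, hz⟩, h, rfl⟩
      exact ⟨⟨hz.1, h⟩, hz.2⟩
    · rintro ⟨⟨h1, h2⟩, h3⟩
      exact ⟨⟨z, h1, h3⟩, h2, rfl⟩
  rw [← hk, Submodule.finrank_map_subtype_eq, ← φ.finrank_range_add_finrank_ker, hs, finrank_top,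
    Module.finrank_self, add_comm]

/-- Elements of `U` are eliminated one at a time. A word u occurring in some z ∈ U selects a weight
component of z, scaled to a y with coefficient 1 at u; then U' = U ∩ ker(`cf u`) is smaller by one
dimension, and brackets with y have degree above d, so they are already generators. -/
theorem hilb_gens {d : ℕ} (hd : d ≠ 0) : ∀ (r : ℕ) (U : Submodule ℚ NC), U ≤ lie d →
    (∀ y ∈ U, ∀ a, pr d a y ∈ U) → Module.finrank ℚ U = r →
    hilb (Algebra.adjoin ℚ (gens d U)) *
      ∏ a ∈ Finset.range (d + 1), (1 - monom d a) ^ Module.finrank ℚ ↥(U ⊓ wt d a) =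
    hilb (Algebra.adjoin ℚ (gens d ⊥)) := by
  intro r
  induction r with
  | zero =>
    intro U hU _ h0
    have : FiniteDimensional ℚ U := Submodule.finiteDimensional_of_le (hU.trans (lie_le d))
    obtain rfl := Submodule.finrank_eq_zero.1 h0
    rw [Finset.prod_eq_one, mul_one]
    intro a _
    rw [bot_inf_eq, finrank_bot, pow_zero]
  | succ r ih =>
    intro U hU hpr hr
    have : FiniteDimensional ℚ U := Submodule.finiteDimensional_of_le (hU.trans (lie_le d))
    obtain ⟨z, hz, hz0⟩ := Submodule.exists_mem_ne_zero_of_ne_bot (p := U) (by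
      rintro rfl
      simp at hr)
    obtain ⟨u, huz⟩ : ∃ u, cf u z ≠ 0 := by
      by_contra! h
      exact hz0 (ext_cf fun l => by rw [h l, map_zero])
    have hud : u.length = d := mem_supp.1 (hU hz).2 u huz
    have hu : u ≠ [] := by rintro rfl; exact hd hud.symm
    set m := u.count 0 with hm
    have hcfpr : ∀ a v, cf u (pr d a v) = if m = a then cf u v else 0 := by
      intro a v
      rw [pr, cf_proj]
      simp only [Set.mem_ofPred_eq, hud, true_and, hm]
    have hcfwt : ∀ {n a : ℕ} {p : NC}, p ∈ wt n a → (n ≠ d ∨ a ≠ m) → cf u p = 0 := by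
      intro n a p hp hna
      by_contra hc
      have := mem_supp.1 hp u hc
      rcases hna with h | h
      · exact h (this.1.symm.trans hud)
      · exact h (this.2.symm)
    let y := (cf u z)⁻¹ • pr d m z
    have hyU : y ∈ U := Submodule.smul_mem _ _ (hpr z hz m)
    have hyw : y ∈ wt d m := Submodule.smul_mem _ _ (pr_mem d m z)
    have huy : cf u y = 1 := by
      rw [map_smul, hcfpr, if_pos rfl, smul_eq_mul, inv_mul_cancel₀ huz]
    let U' := U ⊓ LinearMap.ker (cf u)
    have hU' : U' ≤ lie d := inf_le_left.trans hU
    have hS : ∀ p ∈ gens d U', p ∈ prim ∧ cf u p = 0 ∧ ∃ N a, u.length ≤ N ∧ p ∈ wt N a := by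
      rintro p (⟨a, hp, hpw⟩ | ⟨n, a, hn, hp, hpw⟩)
      · exact ⟨(hU hp.1).1, hp.2, d, a, hud.le, hpw⟩
      · exact ⟨hp, hcfwt hpw (Or.inl (by omega)), n, a, by omega, hpw⟩
    have hyS : ∀ p ∈ gens d U', p * y - y * p ∈ Algebra.adjoin ℚ (gens d U') := by
      intro p hp
      obtain ⟨h1, -, N, a, h2, h3⟩ := hS p hp
      refine Algebra.subset_adjoin (Or.inr ⟨N + d, a + m, by omega,
        bracket_mem_prim h1 (hU hyU).1, sub_mem (mul_mem_wt h3 hyw) ?_⟩)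
      rw [add_comm N, add_comm a]
      exact mul_mem_wt hyw h3
    have hadj : Algebra.adjoin ℚ (gens d U) = Algebra.adjoin ℚ (insert y (gens d U')) := by
      refine le_antisymm (Algebra.adjoin_le ?_) (Algebra.adjoin_mono ?_)
      · rintro p (⟨a, hp, hpw⟩ | hp)
        · by_cases ham : a = m
          · subst ham
            have e : p = cf u p • y + (p - cf u p • y) := by abel
            rw [e]
            refine add_mem (Subalgebra.smul_mem _ (Algebra.subset_adjoin (Set.mem_insert _ _)) _)
              (Algebra.subset_adjoin (Or.inr (Or.inl ⟨_, ⟨sub_mem hp (U.smul_mem _ hyU), ?_⟩,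
                sub_mem hpw (Submodule.smul_mem _ _ hyw)⟩)))
            rw [SetLike.mem_coe, LinearMap.mem_ker, map_sub, map_smul, huy, smul_eq_mul, mul_one, sub_self]
          · exact Algebra.subset_adjoin
              (Or.inr (Or.inl ⟨a, ⟨hp, hcfwt hpw (Or.inr ham)⟩, hpw⟩))
        · exact Algebra.subset_adjoin (Or.inr (Or.inr hp))
      · rintro p (rfl | ⟨a, hp, hpw⟩ | hp)
        exacts [Or.inl ⟨m, hyU, hyw⟩, Or.inl ⟨a, hp.1, hpw⟩, Or.inr hp]
    have hfr : ∀ a, Module.finrank ℚ ↥(U ⊓ wt d a) =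
        Module.finrank ℚ ↥(U' ⊓ wt d a) + if m = a then 1 else 0 := by
      intro a
      split_ifs with h
      · subst h
        exact finrank_inf_ker ⟨hyU, hyw⟩ huy
      · refine congrArg (fun U : Submodule ℚ NC => Module.finrank ℚ U) (le_antisymm ?_ ?_)
        · exact fun p hp => ⟨⟨hp.1, hcfwt hp.2 (Or.inr (Ne.symm h))⟩, hp.2⟩
        · exact inf_le_inf_right _ inf_le_left
    have hpr' : ∀ y ∈ U', ∀ a, pr d a y ∈ U' := fun v hv a =>
      ⟨hpr v hv.1 a, by rw [SetLike.mem_coe, LinearMap.mem_ker, hcfpr, LinearMap.mem_ker.1 hv.2, ite_self]⟩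
    have hlt : U' ≤ U := inf_le_left
    have hr' : Module.finrank ℚ U' = r := by
      have h1 := finrank_eq_sum_wt (hU.trans (lie_le d)) fun v hv a => hpr v hv a
      have h2 := finrank_eq_sum_wt (hU'.trans (lie_le d)) fun v hv a => hpr' v hv a
      simp only [hfr, Finset.sum_add_distrib] at h1
      rw [← h2, Finset.sum_ite_eq, if_pos] at h1
      · omega
      · rw [Finset.mem_range, hm, ← hud]
        exact Nat.lt_succ_of_le List.count_le_length
    have hprod : ∏ a ∈ Finset.range (d + 1), (1 - monom d a) ^ Module.finrank ℚ ↥(U ⊓ wt d a) =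
        (1 - monom d m) * ∏ a ∈ Finset.range (d + 1),
          (1 - monom d a) ^ Module.finrank ℚ ↥(U' ⊓ wt d a) := by
      simp only [hfr, pow_add, Finset.prod_mul_distrib, pow_ite, pow_one, pow_zero]
      rw [Finset.prod_ite_eq, if_pos, mul_comm]
      rw [Finset.mem_range, hm, ← hud]
      exact Nat.lt_succ_of_le List.count_le_length
    have hstep := hilb_adjoin_insert hu hS (hU hyU).1 (m := m) (by rw [hud]; exact hyw) huy hyS
    rw [hud] at hstep
    rw [hprod, ← mul_assoc, hadj, hstep]
    exact ih U' hU' hpr' hr'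

theorem lie_inf_wt (n a : ℕ) : lie n ⊓ wt n a = prim ⊓ wt n a := by
  rw [lie, inf_assoc, inf_eq_right.2 (wt_le_deg n a)]

theorem gens_bot (d : ℕ) : gens d ⊥ = gens (d + 1) (lie (d + 1)) := by
  ext p
  constructor
  · rintro (⟨a, hp, -⟩ | ⟨n, a, hn, hp⟩)
    · rw [(Submodule.mem_bot ℚ).1 hp]
      exact Or.inl ⟨0, zero_mem _⟩
    · rcases Nat.lt_or_ge (d + 1) n with h | h
      · exact Or.inr ⟨n, a, h, hp⟩
      · obtain rfl : n = d + 1 := by omega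
        exact Or.inl ⟨a, by rwa [lie_inf_wt]⟩
  · rintro (⟨a, hp⟩ | ⟨n, a, hn, hp⟩)
    · rw [lie_inf_wt] at hp
      exact Or.inr ⟨_, a, Nat.lt_succ_self d, hp⟩
    · exact Or.inr ⟨n, a, by omega, hp⟩

theorem x_mem_wt (i : Fin 2) : x i ∈ wt 1 (List.count 0 [i]) := word_mem_supp ⟨rfl, rfl⟩

theorem adjoin_gens_zero : Algebra.adjoin ℚ (gens 0 ⊥) = ⊤ := by
  rw [eq_top_iff]
  intro a _
  induction a using word_induction with
  | hw l =>
    induction l with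
    | nil => exact one_mem _
    | cons i l ih =>
      rw [word_cons]
      exact mul_mem (Algebra.subset_adjoin
        (Or.inr ⟨1, _, Nat.one_pos, x_mem_prim i, x_mem_wt i⟩)) (ih trivial)
  | h0 => exact zero_mem _
  | hadd a b ha hb => exact add_mem (ha trivial) (hb trivial)
  | hsmul c a ha => exact Subalgebra.smul_mem _ (ha trivial) c

/-- The product formula of Poincaré–Birkhoff–Witt type, truncated at N: starting from the whole
algebra, which the letters generate, the Lie elements of degrees 1 to N are eliminated in turn. -/
theorem hilb_top_mul_prod (N : ℕ) :
    hilb ⊤ * ∏ n ∈ Finset.range N, ∏ a ∈ Finset.range (n + 2),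
      (1 - monom (n + 1) a) ^ Module.finrank ℚ ↥(prim ⊓ wt (n + 1) a) =
    hilb (Algebra.adjoin ℚ (gens N ⊥)) := by
  induction N with
  | zero => rw [Finset.prod_range_zero, mul_one, adjoin_gens_zero]
  | succ N ih =>
    rw [Finset.prod_range_succ, ← mul_assoc, ih, gens_bot,
      ← hilb_gens (Nat.succ_ne_zero N) _ _ le_rfl
        (fun y hy a => pr_mem_of_stable (lie_le _) (lie_stable _) hy a) rfl]
    refine congrArg _ (Finset.prod_congr rfl fun a _ => ?_)
    rw [lie_inf_wt]

theorem coeff_hilb_gens {N n : ℕ} (hn : n ≤ N) :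
    (hilb (Algebra.adjoin ℚ (gens N ⊥))).coeff n = if n = 0 then 1 else 0 := by
  ext a
  rw [hilb, PowerSeries.coeff_mk, PowerSeries.coeff_mk]
  split_ifs with h
  · subst h
    rw [PowerSeries.coeff_one]
    split_ifs with h
    · subst h
      have e : Subalgebra.toSubmodule (Algebra.adjoin ℚ (gens N ⊥)) ⊓ wt 0 0 =
          Submodule.span ℚ {1} := by
        have hw : wt 0 0 = Submodule.span ℚ {1} := by
          rw [wt, supp]
          congr 1
          ext z
          simp only [Set.mem_image, Set.mem_ofPred_eq, Set.mem_singleton_iff]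
          constructor
          · rintro ⟨l, ⟨h1, -⟩, rfl⟩
            rw [List.length_eq_zero_iff.1 h1, word_nil]
          · rintro rfl
            exact ⟨[], ⟨rfl, rfl⟩, rfl⟩
        rw [hw, inf_eq_right, Submodule.span_le]
        rintro _ rfl
        exact one_mem (Algebra.adjoin ℚ (gens N ⊥))
      rw [e, finrank_span_singleton one_ne_zero, Nat.cast_one]
    · rw [wt_eq_bot (Nat.pos_of_ne_zero h), inf_bot_eq, finrank_bot, Nat.cast_zero]
  · rw [map_zero, Nat.cast_eq_zero]
    -- After subtraction of the constant term only words longer than N remain; this is stable under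
    -- products, since each term of the expansion contains p − ε(p) or q − ε(q).
    have key : ∀ b ∈ Algebra.adjoin ℚ (gens N ⊥), b - eps b • 1 ∈ supp {l | N < l.length} := by
      intro b hb
      induction hb using Algebra.adjoin_induction with
      | mem p hp =>
        have hp' : p ∈ supp {l | N < l.length} := by
          rcases hp with ⟨a, hp, -⟩ | ⟨n, a, hn, -, hp⟩
          · rw [(Submodule.mem_bot ℚ).1 hp]; exact zero_mem _
          · exact supp_mono (fun l hl => by rw [Set.mem_ofPred_eq, hl.1]; exact hn) hp
        have : eps p = 0 := by
          rw [eps_eq]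
          by_contra h
          exact Nat.not_lt_zero _ (mem_supp.1 hp' [] h)
        rwa [this, zero_smul, sub_zero]
      | algebraMap r =>
        rw [AlgHom.commutes, Algebra.algebraMap_self_apply, Algebra.algebraMap_eq_smul_one,
          sub_self]
        exact zero_mem _
      | add p q _ _ h1 h2 =>
        have : p + q - eps (p + q) • 1 = (p - eps p • 1) + (q - eps q • 1) := by
          rw [map_add]; module
        rw [this]; exact add_mem h1 h2
      | mul p q _ _ h1 h2 =>
        have : p * q - eps (p * q) • 1 = (p - eps p • 1) * (q - eps q • 1) +
            eps q • (p - eps p • 1) + eps p • (q - eps q • 1) := by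
          rw [map_mul eps, sub_mul, mul_sub, mul_sub, smul_mul_assoc, smul_mul_assoc,
            mul_smul_comm, mul_smul_comm, one_mul, mul_one, one_mul, mul_smul]
          module
        rw [this]
        exact add_mem (add_mem (mul_mem_supp (fun s hs t ht => by
            simp only [Set.mem_ofPred_eq, List.length_append] at *; omega) h1 h2)
          (Submodule.smul_mem _ _ h1)) (Submodule.smul_mem _ _ h2)
    have e : Subalgebra.toSubmodule (Algebra.adjoin ℚ (gens N ⊥)) ⊓ wt n a = ⊥ := by
      rw [eq_bot_iff]
      rintro b ⟨hb, hbw⟩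
      have hb1 := key b hb
      have h0 : eps b = 0 := by
        rw [eps_eq]
        by_contra hc
        exact h (mem_supp.1 hbw [] hc).1.symm
      rw [h0, zero_smul, sub_zero] at hb1
      refine (Submodule.mem_bot ℚ).2 (ext_cf fun l => ?_)
      rw [map_zero]
      by_contra hc
      have h1 := mem_supp.1 hb1 l hc
      have h2 := (mem_supp.1 hbw l hc).1
      simp only [Set.mem_ofPred_eq] at h1
      omega
    rw [e, finrank_bot]

theorem finrank_wt (N a : ℕ) : Module.finrank ℚ (wt N a) = N.choose a := by
  rw [wt, finrank_supp]
  have hinj : ∀ i : Fin 2, Function.Injective (List.cons i) := fun i => List.cons_injective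
  induction N generalizing a with
  | zero =>
    cases a with
    | zero =>
      rw [Nat.choose_zero_right, Set.ncard_eq_one]
      refine ⟨[], Set.ext fun l => ⟨fun h => List.length_eq_zero_iff.1 h.1, ?_⟩⟩
      rintro rfl
      exact ⟨rfl, rfl⟩
    | succ a =>
      rw [Nat.choose_zero_succ, Set.ncard_eq_zero ((finite_words 0).subset fun _ h => h.1)]
      refine Set.eq_empty_of_forall_notMem fun l h => ?_
      have := List.length_eq_zero_iff.1 h.1
      subst this
      simpa using h.2
  | succ N ih =>
    cases a with
    | zero =>
      have e : {l : List (Fin 2) | l.length = N + 1 ∧ l.count 0 = 0} =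
          List.cons 1 '' {l | l.length = N ∧ l.count 0 = 0} := by
        ext l
        cases l with
        | nil => simp
        | cons i l => fin_cases i <;> simp
      rw [e, Set.ncard_image_of_injective _ (hinj 1), ih, Nat.choose_zero_right,
        Nat.choose_zero_right]
    | succ a =>
      have e : {l : List (Fin 2) | l.length = N + 1 ∧ l.count 0 = a + 1} =
          List.cons 0 '' {l | l.length = N ∧ l.count 0 = a} ∪
            List.cons 1 '' {l | l.length = N ∧ l.count 0 = a + 1} := by
        ext l
        cases l with
        | nil => simp
        | cons i l => fin_cases i <;> simp
      have hfin : ∀ a, {l : List (Fin 2) | l.length = N ∧ l.count 0 = a}.Finite := fun a =>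
        (finite_words N).subset fun _ h => h.1
      rw [e, Set.ncard_union_eq ?_ ((hfin _).image _) ((hfin _).image _),
        Set.ncard_image_of_injective _ (hinj 0), Set.ncard_image_of_injective _ (hinj 1), ih, ih,
        Nat.choose_succ_succ]
      rw [Set.disjoint_left]
      rintro _ ⟨l, -, rfl⟩ ⟨m, -, h⟩
      simp at h

theorem coeff_hilb_top (N : ℕ) :
    (hilb ⊤).coeff N = (1 + PowerSeries.X : PowerSeries ℚ) ^ N := by
  ext a
  have h : ((1 + Polynomial.X : Polynomial ℚ) ^ N : Polynomial ℚ) =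
      (1 + PowerSeries.X : PowerSeries ℚ) ^ N := by simp
  rw [← h, Polynomial.coeff_coe, Polynomial.coeff_one_add_X_pow, hilb, PowerSeries.coeff_mk,
    PowerSeries.coeff_mk, Algebra.top_toSubmodule, top_inf_eq, finrank_wt]

end NC

end

section

namespace NC

/-! ### Dimensions of the spaces of Lie elements -/

/-- The Euler derivation of the power series. -/
def euler (f : PowerSeries (PowerSeries ℚ)) : PowerSeries (PowerSeries ℚ) :=
  PowerSeries.mk fun n => n * f.coeff n

theorem coeff_euler (f : PowerSeries (PowerSeries ℚ)) (n : ℕ) :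
    (euler f).coeff n = n * f.coeff n :=
  PowerSeries.coeff_mk _ _

theorem euler_mul (f g : PowerSeries (PowerSeries ℚ)) :
    euler (f * g) = euler f * g + f * euler g := by
  ext1 n
  rw [coeff_euler, map_add, PowerSeries.coeff_mul, PowerSeries.coeff_mul, PowerSeries.coeff_mul,
    Finset.mul_sum, ← Finset.sum_add_distrib]
  refine Finset.sum_congr rfl fun p hp => ?_
  rw [coeff_euler, coeff_euler, ← Finset.HasAntidiagonal.mem_antidiagonal.1 hp]
  push_cast
  ring

theorem euler_sub (f g : PowerSeries (PowerSeries ℚ)) : euler (f - g) = euler f - euler g := by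
  ext1 n
  rw [coeff_euler, map_sub, map_sub, coeff_euler, coeff_euler, mul_sub]

theorem euler_one : euler 1 = 0 := by
  ext1 n
  rw [coeff_euler, PowerSeries.coeff_one]
  split_ifs with h <;> simp [h]

theorem coeff_monom (d m n : ℕ) :
    (monom d m).coeff n = if n = d then PowerSeries.X ^ m else 0 := by
  rw [monom, PowerSeries.coeff_mul_C, PowerSeries.coeff_X_pow, ite_mul, one_mul, zero_mul]

theorem euler_monom (d m : ℕ) : euler (monom d m) = d * monom d m := by
  ext1 n
  rw [coeff_euler, ← nsmul_eq_mul, ← nsmul_eq_mul, map_nsmul, coeff_monom]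
  split_ifs with h
  · rw [h]
  · simp

/-- The sum of the positive powers of a monomial. -/
def geo (d m : ℕ) : PowerSeries (PowerSeries ℚ) :=
  PowerSeries.mk fun n => if d ∣ n ∧ n ≠ 0 then PowerSeries.X ^ (m * (n / d)) else 0

theorem geo_mul {d : ℕ} (hd : 0 < d) (m : ℕ) : geo d m * (1 - monom d m) = monom d m := by
  rw [mul_sub, mul_one, sub_eq_iff_eq_add, mul_comm]
  ext1 n
  rw [map_add, coeff_monom, monom, mul_assoc, PowerSeries.coeff_X_pow_mul', geo,
    PowerSeries.coeff_mk]
  rcases lt_trichotomy n d with h | rfl | h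
  · rw [if_neg h.ne, if_neg (not_le.2 h), if_neg, add_zero]
    rintro ⟨h1, h2⟩
    exact absurd (Nat.le_of_dvd (Nat.pos_of_ne_zero h2) h1) (not_le.2 h)
  · rw [if_pos rfl, if_pos le_rfl, if_pos ⟨dvd_rfl, hd.ne'⟩, Nat.div_self hd, mul_one, Nat.sub_self,
      PowerSeries.coeff_C_mul, PowerSeries.coeff_mk, if_neg (by simp), mul_zero, add_zero]
  · rw [if_neg h.ne', if_pos h.le, PowerSeries.coeff_C_mul, PowerSeries.coeff_mk, zero_add]
    have e : d ∣ n ∧ n ≠ 0 ↔ d ∣ n - d ∧ n - d ≠ 0 := by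
      rw [Nat.dvd_sub_iff_left h.le dvd_rfl]
      omega
    simp only [e]
    split_ifs with h'
    · rw [← pow_add]
      congr 1
      obtain ⟨k, hk⟩ := h'.1
      obtain rfl : n = d * (k + 1) := by rw [mul_add, ← hk]; omega
      rw [hk, Nat.mul_div_cancel_left _ hd, Nat.mul_div_cancel_left _ hd]
      ring
    · rw [mul_zero]

/-- Here −g is the logarithmic derivative of f; this form of the equation avoids division. -/
theorem euler_pow {f g : PowerSeries (PowerSeries ℚ)} (h : euler f = -(g * f)) (l : ℕ) :
    euler (f ^ l) = -((l * g) * f ^ l) := by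
  induction l with
  | zero => simp [euler_one]
  | succ l ih =>
    rw [pow_succ, euler_mul, ih, h]
    push_cast
    ring

theorem euler_prod {ι : Type*} (s : Finset ι) {f g : ι → PowerSeries (PowerSeries ℚ)}
    (h : ∀ i ∈ s, euler (f i) = -(g i * f i)) :
    euler (∏ i ∈ s, f i) = -((∑ i ∈ s, g i) * ∏ i ∈ s, f i) := by
  classical
  induction s using Finset.induction_on with
  | empty => simp [euler_one]
  | insert i s hi ih =>
    rw [Finset.prod_insert hi, Finset.sum_insert hi, euler_mul, h i (Finset.mem_insert_self i s),
      ih fun j hj => h j (Finset.mem_insert_of_mem hj)]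
    ring

theorem coeff_mul_of_coeff {f T : PowerSeries (PowerSeries ℚ)} {N : ℕ}
    (hT : ∀ n ≤ N, T.coeff n = if n = 0 then 1 else 0) : (f * T).coeff N = f.coeff N := by
  rw [PowerSeries.coeff_mul, Finset.sum_eq_single (N, 0)]
  · rw [hT 0 (Nat.zero_le N), if_pos rfl, mul_one]
  · rintro ⟨i, j⟩ hij hne
    rw [Finset.HasAntidiagonal.mem_antidiagonal] at hij
    simp only at hij
    rw [hT j (by omega), if_neg, mul_zero]
    rintro rfl
    exact hne (by rw [← hij]; rfl)
  · intro h
    simp at h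

/-- Logarithmic derivative of the truncated product formula. With Y = (1 + s)t the Hilbert series of
A is 1/(1 − Y), contributing Y/(1 − Y), whose coefficient at t^N is (1 + s)^N. The other side is 1 +
O(t^{N+1}) and contributes nothing in degree N. -/
theorem sum_geo {N : ℕ} (hN : N ≠ 0) :
    (∑ n ∈ Finset.range N, ∑ a ∈ Finset.range (n + 2),
      (Module.finrank ℚ ↥(prim ⊓ wt (n + 1) a) : PowerSeries (PowerSeries ℚ)) *
        (((n + 1 : ℕ) : PowerSeries (PowerSeries ℚ)) * geo (n + 1) a)).coeff N = (1 + PowerSeries.X : PowerSeries ℚ) ^ N := by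
  set G := ∑ n ∈ Finset.range N, ∑ a ∈ Finset.range (n + 2),
      (Module.finrank ℚ ↥(prim ⊓ wt (n + 1) a) : PowerSeries (PowerSeries ℚ)) *
        (((n + 1 : ℕ) : PowerSeries (PowerSeries ℚ)) * geo (n + 1) a) with hG
  set P := ∏ n ∈ Finset.range N, ∏ a ∈ Finset.range (n + 2),
      (1 - monom (n + 1) a) ^ Module.finrank ℚ ↥(prim ⊓ wt (n + 1) a) with hP
  have hDP : euler P = -(G * P) := by
    refine euler_prod _ fun n _ => euler_prod _ fun a _ => euler_pow ?_ _
    rw [euler_sub, euler_one, euler_monom, zero_sub, mul_assoc, geo_mul n.succ_pos]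
  set T := hilb (Algebra.adjoin ℚ (gens N ⊥)) with hT
  have hHP : hilb ⊤ * P = T := hilb_top_mul_prod N
  have hTc : ∀ n ≤ N, T.coeff n = if n = 0 then 1 else 0 := fun n hn => coeff_hilb_gens hn
  let Y : PowerSeries (PowerSeries ℚ) := PowerSeries.C (1 + PowerSeries.X) * PowerSeries.X
  have hYc : ∀ n, (Y * hilb ⊤).coeff (n + 1) = (1 + PowerSeries.X : PowerSeries ℚ) ^ (n + 1) := by
    intro n
    rw [mul_assoc, PowerSeries.coeff_C_mul, PowerSeries.coeff_succ_X_mul, coeff_hilb_top, pow_succ']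
  have hY : (1 - Y) * hilb ⊤ = 1 := by
    rw [sub_mul, one_mul, sub_eq_iff_eq_add]
    ext1 n
    cases n with
    | zero => rw [coeff_hilb_top, map_add]; simp [Y]
    | succ n => rw [coeff_hilb_top, map_add, hYc, PowerSeries.coeff_one, if_neg n.succ_ne_zero, zero_add]
  have hDY : euler Y = Y := by
    ext1 n
    rw [coeff_euler, PowerSeries.coeff_C_mul, PowerSeries.coeff_X]
    split_ifs with h
    · rw [h, Nat.cast_one, one_mul]
    · simp
  have hDH : euler (hilb ⊤) = Y * hilb ⊤ * hilb ⊤ := by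
    have h1 := congrArg euler hY
    rw [euler_mul, euler_sub, euler_one, hDY] at h1
    linear_combination hilb ⊤ * h1 - euler (hilb ⊤) * hY
  have hDT : euler T = (Y * hilb ⊤ - G) * T := by
    rw [← hHP, euler_mul, hDP, hDH]
    ring
  have h1 := coeff_mul_of_coeff (f := Y * hilb ⊤ - G) hTc
  rw [← hDT, coeff_euler, hTc N le_rfl, if_neg hN, mul_zero, map_sub] at h1
  obtain ⟨n, rfl⟩ := Nat.exists_eq_succ_of_ne_zero hN
  rw [← hYc n]
  exact (sub_eq_zero.1 h1.symm).symm

/-- The series `geo n a` meets bidegree (N, b) exactly when (n, a) is (N, b) divided by a common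
divisor k = N/n. -/
theorem sum_divisors_finrank {N b : ℕ} (hN : N ≠ 0) (hb : b ≤ N) :
    ∑ k ∈ (N.gcd b).divisors,
      (Module.finrank ℚ ↥(prim ⊓ wt (N / k) (b / k)) : ℚ) * ((N / k : ℕ) : ℚ) = N.choose b := by
  have h := congrArg (PowerSeries.coeff b) (sum_geo hN)
  have hr : ((1 + PowerSeries.X : PowerSeries ℚ) ^ N).coeff b = N.choose b := by
    have := coeff_hilb_top N
    rw [← this, hilb, PowerSeries.coeff_mk, PowerSeries.coeff_mk, Algebra.top_toSubmodule,
      top_inf_eq, finrank_wt]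
  rw [hr] at h
  rw [← h, map_sum, map_sum]
  let G : ℕ → ℚ := fun m => ∑ a ∈ Finset.range (m + 1),
    if b = a * (N / m) then (Module.finrank ℚ ↥(prim ⊓ wt m a) : ℚ) * (m : ℚ) else 0
  let F : ℕ → ℚ := fun m => if m ∣ N then G m else 0
  have hterm : ∀ n ∈ Finset.range N, (PowerSeries.coeff b) ((PowerSeries.coeff N)
      (∑ a ∈ Finset.range (n + 2),
        (Module.finrank ℚ ↥(prim ⊓ wt (n + 1) a) : PowerSeries (PowerSeries ℚ)) *
        (((n + 1 : ℕ) : PowerSeries (PowerSeries ℚ)) * geo (n + 1) a))) =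
      F (n + 1) := by
    intro n hn
    rw [map_sum, map_sum]
    simp only [F, G]
    split_ifs with hd
    · refine Finset.sum_congr rfl fun a _ => ?_
      rw [← nsmul_eq_mul, ← nsmul_eq_mul, map_nsmul, map_nsmul, map_nsmul, map_nsmul, geo,
        PowerSeries.coeff_mk, if_pos ⟨hd, hN⟩, PowerSeries.coeff_X_pow]
      split_ifs
      · simp only [nsmul_eq_mul, mul_one]
      · simp
    · refine Finset.sum_eq_zero fun a _ => ?_
      rw [← nsmul_eq_mul, ← nsmul_eq_mul, map_nsmul, map_nsmul, map_nsmul, map_nsmul, geo,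
        PowerSeries.coeff_mk, if_neg fun h => hd h.1]
      simp
  rw [Finset.sum_congr rfl hterm, Finset.range_eq_Ico, Finset.sum_Ico_add' F 0 N 1, zero_add,
    ← Finset.sum_filter]
  change _ = ∑ m ∈ N.divisors, G m
  rw [← Nat.sum_div_divisors N G]
  have hfilter : (N.gcd b).divisors = N.divisors.filter (· ∣ b) := by
    ext k
    simp only [Nat.mem_divisors, Finset.mem_filter, Nat.dvd_gcd_iff, ne_eq, Nat.gcd_eq_zero_iff]
    tauto
  rw [hfilter, Finset.sum_filter]
  refine Finset.sum_congr rfl fun k hk => ?_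
  have hkN := Nat.dvd_of_mem_divisors hk
  simp only [G]
  rw [Nat.div_div_self hkN hN]
  have hk0 : 0 < k := Nat.pos_of_mem_divisors hk
  split_ifs with hkb
  · obtain ⟨c, rfl⟩ := hkb
    rw [Nat.mul_div_cancel_left _ hk0, Finset.sum_eq_single c]
    · rw [if_pos (mul_comm _ _)]
    · intro a _ hac
      rw [if_neg]
      intro h
      rw [mul_comm] at h
      exact hac (Nat.eq_of_mul_eq_mul_right hk0 h).symm
    · intro h
      exfalso
      refine h (Finset.mem_range.2 (Nat.lt_succ_of_le ?_))
      rwa [Nat.le_div_iff_mul_le hk0, mul_comm]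
  · refine (Finset.sum_eq_zero fun a _ => if_neg ?_).symm
    rintro rfl
    exact hkb (dvd_mul_left _ _)

/-- Möbius inversion of `sum_divisors_finrank` along the ray of multiples j·(N₀, a₀) of a primitive
vector, where the common divisors of the bidegree are the divisors of j. -/
theorem finrank_prim_wt {a b : ℕ} (h : a + b ≠ 0) :
    (Module.finrank ℚ ↥(prim ⊓ wt (a + b) a) : ℚ) = theta a b := by
  set g := (a + b).gcd a with hg
  have hg0 : 0 < g := Nat.gcd_pos_of_pos_left _ (Nat.pos_of_ne_zero h)
  obtain ⟨N₀, hN₀⟩ := Nat.gcd_dvd_left (a + b) a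
  obtain ⟨a₀, ha₀⟩ := Nat.gcd_dvd_right (a + b) a
  rw [← hg] at hN₀ ha₀
  have hN0 : N₀ ≠ 0 := by rintro rfl; exact h (hN₀.trans (mul_zero _))
  have hcop : N₀.gcd a₀ = 1 := by
    have h1 : g * N₀.gcd a₀ = g := by
      rw [← Nat.gcd_mul_left, ← hN₀, ← ha₀]
    exact Nat.eq_of_mul_eq_mul_left hg0 (h1.trans (mul_one g).symm)
  have ha0 : a₀ ≤ N₀ := by
    refine Nat.le_of_mul_le_mul_left ?_ hg0
    rw [← hN₀, ← ha₀]
    exact Nat.le_add_right a b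
  have key := (ArithmeticFunction.sum_eq_iff_sum_mul_moebius_eq (R := ℚ)
    (f := fun j => (Module.finrank ℚ ↥(prim ⊓ wt (j * N₀) (j * a₀)) : ℚ) * ((j * N₀ : ℕ) : ℚ))
    (g := fun j => ((j * N₀).choose (j * a₀) : ℚ))).1 (fun m hm => by
      rw [← sum_divisors_finrank (Nat.mul_ne_zero hm.ne' hN0) (Nat.mul_le_mul_left m ha0),
        Nat.gcd_mul_left, hcop, mul_one, ← Nat.sum_div_divisors]
      refine Finset.sum_congr rfl fun k hk => ?_
      obtain ⟨c, rfl⟩ := Nat.dvd_of_mem_divisors hk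
      have hk0 : 0 < k := Nat.pos_of_mem_divisors hk
      rw [mul_assoc, mul_assoc, Nat.mul_div_cancel_left _ hk0, Nat.mul_div_cancel_left _ hk0,
        Nat.mul_div_cancel_left _ hk0]) g hg0
  rw [← hN₀, ← ha₀] at key
  rw [Nat.sum_divisorsAntidiagonal
    (fun i j => (ArithmeticFunction.moebius i : ℚ) * ((j * N₀).choose (j * a₀) : ℚ))] at key
  have hne : ((a + b : ℕ) : ℚ) ≠ 0 := by exact_mod_cast h
  have hgi : Int.gcd (a : ℤ) (b : ℤ) = g := by
    rw [Int.gcd_natCast_natCast, hg, Nat.gcd_comm (a + b), Nat.gcd_self_add_right]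
  rw [theta, hgi, one_div, eq_inv_mul_iff_mul_eq₀ (by exact_mod_cast hne)]
  rw [mul_comm] at key
  have e : (((a : ℤ) + (b : ℤ) : ℤ) : ℚ) = ((a + b : ℕ) : ℚ) := by push_cast; rfl
  rw [e, ← key]
  refine Finset.sum_congr rfl fun d hd => ?_
  obtain ⟨c, hc⟩ := Nat.dvd_of_mem_divisors hd
  have hd0 : 0 < d := Nat.pos_of_mem_divisors hd
  have e1 : (a + b) / d = c * N₀ := by
    rw [hN₀, hc, mul_assoc, Nat.mul_div_cancel_left _ hd0]
  have e2 : a / d = c * a₀ := by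
    rw [ha₀, hc, mul_assoc, Nat.mul_div_cancel_left _ hd0]
  have e3 : g / d = c := by rw [hc, Nat.mul_div_cancel_left _ hd0]
  rw [e3, ← e1, ← e2, binom, if_pos]
  · norm_cast
  · constructor
    · positivity
    · exact_mod_cast Nat.div_le_div_right (Nat.le_add_right a b)

end NC

end

section

/-! ### The closed lower central series -/

/-! ### Commutators of lower central terms in an abstract group -/

section LowerCentralSeries

variable {G : Type*} [Group G]

/-- Three subgroups lemma. Numbering starts at 0, so the terms have weights a + 1 and b + 1, whence
the additional 1. -/
theorem commutator_lowerCentralSeries_le (a b : ℕ) :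
    ⁅(⊤ : Subgroup G).lowerCentralSeries a, (⊤ : Subgroup G).lowerCentralSeries b⁆ ≤
      (⊤ : Subgroup G).lowerCentralSeries (a + b + 1) := by
  induction b generalizing a with
  | zero => exact le_rfl
  | succ b ih =>
    let N := (⊤ : Subgroup G).lowerCentralSeries (a + (b + 1) + 1)
    have hq : ∀ H : Subgroup G, H ≤ N ↔ H.map (QuotientGroup.mk' N) = ⊥ := by
      intro H
      rw [Subgroup.map_eq_bot_iff, QuotientGroup.ker_mk']
    have h1 : ⁅⁅(⊤ : Subgroup G), (⊤ : Subgroup G).lowerCentralSeries a⁆,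
        (⊤ : Subgroup G).lowerCentralSeries b⁆ ≤ N := by
      rw [Subgroup.commutator_comm ⊤]
      have := ih (a + 1)
      rwa [show a + 1 + b + 1 = a + (b + 1) + 1 by omega] at this
    have h2 : ⁅⁅(⊤ : Subgroup G).lowerCentralSeries a, (⊤ : Subgroup G).lowerCentralSeries b⁆,
        (⊤ : Subgroup G)⁆ ≤ N :=
      Subgroup.commutator_mono (ih a) le_rfl
    rw [Subgroup.commutator_comm, Subgroup.lowerCentralSeries_succ]
    change _ ≤ N
    rw [hq, Subgroup.map_commutator, Subgroup.map_commutator] at h1 h2 ⊢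
    exact Subgroup.commutator_commutator_eq_bot_of_rotate h1 h2

end LowerCentralSeries

variable {r : ℕ}

theorem completion_ext {x y : Completion r} (h : ∀ n, component r n x = component r n y) : x = y :=
  Subtype.ext (funext h)

theorem component_eq_of_le {m n : ℕ} (h : m ≤ n) {x y : Completion r}
    (hxy : component r n x = component r n y) : component r m x = component r m y := by
  have hx : nilProj r h (component r n x) = component r m x := x.2 m n h
  have hy : nilProj r h (component r n y) = component r m y := y.2 m n h
  rw [← hx, ← hy, hxy]

theorem exists_toCompletion (n : ℕ) (x : Completion r) :
    ∃ w, component r n (toCompletion r w) = component r n x :=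
  QuotientGroup.mk_surjective (component r n x)

theorem isOpen_comap_component (n : ℕ) (H : Subgroup (NilQuot r n)) :
    IsOpen (H.comap (component r n) : Set (Completion r)) := by
  refine (iInf_le (fun n => TopologicalSpace.induced (component r n) ⊥) n) _ ?_
  exact ⟨H, trivial, rfl⟩

theorem isClosed_comap_component (n : ℕ) (H : Subgroup (NilQuot r n)) :
    IsClosed (H.comap (component r n) : Set (Completion r)) :=
  Subgroup.isClosed_of_isOpen _ (isOpen_comap_component n H)

theorem exists_of_mem_nhds {x : Completion r} {U : Set (Completion r)} (hU : U ∈ nhds x) :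
    ∃ n, ∀ y, component r n y = component r n x → y ∈ U := by
  have h : nhds x = ⨅ n, Filter.principal {y | component r n y = component r n x} := by
    refine (nhds_iInf (t := fun n => TopologicalSpace.induced (component r n) ⊥)).trans
      (iInf_congr fun n => ?_)
    let : TopologicalSpace (NilQuot r n) := ⊥
    have : DiscreteTopology (NilQuot r n) := ⟨rfl⟩
    rw [nhds_induced, nhds_discrete, Filter.comap_pure]
    rfl
  rw [h, Filter.mem_iInf_of_directed] at hU
  · obtain ⟨n, hn⟩ := hU
    exact ⟨n, fun y hy => hn hy⟩
  · intro m n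
    refine ⟨max m n, ?_, ?_⟩
    · exact Filter.principal_mono.2 fun y hy => component_eq_of_le (le_max_left m n) hy
    · exact Filter.principal_mono.2 fun y hy => component_eq_of_le (le_max_right m n) hy

theorem mem_of_isClosed {S : Set (Completion r)} (hS : IsClosed S) {x : Completion r}
    (h : ∀ n, ∃ c ∈ S, component r n c = component r n x) : x ∈ S := by
  rw [← hS.closure_eq, mem_closure_iff_nhds]
  intro U hU
  obtain ⟨n, hn⟩ := exists_of_mem_nhds hU
  obtain ⟨c, hc, hcx⟩ := h n
  exact ⟨c, hn c hcx, hc⟩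

theorem component_mem_map {a : ℕ} {x : Completion r} (hx : x ∈ series r (a + 1)) (n : ℕ) :
    component r n x ∈ ((⊤ : Subgroup (FreeGroup (Fin r))).lowerCentralSeries a).map
      (QuotientGroup.mk' _) := by
  induction a generalizing x with
  | zero =>
    obtain ⟨w, hw⟩ := exists_toCompletion n x
    exact ⟨w, trivial, hw⟩
  | succ a ih =>
    have hle : ⁅series r (a + 1), (⊤ : Subgroup (Completion r))⁆ ≤
        (((⊤ : Subgroup (FreeGroup (Fin r))).lowerCentralSeries (a + 1)).map
          (QuotientGroup.mk' ((⊤ : Subgroup (FreeGroup (Fin r))).lowerCentralSeries n))).comap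
            (component r n) := by
      rw [Subgroup.commutator_le]
      intro u hu g _
      rw [Subgroup.mem_comap, map_commutatorElement, Subgroup.lowerCentralSeries_succ,
        Subgroup.map_commutator]
      refine Subgroup.commutator_mem_commutator (ih hu) ?_
      obtain ⟨w, hw⟩ := exists_toCompletion n g
      exact ⟨w, trivial, hw⟩
    exact Subgroup.topologicalClosure_minimal _ hle (isClosed_comap_component n _) hx

theorem toCompletion_mem_series {a : ℕ} {w : FreeGroup (Fin r)}
    (hw : w ∈ (⊤ : Subgroup (FreeGroup (Fin r))).lowerCentralSeries a) :
    toCompletion r w ∈ series r (a + 1) := by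
  induction a generalizing w with
  | zero => trivial
  | succ a ih =>
    have hle : (⊤ : Subgroup (FreeGroup (Fin r))).lowerCentralSeries (a + 1) ≤
        (series r (a + 2)).comap (toCompletion r) := by
      rw [Subgroup.lowerCentralSeries_succ, Subgroup.commutator_le]
      intro u hu g _
      rw [Subgroup.mem_comap, map_commutatorElement]
      exact commutator_series_le r (a + 1)
        (Subgroup.commutator_mem_commutator (ih hu) (Subgroup.mem_top _))
    exact hle hw

/-- The closed series is the filtration that defines the topology. An element of the kernel is a
limit of words; from level n on these words lie in the n-th lower central term, and closedness
passes to the limit. -/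
theorem series_eq_ker (n : ℕ) : series r (n + 1) = (component r n).ker := by
  ext x
  rw [MonoidHom.mem_ker]
  constructor
  · intro hx
    obtain ⟨w, hw, h⟩ := component_mem_map hx n
    rw [← h]
    exact (QuotientGroup.eq_one_iff w).2 hw
  · intro hx
    refine mem_of_isClosed (isClosed_series r (n + 1)) fun m => ?_
    obtain ⟨w, hw⟩ := exists_toCompletion (max m n) x
    refine ⟨toCompletion r w, toCompletion_mem_series ?_, component_eq_of_le (le_max_left m n) hw⟩
    have := (component_eq_of_le (le_max_right m n) hw).trans hx
    exact (QuotientGroup.eq_one_iff w).1 this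

theorem mem_series_succ {n : ℕ} {x : Completion r} :
    x ∈ series r (n + 1) ↔ component r n x = 1 := by
  rw [series_eq_ker, MonoidHom.mem_ker]

theorem exists_toCompletion_mul (n : ℕ) (x : Completion r) :
    ∃ w, ∃ k ∈ series r n, x = toCompletion r w * k := by
  obtain ⟨w, hw⟩ := exists_toCompletion n x
  refine ⟨w, (toCompletion r w)⁻¹ * x, series_succ_le r n ?_, (mul_inv_cancel_left _ _).symm⟩
  rw [mem_series_succ, map_mul, map_inv, hw, inv_mul_cancel]

theorem exists_toCompletion_mul' {a : ℕ} {x : Completion r} (hx : x ∈ series r (a + 1)) (n : ℕ) :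
    ∃ w ∈ (⊤ : Subgroup (FreeGroup (Fin r))).lowerCentralSeries a,
      component r n x = component r n (toCompletion r w) := by
  obtain ⟨w, hw, h⟩ := component_mem_map hx n
  exact ⟨w, hw, h.symm⟩

theorem commutator_series_series_le : ∀ n m : ℕ,
    ⁅series r n, series r m⁆ ≤ series r (n + m)
  | 0, m => by rw [zero_add]; exact Subgroup.commutator_le_right _ _
  | n + 1, 0 => Subgroup.commutator_le_left _ _
  | n + 1, m + 1 => by
    rw [Subgroup.commutator_le]
    intro x hx y hy
    rw [show n + 1 + (m + 1) = n + m + 1 + 1 by omega, mem_series_succ, map_commutatorElement]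
    have h := Subgroup.commutator_mem_commutator (component_mem_map hx (n + m + 1))
      (component_mem_map hy (n + m + 1))
    rw [← Subgroup.map_commutator] at h
    obtain ⟨w, hw, h⟩ := h
    rw [← h]
    exact (QuotientGroup.eq_one_iff w).2 (commutator_lowerCentralSeries_le n m hw)

theorem commutator_mem_series {n m : ℕ} {x y : Completion r} (hx : x ∈ series r n)
    (hy : y ∈ series r m) : ⁅x, y⁆ ∈ series r (n + m) :=
  commutator_series_series_le n m (Subgroup.commutator_mem_commutator hx hy)

/-! ### Generation -/

theorem eq_top_of_gen_mem {H : Subgroup (Completion r)} (h2 : series r 2 ≤ H)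
    (hg : ∀ i, gen r i ∈ H) : H = ⊤ := by
  rw [eq_top_iff]
  intro x _
  obtain ⟨w, k, hk, rfl⟩ := exists_toCompletion_mul 2 x
  clear * - hg h2 hk
  refine H.mul_mem ?_ (h2 hk)
  induction w using FreeGroup.induction_on with
  | C1 => rw [map_one]; exact H.one_mem
  | of i => exact hg i
  | inv_of i hi => rw [map_inv]; exact H.inv_mem hi
  | mul u v hu hv => rw [map_mul]; exact H.mul_mem hu hv

theorem mem_series_one (x : Completion r) : x ∈ series r 1 := trivial

/-- Modulo the next term the commutator is additive in g and depends only on the class of g in the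
abelianization, so commutators with generators suffice. -/
theorem series_le_of_commutator_mem {n : ℕ} {H : Subgroup (Completion r)}
    (h2 : series r (n + 3) ≤ H) (hg : ∀ i, ∀ v ∈ series r (n + 1), ⁅gen r i, v⁆ ∈ H) :
    series r (n + 2) ≤ H := by
  -- A subgroup containing the kernel of a projection is a preimage from a discrete quotient, hence
  -- closed; so it suffices to treat actual commutators.
  have hH : H = (H.map (component r (n + 2))).comap (component r (n + 2)) := by
    rw [Subgroup.comap_map_eq, ← series_eq_ker, sup_eq_left.2 h2]
  have hcl : IsClosed (H : Set (Completion r)) := by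
    rw [hH]
    exact isClosed_comap_component _ _
  refine Subgroup.topologicalClosure_minimal _ ?_ hcl
  rw [Subgroup.commutator_comm, Subgroup.commutator_le]
  intro g hgt v hv
  have hv' : ∀ g, ⁅g, v⁆ ∈ series r (n + 2) := fun g => by
    have := commutator_mem_series (mem_series_one g) hv
    rwa [show 1 + (n + 1) = n + 2 by omega] at this
  have h3 : ∀ g, ∀ w ∈ series r (n + 2), ⁅g, w⁆ ∈ series r (n + 3) := fun g w hw => by
    have := commutator_mem_series (mem_series_one g) hw
    rwa [show 1 + (n + 2) = n + 3 by omega] at this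
  let K : Subgroup (Completion r) :=
    { carrier := {g | ⁅g, v⁆ ∈ H}
      mul_mem' := fun {a b} ha hb => by
        have e : ⁅a * b, v⁆ = ⁅a, ⁅b, v⁆⁆ * ⁅b, v⁆ * ⁅a, v⁆ := by
          simp only [commutatorElement_def]; group
        change ⁅a * b, v⁆ ∈ H
        rw [e]
        exact H.mul_mem (H.mul_mem (h2 (h3 _ _ (hv' b))) hb) ha
      one_mem' := by
        change ⁅(1 : Completion r), v⁆ ∈ H
        rw [commutatorElement_one_left]
        exact H.one_mem
      inv_mem' := fun {a} ha => by
        have e : ⁅a⁻¹, v⁆ = ⁅a⁻¹, ⁅a, v⁆⁻¹⁆ * ⁅a, v⁆⁻¹ := by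
          simp only [commutatorElement_def]; group
        change ⁅a⁻¹, v⁆ ∈ H
        rw [e]
        exact H.mul_mem (h2 (h3 _ _ ((series r (n + 2)).inv_mem (hv' a)))) (H.inv_mem ha) }
  have hK : K = ⊤ := by
    refine eq_top_of_gen_mem (fun g hg => ?_) fun i => hg i v hv
    have := commutator_mem_series hg hv
    rw [show 2 + (n + 1) = n + 3 by omega] at this
    exact h2 this
  exact (hK ▸ Subgroup.mem_top g : g ∈ K)

/-! ### Filtered endomorphisms -/

/-- An endomorphism that preserves the closed lower central series. -/
def Filtered (f : Completion r →* Completion r) : Prop := ∀ n, ∀ x ∈ series r n, f x ∈ series r n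

theorem Filtered.comp {f g : Completion r →* Completion r} (hf : Filtered f) (hg : Filtered g) :
    Filtered (f.comp g) := fun n x hx => hf n _ (hg n x hx)

theorem Filtered.id : Filtered (MonoidHom.id (Completion r)) := fun _ _ hx => hx

theorem Filtered.continuous {f : Completion r →* Completion r} (hf : Filtered f) :
    Continuous f := by
  refine continuous_of_continuousAt_one f ?_
  intro U hU
  rw [map_one] at hU
  obtain ⟨n, hn⟩ := exists_of_mem_nhds hU
  rw [Filter.mem_map]
  refine Filter.mem_of_superset ((isOpen_comap_component n ⊥).mem_nhds (Subgroup.one_mem _)) ?_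
  intro x hx
  refine hn _ ?_
  rw [map_one]
  exact mem_series_succ.1 (hf _ x (mem_series_succ.2 hx))

theorem Filtered.ext {f g : Completion r →* Completion r} (hf : Filtered f) (hg : Filtered g)
    (h : ∀ i, f (gen r i) = g (gen r i)) : f = g := by
  refine MonoidHom.ext fun x => completion_ext fun n => ?_
  obtain ⟨w, k, hk, rfl⟩ := exists_toCompletion_mul (n + 1) x
  have e : f.comp (toCompletion r) = g.comp (toCompletion r) := FreeGroup.ext_hom _ _ h
  have e' : f (toCompletion r w) = g (toCompletion r w) := DFunLike.congr_fun e w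
  rw [map_mul, map_mul, map_mul, map_mul, e', mem_series_succ.1 (hf _ k hk),
    mem_series_succ.1 (hg _ k hk)]

/-- Universal property of F̂: F / F_{n+1} is nilpotent of class at most n, so a map from F into it
factors through F / F_{n+1}, compatibly in n. -/
theorem exists_filtered (f : Fin r → Completion r) :
    ∃ φ : Completion r →* Completion r, Filtered φ ∧ ∀ i, φ (gen r i) = f i := by
  let lift₀ : ∀ n, FreeGroup (Fin r) →* NilQuot r n := fun n =>
    FreeGroup.lift fun i => component r n (f i)
  have hker : ∀ n, ∀ w ∈ (⊤ : Subgroup (FreeGroup (Fin r))).lowerCentralSeries n,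
      lift₀ n w = 1 := by
    intro n w hw
    have h1 := Subgroup.mem_map_of_mem (lift₀ n) hw
    rw [Subgroup.map_lowerCentralSeries] at h1
    have h2 := Subgroup.lowerCentralSeries_mono n (le_top (a := Subgroup.map (lift₀ n) ⊤)) h1
    have h3 : (⊤ : Subgroup (NilQuot r n)) = Subgroup.map (QuotientGroup.mk' _) ⊤ :=
      (Subgroup.map_top_of_surjective _ (QuotientGroup.mk'_surjective _)).symm
    change _ ∈ (⊤ : Subgroup (NilQuot r n)).lowerCentralSeries n at h2
    rw [h3, ← Subgroup.map_lowerCentralSeries] at h2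
    obtain ⟨v, hv, hvw⟩ := h2
    rw [← hvw]
    exact (QuotientGroup.eq_one_iff v).2 hv
  let lift₁ : ∀ n, NilQuot r n →* NilQuot r n := fun n => QuotientGroup.lift _ (lift₀ n) (hker n)
  have hcompat : ∀ (m n : ℕ) (h : m ≤ n) (z : NilQuot r n),
      nilProj r h (lift₁ n z) = lift₁ m (nilProj r h z) := by
    intro m n h z
    obtain ⟨w, rfl⟩ := QuotientGroup.mk_surjective z
    change ((nilProj r h).comp (lift₀ n)) w = lift₀ m w
    refine DFunLike.congr_fun (FreeGroup.ext_hom _ _ fun i => ?_) w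
    simp only [lift₀, MonoidHom.comp_apply, FreeGroup.lift_apply_of]
    exact (f i).2 m n h
  let φ : Completion r →* Completion r :=
    { toFun := fun x => ⟨fun n => lift₁ n (component r n x), fun m n h => by
        rw [hcompat]; exact congrArg _ (x.2 m n h)⟩
      map_one' := completion_ext fun n => by
        change lift₁ n (component r n 1) = component r n 1
        rw [map_one, map_one]
      map_mul' := fun x y => completion_ext fun n => by
        change lift₁ n (component r n (x * y)) = lift₁ n (component r n x) * lift₁ n (component r n y)
        rw [map_mul, map_mul] }
  refine ⟨φ, ?_, fun i => completion_ext fun n => ?_⟩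
  · rintro (_ | n) x hx
    · trivial
    · rw [mem_series_succ] at hx ⊢
      change lift₁ n (component r n x) = 1
      rw [hx, map_one]
  · change lift₀ n (FreeGroup.of i) = _
    simp only [lift₀, FreeGroup.lift_apply_of]

theorem filtered_of_mem (φ : B r) : Filtered φ.1.toMonoidHom := fun n _ hx => apply_mem_series φ n hx

end

section

open NC

/-! ### The Magnus expansion -/

/-! ### Orders of vanishing of noncommutative power series -/

section Order

/-- Vanishing of the coefficients of degree less than `n`. -/
def Vanishes (n : ℕ) (f : PowerSeries NC) : Prop := ∀ k < n, f.coeff k = 0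

theorem Vanishes.add {n : ℕ} {f g : PowerSeries NC} (hf : Vanishes n f) (hg : Vanishes n g) :
    Vanishes n (f + g) := fun k hk => by rw [map_add, hf k hk, hg k hk, add_zero]

theorem Vanishes.neg {n : ℕ} {f : PowerSeries NC} (hf : Vanishes n f) : Vanishes n (-f) :=
  fun k hk => by rw [map_neg, hf k hk, neg_zero]

theorem Vanishes.sub {n : ℕ} {f g : PowerSeries NC} (hf : Vanishes n f) (hg : Vanishes n g) :
    Vanishes n (f - g) := fun k hk => by rw [map_sub, hf k hk, hg k hk, sub_zero]

theorem Vanishes.mul {m n : ℕ} {f g : PowerSeries NC} (hf : Vanishes m f) (hg : Vanishes n g) :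
    Vanishes (m + n) (f * g) := by
  intro k hk
  rw [PowerSeries.coeff_mul]
  refine Finset.sum_eq_zero fun p hp => ?_
  have := Finset.HasAntidiagonal.mem_antidiagonal.1 hp
  rcases Nat.lt_or_ge p.1 m with h | h
  · rw [hf _ h, zero_mul]
  · rw [hg p.2 (by omega), mul_zero]

theorem Vanishes.coeff_mul {m n : ℕ} {f g : PowerSeries NC} (hf : Vanishes m f)
    (hg : Vanishes n g) : (f * g).coeff (m + n) = f.coeff m * g.coeff n := by
  rw [PowerSeries.coeff_mul, Finset.sum_eq_single (m, n)]
  · intro p hp hne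
    have := Finset.HasAntidiagonal.mem_antidiagonal.1 hp
    rcases Nat.lt_or_ge p.1 m with h | h
    · rw [hf _ h, zero_mul]
    · rcases Nat.lt_or_ge p.2 n with h' | h'
      · rw [hg _ h', mul_zero]
      · exact absurd (Prod.ext (by simp; omega) (by simp; omega)) hne
  · intro h
    simp at h

theorem vanishes_zero (f : PowerSeries NC) : Vanishes 0 f := fun _ hk => absurd hk (Nat.not_lt_zero _)

theorem Vanishes.mul_right {n : ℕ} {f : PowerSeries NC} (hf : Vanishes n f) (g : PowerSeries NC) :
    Vanishes n (f * g) := hf.mul (vanishes_zero g)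

end Order

/-- The unit `1 + x_i t`. -/
def magnusUnit (i : Fin 2) : (PowerSeries NC)ˣ where
  val := 1 + PowerSeries.X * PowerSeries.C (x i)
  inv := PowerSeries.mk fun k => (-x i) ^ k
  val_inv := by
    ext1 n
    rw [add_mul, one_mul, map_add, mul_assoc, PowerSeries.coeff_mk]
    cases n with
    | zero => simp
    | succ n =>
      rw [PowerSeries.coeff_succ_X_mul, PowerSeries.coeff_C_mul, PowerSeries.coeff_mk, pow_succ',
        PowerSeries.coeff_one, if_neg n.succ_ne_zero, neg_mul, neg_add_cancel]
  inv_val := by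
    ext1 n
    rw [mul_add, mul_one, map_add, ← mul_assoc, PowerSeries.coeff_mk, PowerSeries.coeff_mul_C]
    cases n with
    | zero => simp
    | succ n =>
      rw [PowerSeries.coeff_succ_mul_X, PowerSeries.coeff_mk, pow_succ,
        PowerSeries.coeff_one, if_neg n.succ_ne_zero, mul_neg, neg_add_cancel]

/-- The Magnus expansion `x_i ↦ 1 + x_i t`. -/
def magnus : FreeGroup (Fin 2) →* (PowerSeries NC)ˣ := FreeGroup.lift magnusUnit

theorem vanishes_magnus (w : FreeGroup (Fin 2)) : Vanishes 1 ((magnus w).1 - 1) := by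
  have h : ∀ w, PowerSeries.constantCoeff (magnus w).1 = 1 := by
    intro w
    have e : (Units.map (PowerSeries.constantCoeff (R := NC)).toMonoidHom).comp magnus = 1 := by
      refine FreeGroup.ext_hom _ _ fun i => Units.ext ?_
      change PowerSeries.constantCoeff (magnus (FreeGroup.of i)).1 = 1
      rw [magnus, FreeGroup.lift_apply_of]
      simp [magnusUnit]
    exact congrArg Units.val (DFunLike.congr_fun e w)
  intro k hk
  obtain rfl : k = 0 := by omega
  rw [map_sub, PowerSeries.coeff_zero_eq_constantCoeff_apply, h]
  simp

/-- With U and G the two expansions, UGU⁻¹G⁻¹ − 1 = ((U − 1)(G − 1) − (G − 1)(U − 1))(GU)⁻¹, and the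
last factor has constant term 1. -/
theorem magnus_commutator {n : ℕ} {u g : FreeGroup (Fin 2)} (hu : Vanishes n ((magnus u).1 - 1)) :
    Vanishes (n + 1) ((magnus ⁅u, g⁆).1 - 1) ∧
      ((magnus ⁅u, g⁆).1 - 1).coeff (n + 1) =
        ((magnus u).1 - 1).coeff n * ((magnus g).1 - 1).coeff 1 -
          ((magnus g).1 - 1).coeff 1 * ((magnus u).1 - 1).coeff n := by
  have hg := vanishes_magnus g
  set V := (magnus (u⁻¹ * g⁻¹)).1 with hV
  have e : (magnus ⁅u, g⁆).1 - 1 = (((magnus u).1 - 1) * ((magnus g).1 - 1) -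
      ((magnus g).1 - 1) * ((magnus u).1 - 1)) * V := by
    have h1 : (magnus ⁅u, g⁆).1 = (magnus u).1 * (magnus g).1 * V := by
      rw [hV, ← Units.val_mul, ← Units.val_mul, ← map_mul, ← map_mul, commutatorElement_def]
      simp only [mul_assoc]
    have h2 : (magnus g).1 * (magnus u).1 * V = 1 := by
      rw [hV, ← Units.val_mul, ← Units.val_mul, ← map_mul, ← map_mul]
      simp
    calc (magnus ⁅u, g⁆).1 - 1 = (magnus u).1 * (magnus g).1 * V -
          (magnus g).1 * (magnus u).1 * V := by rw [h1, h2]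
      _ = _ := by noncomm_ring
  have h1 := hu.mul hg
  have h2 : Vanishes (n + 1) (((magnus g).1 - 1) * ((magnus u).1 - 1)) := by
    rw [add_comm]; exact hg.mul hu
  refine ⟨?_, ?_⟩
  · rw [e]
    exact (h1.sub h2).mul_right V
  · have h3 := (h1.sub h2).coeff_mul (vanishes_zero V)
    rw [add_zero] at h3
    have hV0 : V.coeff 0 = 1 := by
      have := vanishes_magnus (u⁻¹ * g⁻¹) 0 Nat.one_pos
      rw [map_sub, sub_eq_zero] at this
      rw [hV, this, PowerSeries.coeff_one, if_pos rfl]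
    rw [e, h3, hV0, mul_one, map_sub, hu.coeff_mul hg, add_comm n, hg.coeff_mul hu]

theorem magnus_lowerCentralSeries {a : ℕ} {w : FreeGroup (Fin 2)}
    (hw : w ∈ (⊤ : Subgroup (FreeGroup (Fin 2))).lowerCentralSeries a) :
    Vanishes (a + 1) ((magnus w).1 - 1) := by
  induction a generalizing w with
  | zero => exact vanishes_magnus w
  | succ a ih =>
    let K : Subgroup (FreeGroup (Fin 2)) :=
      { carrier := {w | Vanishes (a + 1 + 1) ((magnus w).1 - 1)}
        mul_mem' := fun {v w} hv hw => by
          have e : (magnus (v * w)).1 - 1 =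
              ((magnus v).1 - 1) * (magnus w).1 + ((magnus w).1 - 1) := by
            rw [map_mul, Units.val_mul]; noncomm_ring
          change Vanishes _ _
          rw [e]
          exact (hv.mul_right _).add hw
        one_mem' := by
          change Vanishes _ _
          rw [map_one, Units.val_one, sub_self]
          exact fun k _ => map_zero _
        inv_mem' := fun {v} hv => by
          have e : (magnus v⁻¹).1 - 1 = -(((magnus v).1 - 1) * (magnus v⁻¹).1) := by
            rw [sub_mul, ← Units.val_mul, ← map_mul, mul_inv_cancel, map_one, Units.val_one]
            noncomm_ring
          change Vanishes _ _
          rw [e]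
          exact (hv.mul_right _).neg }
    have hle : (⊤ : Subgroup (FreeGroup (Fin 2))).lowerCentralSeries (a + 1) ≤ K := by
      rw [Subgroup.lowerCentralSeries_succ, Subgroup.commutator_le]
      intro u hu g _
      exact (magnus_commutator (ih hu)).1
    exact hle hw

/-- The coefficient of degree `n` of the Magnus expansion. -/
def iota (n : ℕ) (y : Completion 2) : NC :=
  ((magnus (Quotient.out (component 2 n y))).1 - 1).coeff n

/-- Two representatives differ by an element of the n-th lower central term, whose expansion is 1 +
O(t^{n+1}). -/
theorem iota_eq {n : ℕ} {y : Completion 2} {w : FreeGroup (Fin 2)}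
    (h : component 2 n y = component 2 n (toCompletion 2 w)) :
    iota n y = ((magnus w).1 - 1).coeff n := by
  set v := Quotient.out (component 2 n y) with hv
  have hvw : (QuotientGroup.mk v : NilQuot 2 n) = QuotientGroup.mk w := by
    rw [hv]
    exact (Quotient.out_eq _).trans h
  have hmem := magnus_lowerCentralSeries (QuotientGroup.eq.1 hvw)
  have e : (magnus w).1 - 1 = (magnus v).1 * ((magnus (v⁻¹ * w)).1 - 1) + ((magnus v).1 - 1) := by
    rw [mul_sub, ← Units.val_mul, ← map_mul, mul_inv_cancel_left, mul_one]
    abel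
  have h0 := ((vanishes_zero (magnus v).1).mul hmem) n (by omega)
  rw [e, map_add, h0, zero_add, iota]

theorem iota_mul {n : ℕ} {y z : Completion 2} (hy : y ∈ series 2 (n + 1))
    (hz : z ∈ series 2 (n + 1)) : iota (n + 1) (y * z) = iota (n + 1) y + iota (n + 1) z := by
  obtain ⟨u, hu, hu'⟩ := exists_toCompletion_mul' hy (n + 1)
  obtain ⟨v, hv, hv'⟩ := exists_toCompletion_mul' hz (n + 1)
  have huv : component 2 (n + 1) (y * z) = component 2 (n + 1) (toCompletion 2 (u * v)) := by
    rw [map_mul, map_mul, map_mul, hu', hv']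
  rw [iota_eq hu', iota_eq hv', iota_eq huv]
  have e : (magnus (u * v)).1 - 1 = ((magnus u).1 - 1) * ((magnus v).1 - 1) +
      ((magnus u).1 - 1) + ((magnus v).1 - 1) := by
    rw [map_mul, Units.val_mul]; noncomm_ring
  have h0 := ((magnus_lowerCentralSeries hu).mul (magnus_lowerCentralSeries hv)) (n + 1) (by omega)
  rw [e, map_add, map_add, h0, zero_add]

theorem iota_one (n : ℕ) : iota n 1 = 0 := by
  rw [iota_eq (w := 1) (by rw [map_one (toCompletion 2)]), map_one, Units.val_one, sub_self, map_zero]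

theorem iota_of_mem {n : ℕ} {y : Completion 2} (hy : y ∈ series 2 (n + 1)) : iota n y = 0 := by
  rw [iota_eq (w := 1) (by
    rw [map_one (toCompletion 2), map_one]; exact mem_series_succ.1 hy), map_one,
    Units.val_one, sub_self, map_zero]

theorem iota_inv {n : ℕ} {y : Completion 2} (hy : y ∈ series 2 (n + 1)) :
    iota (n + 1) y⁻¹ = -iota (n + 1) y := by
  have h := iota_mul hy ((series 2 (n + 1)).inv_mem hy)
  rw [mul_inv_cancel, iota_one] at h
  exact (neg_eq_of_add_eq_zero_right h.symm).symm

theorem iota_gen (i : Fin 2) : iota 1 (gen 2 i) = x i := by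
  rw [iota_eq (y := gen 2 i) (w := FreeGroup.of i) rfl, magnus, FreeGroup.lift_apply_of, magnusUnit,
    add_sub_cancel_left, show (1 : ℕ) = 0 + 1 from rfl, PowerSeries.coeff_succ_X_mul,
    PowerSeries.coeff_zero_C]

theorem iota_commutator {n : ℕ} {y g : Completion 2} (hy : y ∈ series 2 (n + 1)) :
    iota (n + 2) ⁅y, g⁆ = iota (n + 1) y * iota 1 g - iota 1 g * iota (n + 1) y := by
  obtain ⟨u, hu, hu'⟩ := exists_toCompletion_mul' hy (n + 2)
  obtain ⟨v, hv'⟩ := exists_toCompletion (n + 2) g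
  have huv : component 2 (n + 2) ⁅y, g⁆ = component 2 (n + 2) (toCompletion 2 ⁅u, v⁆) := by
    rw [map_commutatorElement, map_commutatorElement, map_commutatorElement, hu', hv']
  rw [iota_eq huv, iota_eq (component_eq_of_le (by omega) hu'),
    iota_eq (component_eq_of_le (by omega) hv'.symm)]
  exact (magnus_commutator (magnus_lowerCentralSeries hu)).2

theorem iota_gen_commutator {n : ℕ} {y : Completion 2} (hy : y ∈ series 2 (n + 1)) (i : Fin 2) :
    iota (n + 2) ⁅gen 2 i, y⁆ = x i * iota (n + 1) y - iota (n + 1) y * x i := by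
  have hmem : ⁅y, gen 2 i⁆ ∈ series 2 (n + 2) :=
    commutator_mem_series (n := n + 1) (m := 1) hy (mem_series_one _)
  rw [← commutatorElement_inv, iota_inv hmem, iota_commutator hy, iota_gen, neg_sub]

/-- Induction along the lower central series by means of commutators with the generators. -/
theorem series_induction {r : ℕ} {P : ℕ → Completion r → Prop}
    (mul : ∀ n, ∀ y ∈ series r (n + 1), ∀ z ∈ series r (n + 1), P n y → P n z → P n (y * z))
    (inv : ∀ n, ∀ y ∈ series r (n + 1), P n y → P n y⁻¹)
    (succ : ∀ n, ∀ y ∈ series r (n + 2), P n y)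
    (hgen : ∀ i, P 0 (gen r i))
    (step : ∀ n, ∀ y ∈ series r (n + 1), P n y → ∀ i, P (n + 1) ⁅gen r i, y⁆) :
    ∀ n, ∀ y ∈ series r (n + 1), P n y := by
  let K : ℕ → Subgroup (Completion r) := fun n =>
    { carrier := {y | y ∈ series r (n + 1) ∧ P n y}
      mul_mem' := fun {y z} hy hz => ⟨mul_mem hy.1 hz.1, mul n y hy.1 z hz.1 hy.2 hz.2⟩
      one_mem' := ⟨one_mem _, succ n 1 (one_mem _)⟩
      inv_mem' := fun {y} hy => ⟨inv_mem hy.1, inv n y hy.1 hy.2⟩ }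
  have hK : ∀ n, series r (n + 1) ≤ K n := by
    intro n
    induction n with
    | zero =>
      have : K 0 = ⊤ := eq_top_of_gen_mem (fun y hy => ⟨mem_series_one y, succ 0 y hy⟩)
        fun i => ⟨mem_series_one _, hgen i⟩
      rw [this]
      exact le_top
    | succ n ih =>
      refine series_le_of_commutator_mem (fun y hy => ⟨series_succ_le r _ hy, succ _ y hy⟩)
        fun i v hv => ⟨?_, step n v hv (ih hv).2 i⟩
      have := commutator_mem_series (mem_series_one (gen r i)) hv
      rwa [show 1 + (n + 1) = n + 1 + 1 by omega] at this
  exact fun n y hy => (hK n hy).2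

theorem iota_mem_lie : ∀ n, ∀ y ∈ series 2 (n + 1), iota (n + 1) y ∈ lie (n + 1) := by
  refine series_induction (fun n y hy z hz h1 h2 => ?_) (fun n y hy h => ?_) (fun n y hy => ?_)
    (fun i => ?_) (fun n y hy h i => ?_)
  · rw [iota_mul hy hz]; exact add_mem h1 h2
  · rw [iota_inv hy]; exact neg_mem h
  · rw [iota_of_mem hy]; exact zero_mem _
  · rw [iota_gen]; exact ⟨x_mem_prim i, x_mem_deg i⟩
  · rw [iota_gen_commutator hy]
    refine ⟨bracket_mem_prim (x_mem_prim i) h.1, sub_mem ?_ (mul_mem_deg h.2 (x_mem_deg i))⟩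
    rw [add_comm (n + 1)]
    exact mul_mem_deg (x_mem_deg i) h.2

/-- Right-normed commutators of the generators have as leading coefficients the values of `dyn` on
words, which span the Lie elements. -/
theorem exists_iota_eq_dyn (l : List (Fin 2)) (hl : l ≠ []) :
    ∃ y ∈ series 2 l.length, iota l.length y = dyn (word l) := by
  induction l with
  | nil => exact absurd rfl hl
  | cons i l ih =>
    rw [word_cons, dyn_x_mul, cf_word]
    rcases eq_or_ne l [] with rfl | h
    · refine ⟨gen 2 i, mem_series_one _, ?_⟩
      rw [List.length_singleton, iota_gen, word_nil, dyn_one, if_pos rfl]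
      simp
    · obtain ⟨y, hy, hyl⟩ := ih h
      obtain ⟨n, hn⟩ : ∃ n, l.length = n + 1 :=
        Nat.exists_eq_succ_of_ne_zero (by simpa using h)
      rw [hn] at hy hyl
      refine ⟨⁅gen 2 i, y⁆, ?_, ?_⟩
      · have := commutator_mem_series (mem_series_one (gen 2 i)) hy
        rwa [List.length_cons, hn, add_comm]
      · rw [List.length_cons, hn, iota_gen_commutator hy, hyl, if_neg h, zero_smul, add_zero]

end

section

open NC

/-! ### The rational Lie algebra of the completion -/

/-- The class in `ℚ ⊗ J_k` of an element of the `k`-th term of the closed lower central series. -/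
def jmk (k : ℕ) (y : Completion 2) (hy : y ∈ series 2 k) : ℚ ⊗[ℤ] Additive (J 2 k) :=
  1 ⊗ₜ Additive.ofMul (QuotientGroup.mk ⟨y, hy⟩)

theorem jmk_mul {k : ℕ} {y z : Completion 2} (hy : y ∈ series 2 k) (hz : z ∈ series 2 k) :
    jmk k (y * z) (mul_mem hy hz) = jmk k y hy + jmk k z hz :=
  TensorProduct.tmul_add (1 : ℚ) (Additive.ofMul (QuotientGroup.mk ⟨y, hy⟩ : J 2 k))
    (Additive.ofMul (QuotientGroup.mk ⟨z, hz⟩ : J 2 k))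

theorem jmk_of_mem {k : ℕ} {y : Completion 2} (hy : y ∈ series 2 (k + 1)) :
    jmk k y (series_succ_le 2 k hy) = 0 := by
  have : (QuotientGroup.mk ⟨y, series_succ_le 2 k hy⟩ : J 2 k) = 1 :=
    (QuotientGroup.eq_one_iff _).2 hy
  rw [jmk, this, ofMul_one, TensorProduct.tmul_zero]

theorem jq_induction {k : ℕ} {P : ℚ ⊗[ℤ] Additive (J 2 k) → Prop} (zero : P 0)
    (add : ∀ y z, P y → P z → P (y + z))
    (smul : ∀ (q : ℚ) (y : Completion 2) (hy : y ∈ series 2 k), P (q • jmk k y hy))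
    (z : ℚ ⊗[ℤ] Additive (J 2 k)) : P z := by
  induction z using TensorProduct.induction_on with
  | zero => exact zero
  | tmul q y =>
    obtain ⟨y, rfl⟩ := Additive.ofMul.surjective y
    obtain ⟨⟨y, hy⟩, rfl⟩ := QuotientGroup.mk_surjective y
    have := smul q y hy
    rwa [jmk, TensorProduct.smul_tmul', smul_eq_mul, mul_one] at this
  | add y z hy hz => exact add y z hy hz

/-- The graded rational Lie algebra (as a product). -/
abbrev GrLie : Type := ∀ k, ℚ ⊗[ℤ] Additive (J 2 k)

open Classical in
/-- The homogeneous element of degree `k` with a given representative. -/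
def el (k : ℕ) (y : Completion 2) : GrLie :=
  if h : y ∈ series 2 k then Pi.single k (jmk k y h) else 0

theorem el_eq {k : ℕ} {y : Completion 2} (hy : y ∈ series 2 k) :
    el k y = Pi.single k (jmk k y hy) := dif_pos hy

theorem el_mul {k : ℕ} {y z : Completion 2} (hy : y ∈ series 2 k) (hz : z ∈ series 2 k) :
    el k (y * z) = el k y + el k z := by
  rw [el_eq hy, el_eq hz, el_eq (mul_mem hy hz), jmk_mul hy hz, Pi.single_add]

theorem el_of_mem {k : ℕ} {y : Completion 2} (hy : y ∈ series 2 (k + 1)) : el k y = 0 := by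
  rw [el_eq (series_succ_le 2 k hy), jmk_of_mem hy, Pi.single_zero]

theorem el_one (k : ℕ) : el k 1 = 0 := el_of_mem (one_mem _)

theorem el_inv {k : ℕ} {y : Completion 2} (hy : y ∈ series 2 k) : el k y⁻¹ = -el k y := by
  have h := el_mul hy (inv_mem hy)
  rw [mul_inv_cancel, el_one] at h
  exact (neg_eq_of_add_eq_zero_right h.symm).symm

theorem el_congr {k : ℕ} {y z : Completion 2} (hy : y ∈ series 2 k)
    (h : (QuotientGroup.mk y : Completion 2 ⧸ series 2 (k + 1)) = QuotientGroup.mk z) :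
    el k y = el k z := by
  have h1 := QuotientGroup.eq.1 h
  have h2 := el_mul hy (series_succ_le 2 k h1)
  rw [mul_inv_cancel_left, el_of_mem h1, add_zero] at h2
  exact h2.symm

theorem commutator_gen_mem (i : Fin 2) {k : ℕ} {y : Completion 2} (hy : y ∈ series 2 k) :
    ⁅gen 2 i, y⁆ ∈ series 2 (k + 1) := by
  rw [add_comm]
  exact commutator_mem_series (mem_series_one _) hy

/-- The commutator with a generator. -/
def adHom (i : Fin 2) (k : ℕ) : J 2 k →* J 2 (k + 1) :=
  QuotientGroup.lift _
    { toFun := fun y => QuotientGroup.mk ⟨⁅gen 2 i, y.1⁆, commutator_gen_mem i y.2⟩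
      map_one' := (QuotientGroup.eq_one_iff _).2 (by
        rw [Subgroup.mem_subgroupOf]
        simp only [OneMemClass.coe_one, commutatorElement_one_right]
        exact one_mem _)
      map_mul' := fun y z => QuotientGroup.eq.2 (by
        rw [Subgroup.mem_subgroupOf]
        -- The defect of additivity is a commutator lying in term k + 2 of the series, hence trivial
        -- in J_{k+1}.
        have e : ⁅gen 2 i, y.1 * z.1⁆⁻¹ * (⁅gen 2 i, y.1⁆ * ⁅gen 2 i, z.1⁆) =
            ⁅y.1, ⁅gen 2 i, z.1⁆⁻¹⁆ := by
          simp only [commutatorElement_def]; group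
        have h := commutator_mem_series (mem_series_one y.1)
          (inv_mem (commutator_gen_mem i z.2))
        rw [← e, show 1 + (k + 1) = k + 1 + 1 by omega] at h
        exact h) }
    fun y hy => (QuotientGroup.eq_one_iff _).2 (commutator_gen_mem (k := k + 1) i hy)

/-- The rational extension of `adHom`. -/
def adLin (i : Fin 2) (k : ℕ) : ℚ ⊗[ℤ] Additive (J 2 k) →ₗ[ℚ] ℚ ⊗[ℤ] Additive (J 2 (k + 1)) :=
  LinearMap.baseChange ℚ (MonoidHom.toAdditive (adHom i k)).toIntLinearMap

theorem adLin_jmk (i : Fin 2) {k : ℕ} {y : Completion 2} (hy : y ∈ series 2 k) :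
    adLin i k (jmk k y hy) = jmk (k + 1) ⁅gen 2 i, y⁆ (commutator_gen_mem i hy) := rfl

/-- The operator of commutation with a generator. -/
def adOp (i : Fin 2) : GrLie →ₗ[ℚ] GrLie :=
  LinearMap.pi fun k => match k with
    | 0 => 0
    | k + 1 => adLin i k ∘ₗ LinearMap.proj k

theorem adOp_el (i : Fin 2) {k : ℕ} {y : Completion 2} (hy : y ∈ series 2 k) :
    adOp i (el k y) = el (k + 1) ⁅gen 2 i, y⁆ := by
  rw [el_eq hy, el_eq (commutator_gen_mem i hy)]
  funext m
  cases m with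
  | zero => rw [Pi.single_eq_of_ne (Nat.succ_ne_zero k).symm]; rfl
  | succ m =>
    change adLin i m ((Pi.single k (jmk k y hy) : GrLie) m) = _
    rcases eq_or_ne m k with rfl | h
    · rw [Pi.single_eq_same, Pi.single_eq_same, adLin_jmk]
    · rw [Pi.single_eq_of_ne h, Pi.single_eq_of_ne (by simpa using h), map_zero]

/-- The action of the free associative algebra by commutators with the generators. -/
def ad : NC →ₐ[ℚ] Module.End ℚ GrLie := NC.lift adOp

/-- Conjugating ⁅v, y⁆ by x gives ⁅⁅x, v⁆ v, ⁅x, y⁆ y⁆. Expanding this, the hypotheses remove all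
conjugations and the cross term ⁅⁅x, v⁆, ⁅x, y⁆⁆. -/
theorem commutator_jacobi_of_commute {Q : Type*} [Group Q] {x v y : Q}
    (h1 : Commute ⁅x, v⁆ ⁅v, ⁅x, y⁆ * y⁆) (h2 : Commute ⁅x, y⁆ ⁅v, y⁆)
    (h3 : ⁅⁅x, v⁆, ⁅x, y⁆⁆ = 1) (h4 : Commute ⁅x, y⁆ ⁅⁅x, v⁆, y⁆)
    (h5 : Commute ⁅⁅x, v⁆, y⁆ ⁅v, y⁆) : ⁅x, ⁅v, y⁆⁆ = ⁅v, ⁅x, y⁆⁆ * ⁅⁅x, v⁆, y⁆ := by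
  have e0 : ⁅x, ⁅v, y⁆⁆ * ⁅v, y⁆ = ⁅⁅x, v⁆ * v, ⁅x, y⁆ * y⁆ := by
    simp only [commutatorElement_def]; group
  have e1 : ∀ a c : Q, ⁅a * v, c * y⁆ = a * ⁅v, c * y⁆ * a⁻¹ * ⁅a, c * y⁆ := fun a c => by
    simp only [commutatorElement_def]; group
  have e2 : ∀ b c : Q, ⁅b, c * y⁆ = ⁅b, c⁆ * (c * ⁅b, y⁆ * c⁻¹) := fun b c => by
    simp only [commutatorElement_def]; group
  have e3 : ∀ a b : Q, Commute a b → a * b * a⁻¹ = b := fun a b h => by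
    rw [h.eq, mul_inv_cancel_right]
  rw [e1, e3 _ _ h1, e2 v, e3 _ _ h2, e2 ⁅x, v⁆, h3, one_mul, e3 _ _ h4, mul_assoc, ← h5.eq,
    ← mul_assoc] at e0
  exact mul_right_cancel e0

theorem el_jacobi (i : Fin 2) {n m : ℕ} {v y : Completion 2} (hv : v ∈ series 2 (n + 1))
    (hy : y ∈ series 2 m) :
    el (n + 1 + m + 1) ⁅⁅gen 2 i, v⁆, y⁆ =
      el (n + 1 + m + 1) ⁅gen 2 i, ⁅v, y⁆⁆ - el (n + 1 + m + 1) ⁅v, ⁅gen 2 i, y⁆⁆ := by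
  have hy1 := mem_series_one y
  have hxv := commutator_gen_mem i hv
  have hxy := commutator_gen_mem i hy
  have hvy := commutator_mem_series hv hy
  have hxvy : ⁅⁅gen 2 i, v⁆, y⁆ ∈ series 2 (n + 1 + m + 1) := by
    have := commutator_mem_series hxv hy
    rwa [show n + 1 + 1 + m = n + 1 + m + 1 by omega] at this
  have hvxy : ⁅v, ⁅gen 2 i, y⁆⁆ ∈ series 2 (n + 1 + m + 1) :=
    commutator_mem_series (n := n + 1) (m := m + 1) hv hxy
  let π := QuotientGroup.mk' (series 2 (n + 1 + m + 1 + 1))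
  have hone : ∀ {k : ℕ} {z : Completion 2}, z ∈ series 2 k → n + 1 + m + 1 + 1 ≤ k → π z = 1 :=
    fun hz hk => (QuotientGroup.eq_one_iff _).2 (series_antitone 2 hk hz)
  have hcomm : ∀ {p q : ℕ} {a b : Completion 2}, a ∈ series 2 p → b ∈ series 2 q →
      n + 1 + m + 1 + 1 ≤ p + q → Commute (π a) (π b) := by
    intro p q a b ha hb h
    rw [← commutatorElement_eq_one_iff_commute, ← map_commutatorElement]
    exact hone (commutator_mem_series ha hb) h
  have hmem : ⁅v, ⁅gen 2 i, y⁆ * y⁆ ∈ series 2 (n + 1 + m) :=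
    commutator_mem_series hv (mul_mem (series_succ_le 2 m hxy) hy)
  have key : π ⁅gen 2 i, ⁅v, y⁆⁆ = π (⁅v, ⁅gen 2 i, y⁆⁆ * ⁅⁅gen 2 i, v⁆, y⁆) := by
    simp only [map_mul, map_commutatorElement]
    apply commutator_jacobi_of_commute
    · simp only [← map_commutatorElement, ← map_mul]
      exact hcomm hxv hmem (by omega)
    · simp only [← map_commutatorElement]
      -- For m = 0 the weights do not add up to enough; but y also lies in `series 2 1`, which
      -- supplies the missing one.
      rcases m with _ | m
      · have h1 : ⁅v, y⁆ ∈ series 2 (n + 2) :=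
          commutator_mem_series (n := n + 1) (m := 1) hv hy1
        exact hcomm hxy h1 (by omega)
      · exact hcomm hxy hvy (by omega)
    · simp only [← map_commutatorElement]
      rcases m with _ | m
      · have h1 : ⁅gen 2 i, y⁆ ∈ series 2 2 :=
          commutator_mem_series (n := 1) (m := 1) (mem_series_one _) hy1
        exact hone (commutator_mem_series hxv h1) (by omega)
      · exact hone (commutator_mem_series hxv hxy) (by omega)
    · simp only [← map_commutatorElement]
      exact hcomm hxy hxvy (by omega)
    · simp only [← map_commutatorElement]
      exact hcomm hxvy hvy (by omega)
  have h := el_congr (k := n + 1 + m + 1) (commutator_gen_mem i hvy) key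
  rw [h, el_mul hvxy hxvy]
  abel

/-- The commutator action of u on the graded Lie algebra depends only on its leading Magnus
coefficient; `el_jacobi` carries the induction. -/
theorem ad_iota : ∀ n, ∀ u ∈ series 2 (n + 1), ∀ m, ∀ y ∈ series 2 m,
    ad (iota (n + 1) u) (el m y) = el (n + 1 + m) ⁅u, y⁆ := by
  refine series_induction (P := fun n u => ∀ m, ∀ y ∈ series 2 m,
    ad (iota (n + 1) u) (el m y) = el (n + 1 + m) ⁅u, y⁆) ?_ ?_ ?_ ?_ ?_
  · intro n u hu v hv h1 h2 m y hy
    have huy := commutator_mem_series hu hy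
    have hvy := commutator_mem_series hv hy
    have e : ⁅u * v, y⁆ = ⁅u, ⁅v, y⁆⁆ * ⁅v, y⁆ * ⁅u, y⁆ := by
      simp only [commutatorElement_def]; group
    have h3 : ⁅u, ⁅v, y⁆⁆ ∈ series 2 (n + 1 + m + 1) := by
      have := commutator_mem_series (mem_series_one u) hvy
      rwa [add_comm] at this
    rw [iota_mul hu hv, map_add, LinearMap.add_apply, h1 m y hy, h2 m y hy, e,
      el_mul (mul_mem (series_succ_le 2 _ h3) hvy) huy, el_mul (series_succ_le 2 _ h3) hvy,
      el_of_mem h3, zero_add, add_comm]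
  · intro n u hu h m y hy
    have huy := commutator_mem_series hu hy
    have e : ⁅u⁻¹, y⁆ = ⁅u⁻¹, ⁅u, y⁆⁻¹⁆ * ⁅u, y⁆⁻¹ := by
      simp only [commutatorElement_def]; group
    have h3 : ⁅u⁻¹, ⁅u, y⁆⁻¹⁆ ∈ series 2 (n + 1 + m + 1) := by
      have := commutator_mem_series (mem_series_one u⁻¹) (inv_mem huy)
      rwa [add_comm] at this
    rw [iota_inv hu, map_neg, LinearMap.neg_apply, h m y hy, e,
      el_mul (series_succ_le 2 _ h3) (inv_mem huy), el_of_mem h3, zero_add, el_inv huy]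
  · intro n u hu m y hy
    have huy := commutator_mem_series hu hy
    rw [show n + 2 + m = n + 1 + m + 1 by omega] at huy
    rw [iota_of_mem hu, map_zero, LinearMap.zero_apply, el_of_mem huy]
  · intro i m y hy
    rw [iota_gen, ad, NC.lift_x, adOp_el i hy, show 0 + 1 + m = m + 1 by omega]
  · intro n v hv h i m y hy
    have hvy := commutator_mem_series hv hy
    rw [iota_gen_commutator hv, map_sub, map_mul ad, map_mul ad, LinearMap.sub_apply,
      Module.End.mul_apply, Module.End.mul_apply, h m y hy]
    have hx : ad (x i) = adOp i := NC.lift_x _ i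
    rw [hx, adOp_el i hvy, adOp_el i hy, h (m + 1) _ (commutator_gen_mem i hy),
      show n + 1 + 1 + m = n + 1 + m + 1 by omega, el_jacobi i hv hy]
    rfl

/-- The right-normed commutators of the generators. -/
def betaWord : List (Fin 2) → GrLie
  | [] => 0
  | i :: l => adOp i (betaWord l) + cf [] (word l) • el 1 (gen 2 i)

/-- A left inverse, up to the degree, of the Magnus expansion. -/
def beta : NC →ₗ[ℚ] GrLie := ofWords betaWord

theorem beta_one : beta 1 = 0 := by rw [beta, ← word_nil, ofWords_word, betaWord]

theorem beta_x_mul (i : Fin 2) (a : NC) :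
    beta (x i * a) = adOp i (beta a) + cf [] a • el 1 (gen 2 i) := by
  refine DFunLike.congr_fun (f := beta ∘ₗ LinearMap.mulLeft ℚ (x i))
    (g := adOp i ∘ₗ beta + (cf []).smulRight (el 1 (gen 2 i))) (hom_ext fun l => ?_) a
  simp only [LinearMap.comp_apply, LinearMap.mulLeft_apply, LinearMap.add_apply,
    LinearMap.smulRight_apply]
  rw [← word_cons, beta, ofWords_word, ofWords_word, betaWord]

/-- `beta` reads a word as iterated commutation by its letters, applied to the last generator. -/
theorem beta_mul_x (a : NC) (j : Fin 2) : beta (a * x j) = ad a (el 1 (gen 2 j)) := by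
  induction a using word_induction with
  | hw l =>
    induction l with
    | nil =>
      rw [word_nil, one_mul, map_one ad, Module.End.one_apply]
      have := beta_x_mul j 1
      rw [mul_one, beta_one, map_zero, zero_add, ← word_nil, cf_word, if_pos rfl, one_smul] at this
      exact this
    | cons i l ih =>
      rw [word_cons, mul_assoc, beta_x_mul, ih, map_mul ad, ← eps_eq, map_mul eps, eps_x, mul_zero,
        zero_smul, add_zero, Module.End.mul_apply]
      congr 1
      exact (NC.lift_x adOp i).symm
  | h0 => simp
  | hadd a b ha hb => rw [add_mul, map_add, ha, hb, map_add, LinearMap.add_apply]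
  | hsmul c a ha => rw [smul_mul_assoc, map_smul, ha, map_smul, LinearMap.smul_apply]

/-- The Dynkin–Specht–Wever computation for group elements: for ⁅x_i, v⁆ the term x_i ι(v) gives n +
1 copies by induction, and −ι(v) x_i gives −⁅v, x_i⁆, one copy more. -/
theorem beta_iota : ∀ n, ∀ u ∈ series 2 (n + 1),
    beta (iota (n + 1) u) = ((n + 1 : ℕ) : ℚ) • el (n + 1) u := by
  refine series_induction ?_ ?_ ?_ ?_ ?_
  · intro n u hu v hv h1 h2
    rw [iota_mul hu hv, map_add, h1, h2, el_mul hu hv, smul_add]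
  · intro n u hu h
    rw [iota_inv hu, map_neg, h, el_inv hu, smul_neg]
  · intro n u hu
    rw [iota_of_mem hu, map_zero, el_of_mem hu, smul_zero]
  · intro i
    have := beta_x_mul i 1
    rw [mul_one, beta_one, map_zero, zero_add, ← word_nil, cf_word, if_pos rfl, one_smul] at this
    rw [iota_gen, this]
    simp
  · intro n v hv h i
    have h0 : cf [] (iota (n + 1) v) = 0 := by
      by_contra hc
      exact Nat.succ_ne_zero n (mem_supp.1 (iota_mem_lie n v hv).2 [] hc).symm
    rw [iota_gen_commutator hv, map_sub, beta_x_mul, h0, zero_smul, add_zero, h, beta_mul_x,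
      ad_iota n v hv 1 _ (mem_series_one _), map_smul, adOp_el i hv, ← commutatorElement_inv (gen 2 i),
      el_inv (commutator_gen_mem i hv)]
    push_cast
    module

theorem iota_congr {n : ℕ} {y z : Completion 2} (hy : y ∈ series 2 (n + 1))
    (h : (QuotientGroup.mk y : Completion 2 ⧸ series 2 (n + 2)) = QuotientGroup.mk z) :
    iota (n + 1) y = iota (n + 1) z := by
  have h1 := QuotientGroup.eq.1 h
  have h2 := iota_mul hy (series_succ_le 2 _ h1)
  rw [mul_inv_cancel_left, iota_of_mem h1, add_zero] at h2
  exact h2.symm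

/-- The Magnus expansion in degree `n + 1` as a homomorphism on `J_{n+1}`. -/
def iotaHom (n : ℕ) : J 2 (n + 1) →* Multiplicative NC :=
  QuotientGroup.lift _
    { toFun := fun y => Multiplicative.ofAdd (iota (n + 1) y.1)
      map_one' := by rw [OneMemClass.coe_one, iota_one, ofAdd_zero]
      map_mul' := fun y z => by rw [← ofAdd_add, ← iota_mul y.2 z.2]; rfl }
    fun y hy => by
      change Multiplicative.ofAdd (iota (n + 1) y.1) = 1
      rw [iota_of_mem hy, ofAdd_zero]

/-- The rational Magnus expansion in degree `n + 1`. -/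
def iotaQ (n : ℕ) : ℚ ⊗[ℤ] Additive (J 2 (n + 1)) →ₗ[ℚ] NC :=
  LinearMap.liftBaseChange ℚ (MonoidHom.toAdditiveLeft (iotaHom n)).toIntLinearMap

theorem iotaQ_jmk {n : ℕ} {y : Completion 2} (hy : y ∈ series 2 (n + 1)) :
    iotaQ n (jmk (n + 1) y hy) = iota (n + 1) y := by
  rw [iotaQ, jmk, LinearMap.liftBaseChange_tmul, one_smul]
  rfl

theorem iotaQ_injective (n : ℕ) : Function.Injective (iotaQ n) := by
  rw [← LinearMap.ker_eq_bot, LinearMap.ker_eq_bot']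
  intro z hz
  have h : ∀ z, beta (iotaQ n z) = ((n + 1 : ℕ) : ℚ) • (Pi.single (n + 1) z : GrLie) := by
    refine jq_induction (by simp) (fun y z hy hz => ?_) fun q y hy => ?_
    · rw [map_add, map_add, hy, hz, Pi.single_add, smul_add]
    · rw [map_smul, iotaQ_jmk, map_smul, beta_iota n y hy, el_eq hy, Pi.single_smul, smul_comm]
  have h1 := h z
  rw [hz, map_zero] at h1
  have h2 := (smul_eq_zero.1 h1.symm).resolve_left (by positivity)
  have h3 := congrFun h2 (n + 1)
  rwa [Pi.single_eq_same] at h3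

theorem range_iotaQ (n : ℕ) : LinearMap.range (iotaQ n) = lie (n + 1) := by
  refine le_antisymm ?_ ?_
  · rintro _ ⟨z, rfl⟩
    induction z using jq_induction with
    | zero => simp
    | add y z hy hz => rw [map_add]; exact add_mem hy hz
    | smul q y hy =>
      rw [map_smul, iotaQ_jmk]
      exact Submodule.smul_mem _ _ (iota_mem_lie n y hy)
  · rw [lie_eq_map n.succ_ne_zero, Submodule.map_le_iff_le_comap]
    intro a ha
    refine map_supp_le (f := dyn) (U := LinearMap.range (iotaQ n)) ?_ ha
    intro l hl
    have hl : l.length = n + 1 := hl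
    obtain ⟨y, hy, h⟩ := exists_iota_eq_dyn l (by rintro rfl; simp at hl)
    rw [hl] at hy h
    exact ⟨jmk (n + 1) y hy, by rw [iotaQ_jmk, h]⟩

end

section

open NC

/-! ### Equivariance of the Magnus expansion -/

theorem iota_commutator' {n : ℕ} {y : Completion 2} (g : Completion 2)
    (hy : y ∈ series 2 (n + 1)) :
    iota (n + 2) ⁅g, y⁆ = iota 1 g * iota (n + 1) y - iota (n + 1) y * iota 1 g := by
  have hmem : ⁅y, g⁆ ∈ series 2 (n + 2) :=
    commutator_mem_series (n := n + 1) (m := 1) hy (mem_series_one _)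
  rw [← commutatorElement_inv, iota_inv hmem, iota_commutator hy, neg_sub]

/-- Commutators with generators build up the series and are respected by both sides, so the action
on the abelianization determines the action on all leading coefficients. -/
theorem iota_apply {f : Completion 2 →* Completion 2} (hf : Filtered f)
    {A : Matrix (Fin 2) (Fin 2) ℚ} (h : ∀ j, iota 1 (f (gen 2 j)) = lin A j) :
    ∀ n, ∀ y ∈ series 2 (n + 1), iota (n + 1) (f y) = rhoA A (iota (n + 1) y) := by
  refine series_induction ?_ ?_ ?_ ?_ ?_
  · intro n y hy z hz h1 h2
    rw [map_mul, iota_mul (hf _ y hy) (hf _ z hz), h1, h2, iota_mul hy hz, map_add]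
  · intro n y hy h
    rw [map_inv, iota_inv (hf _ y hy), h, iota_inv hy, map_neg]
  · intro n y hy
    rw [iota_of_mem (hf _ y hy), iota_of_mem hy, map_zero]
  · intro i
    rw [h, iota_gen, rhoA_x]
  · intro n y hy ih i
    rw [map_commutatorElement, iota_commutator' _ (hf _ y hy), h, ih, iota_gen_commutator hy,
      map_sub, map_mul (rhoA A), map_mul (rhoA A), rhoA_x]

/-- The value of an additive function on a product of powers of the generators. -/
theorem map_prod_gen_zpow {V : Type*} [AddCommGroup V] (f : Completion 2 → V)
    (hf : ∀ y z, f (y * z) = f y + f z) (e : Fin 2 → ℤ) :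
    f (List.ofFn fun i => gen 2 i ^ e i).prod = ∑ i, e i • f (gen 2 i) := by
  let F : Completion 2 →* Multiplicative V :=
    MonoidHom.mk' (fun y => Multiplicative.ofAdd (f y)) fun y z => by rw [hf]; rfl
  have h : ∀ (y : Completion 2) (k : ℤ), f (y ^ k) = k • f y := fun y k =>
    congrArg Multiplicative.toAdd (map_zpow F y k)
  have h1 : f 1 = 0 := congrArg Multiplicative.toAdd (map_one F)
  simp [List.ofFn_succ, hf, h, Fin.sum_univ_two]

theorem iota_one_of_induces {φ : B 2} {g : GL (Fin 2) ℤ} (h : Induces 2 φ g) (j : Fin 2) :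
    iota 1 (φ.1 (gen 2 j)) = lin (g.1.map (Int.cast : ℤ → ℚ)) j := by
  rw [iota_congr (mem_series_one _) (h j), map_prod_gen_zpow (iota 1)
    fun y z => iota_mul (mem_series_one y) (mem_series_one z), lin]
  refine Finset.sum_congr rfl fun i _ => ?_
  rw [iota_gen, Matrix.map_apply, Int.cast_smul_eq_zsmul]

theorem iota_act {φ : B 2} {g : GL (Fin 2) ℤ} (h : Induces 2 φ g) {n : ℕ} {y : Completion 2}
    (hy : y ∈ series 2 (n + 1)) :
    iota (n + 1) (φ.1 y) = rhoA (g.1.map (Int.cast : ℤ → ℚ)) (iota (n + 1) y) :=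
  iota_apply (filtered_of_mem φ) (iota_one_of_induces h) n y hy

/-! ### Automorphisms with prescribed values on the generators -/

theorem exists_mem_B {r : ℕ} {f f' : Completion r →* Completion r} (hf : Filtered f)
    (hf' : Filtered f') (h : ∀ i, f (f' (gen r i)) = gen r i) (h' : ∀ i, f' (f (gen r i)) = gen r i) :
    ∃ φ : B r, ∀ y, φ.1 y = f y := by
  let e : MulAut (Completion r) := MonoidHom.toMulEquiv f f'
    (Filtered.ext (hf'.comp hf) Filtered.id h') (Filtered.ext (hf.comp hf') Filtered.id h)
  exact ⟨⟨e, hf.continuous, hf'.continuous⟩, fun _ => rfl⟩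

theorem exists_induces_transvection (i j : Fin 2) (hij : i ≠ j) (m : ℤ) :
    ∃ φ, Induces 2 φ (intTransvection i j hij m) := by
  let v : ℤ → Fin 2 → Completion 2 := fun m k =>
    (List.ofFn fun l => gen 2 l ^ (Matrix.transvection i j m l k)).prod
  choose f hf hfv using fun m => exists_filtered (v m)
  have hinv : ∀ m k, f m (f (-m) (gen 2 k)) = gen 2 k := by
    intro m k
    rw [hfv]
    fin_cases i <;> fin_cases j
    · exact absurd rfl hij
    · fin_cases k <;> simp [v, List.ofFn_succ, Matrix.transvection, hfv, Matrix.one_apply]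
    · fin_cases k <;> simp [v, List.ofFn_succ, Matrix.transvection, hfv, Matrix.one_apply]
    · exact absurd rfl hij
  obtain ⟨φ, hφ⟩ := exists_mem_B (hf m) (hf (-m)) (hinv m) fun k => by
    have := hinv (-m) k
    rwa [neg_neg] at this
  exact ⟨φ, fun k => by rw [hφ, hfv]; rfl⟩

/-- No twist is needed here (k = 0): the Magnus map is equivariant for the substitution action
itself. -/
theorem J_models (n : ℕ) :
    (∃ ρ, IsRationalForm (actJ 2 (n + 1)) (n + 1) ρ) ∧
      ∀ ρ, IsRationalForm (actJ 2 (n + 1)) (n + 1) ρ →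
        ∃ M : Model ρ (n + 1 + 2 * 0) 0, LinearMap.range M.j = lie (n + 1) := by
  have hr := range_iotaQ n
  obtain ⟨h1, h2⟩ := rational_form_models (actJ 2 (n + 1)) (n := n + 1) (k := 0)
    (iotaQ_injective n) (hr ▸ lie_le (n + 1)) (hr ▸ lie_stable (n + 1)) (fun φ g hφ y => by
      obtain ⟨⟨y, hy⟩, rfl⟩ := QuotientGroup.mk_surjective y
      rw [pow_zero, one_smul]
      refine (iotaQ_jmk (apply_mem_series φ _ hy)).trans ?_
      rw [iota_act hφ hy]
      exact congrArg _ (iotaQ_jmk hy).symm) exists_induces_transvection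
  refine ⟨h1, fun ρ hρ => ?_⟩
  obtain ⟨M, hM⟩ := h2 ρ hρ
  exact ⟨M, by rw [hM, hr]⟩

end

section

open NC

/-! ### Endomorphisms that are trivial on the abelianization -/

section Unipotent

variable {r : ℕ} {f : Completion r →* Completion r}

theorem commute_mk {p q k : ℕ} {a b : Completion r} (ha : a ∈ series r p) (hb : b ∈ series r q)
    (h : k ≤ p + q) : Commute (QuotientGroup.mk' (series r k) a) (QuotientGroup.mk' (series r k) b) := by
  rw [← commutatorElement_eq_one_iff_commute, ← map_commutatorElement]
  exact (QuotientGroup.eq_one_iff _).2 (series_antitone r h (commutator_mem_series ha hb))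

/-- The analogue of `PronilpotentFree.mk_apply_eq` for an endomorphism not yet known to be
invertible; it is what proves invertibility. -/
theorem Filtered.mk_apply_eq (hf : Filtered f)
    (h : ∀ i, (QuotientGroup.mk (f (gen r i)) : Completion r ⧸ series r 2) = QuotientGroup.mk (gen r i)) :
    ∀ n, ∀ y ∈ series r (n + 1),
      (QuotientGroup.mk (f y) : Completion r ⧸ series r (n + 2)) = QuotientGroup.mk y := by
  refine series_induction ?_ ?_ ?_ h ?_
  · intro n y _ z _ h1 h2
    rw [map_mul, QuotientGroup.mk_mul, QuotientGroup.mk_mul, h1, h2]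
  · intro n y _ h
    rw [map_inv, QuotientGroup.mk_inv, QuotientGroup.mk_inv, h]
  · intro n y hy
    rw [(QuotientGroup.eq_one_iff _).2 hy, (QuotientGroup.eq_one_iff _).2 (hf _ y hy)]
  · intro n y hy ih i
    have h1 := QuotientGroup.eq.1 (h i).symm
    have h2 := QuotientGroup.eq.1 ih.symm
    have ea : f (gen r i) = gen r i * ((gen r i)⁻¹ * f (gen r i)) := by group
    have eb : f y = y * (y⁻¹ * f y) := by group
    let π := QuotientGroup.mk' (series r (n + 1 + 2))
    change π (f ⁅gen r i, y⁆) = π ⁅gen r i, y⁆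
    generalize (gen r i)⁻¹ * f (gen r i) = α at h1 ea
    generalize y⁻¹ * f y = β at h2 eb
    have c1 : Commute (π α) (π (y * β)) :=
      commute_mk h1 (mul_mem hy (series_succ_le r _ h2)) (by omega)
    have c2 : Commute (π β) (π (gen r i)) := commute_mk h2 (mem_series_one _) (by omega)
    have c3 : Commute (π α) (π β) := commute_mk h1 h2 (by omega)
    have c4 : Commute (π β) (π y) := commute_mk h2 (mem_series_one y) (by omega)
    rw [map_commutatorElement, map_commutatorElement, map_commutatorElement, ea, eb]
    rw [map_mul π y β] at c1
    simp only [map_mul, commutatorElement_def, mul_inv_rev]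
    calc π (gen r i) * π α * (π y * π β) * ((π α)⁻¹ * (π (gen r i))⁻¹) * ((π β)⁻¹ * (π y)⁻¹)
        = π (gen r i) * (π α * (π y * π β)) * (π α)⁻¹ * (π (gen r i))⁻¹ * (π β)⁻¹ * (π y)⁻¹ := by
          simp only [mul_assoc]
      _ = π (gen r i) * π y * (π β * (π (gen r i))⁻¹) * (π β)⁻¹ * (π y)⁻¹ := by
          rw [c1.eq]; simp only [mul_assoc, mul_inv_cancel_left]
      _ = π (gen r i) * π y * (π (gen r i))⁻¹ * (π y)⁻¹ := by
          rw [c2.inv_right.eq]; simp only [mul_assoc, mul_inv_cancel_left]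

theorem mem_series_of_apply_mem
    (h : ∀ n, ∀ y ∈ series r (n + 1),
      (QuotientGroup.mk (f y) : Completion r ⧸ series r (n + 2)) = QuotientGroup.mk y)
    {n : ℕ} {y : Completion r} (hy : f y ∈ series r n) : y ∈ series r n := by
  have key : ∀ k ≤ n, y ∈ series r k := by
    intro k
    induction k with
    | zero => intro _; trivial
    | succ k ih =>
      intro hk
      rcases k with _ | k
      · exact mem_series_one y
      · have h1 := h k y (ih (by omega))
        rw [(QuotientGroup.eq_one_iff _).2 (series_antitone r hk hy)] at h1
        exact (QuotientGroup.eq_one_iff _).1 h1.symm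
  exact key n le_rfl

theorem injective_of_mk_apply_eq
    (h : ∀ n, ∀ y ∈ series r (n + 1),
      (QuotientGroup.mk (f y) : Completion r ⧸ series r (n + 2)) = QuotientGroup.mk y) :
    Function.Injective f := by
  rw [injective_iff_map_eq_one]
  intro y hy
  refine completion_ext fun n => ?_
  rw [map_one, ← mem_series_succ]
  exact mem_series_of_apply_mem h (by rw [hy]; exact one_mem _)

/-- Successive approximation: Y_{n+1} = Y_n · f(Y_n)⁻¹ y moves the error f(Y_n)⁻¹ y one step deeper,
and the limit exists by completeness. -/
theorem Filtered.surjective (hf : Filtered f)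
    (h : ∀ n, ∀ y ∈ series r (n + 1),
      (QuotientGroup.mk (f y) : Completion r ⧸ series r (n + 2)) = QuotientGroup.mk y) :
    Function.Surjective f := by
  intro y
  let Y : ℕ → Completion r := fun n => Nat.rec 1 (fun _ z => z * ((f z)⁻¹ * y)) n
  have hY : ∀ n, Y (n + 1) = Y n * ((f (Y n))⁻¹ * y) := fun _ => rfl
  have hmem : ∀ n, (f (Y n))⁻¹ * y ∈ series r (n + 1) := by
    intro n
    induction n with
    | zero => exact mem_series_one _
    | succ n ih =>
      have := QuotientGroup.eq.1 (h n _ ih)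
      rw [hY, map_mul, mul_inv_rev, mul_assoc]
      exact this
  have hcomp : ∀ m n, m ≤ n → component r m (Y n) = component r m (Y m) := by
    intro m n hmn
    induction n, hmn using Nat.le_induction with
    | base => rfl
    | succ n hn ih =>
      rw [hY, map_mul, ih, mem_series_succ.1 (series_antitone r (by omega) (hmem n)), mul_one]
  let z : Completion r := ⟨fun n => component r n (Y n), fun m n hmn =>
    ((Y n).2 m n hmn).trans (hcomp m n hmn)⟩
  refine ⟨z, completion_ext fun n => ?_⟩
  have h1 : z⁻¹ * Y n ∈ series r (n + 1) := by
    rw [mem_series_succ, map_mul, map_inv]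
    exact inv_mul_cancel _
  have h2 := mem_series_succ.1 (hf _ _ h1)
  have h3 := mem_series_succ.1 (hmem n)
  rw [map_mul, map_inv, map_mul, map_inv, inv_mul_eq_one] at h2
  rw [map_mul, map_inv, inv_mul_eq_one] at h3
  exact h2.trans h3

theorem Filtered.exists_mem_B (hf : Filtered f)
    (h : ∀ i, (QuotientGroup.mk (f (gen r i)) : Completion r ⧸ series r 2) = QuotientGroup.mk (gen r i)) :
    ∃ φ : B r, ∀ y, φ.1 y = f y := by
  have h' := hf.mk_apply_eq h
  let e := MulEquiv.ofBijective f ⟨injective_of_mk_apply_eq h', hf.surjective h'⟩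
  have he : ∀ y, f (e.symm y) = y := e.apply_symm_apply
  have hs : Filtered e.symm.toMonoidHom := fun n y hy =>
    mem_series_of_apply_mem h' (by rw [MulEquiv.toMonoidHom_eq_coe, MonoidHom.coe_coe, he]; exact hy)
  exact PronilpotentFree.exists_mem_B hf hs (fun i => he _) fun i => e.symm_apply_apply _

end Unipotent

theorem exists_mem_BFilt {r n : ℕ} (u : Fin r → Completion r) (hu : ∀ i, u i ∈ series r (n + 2)) :
    ∃ φ ∈ BFilt r (n + 1), ∀ i, φ.1 (gen r i) = gen r i * u i := by
  obtain ⟨f, hf, hfu⟩ := exists_filtered fun i => gen r i * u i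
  have hm : ∀ k ≤ n + 2, ∀ i, (QuotientGroup.mk (f (gen r i)) : Completion r ⧸ series r k) =
      QuotientGroup.mk (gen r i) := fun k hk i => by
    refine (QuotientGroup.eq.2 ?_).symm
    rw [hfu, inv_mul_cancel_left]
    exact series_antitone r hk (hu i)
  obtain ⟨φ, hφ⟩ := hf.exists_mem_B (hm 2 (by omega))
  refine ⟨φ, fun y => ?_, fun i => by rw [hφ, hfu]⟩
  rw [hφ]
  obtain ⟨w, k, hk, rfl⟩ := exists_toCompletion_mul (n + 2) y
  have e : ((QuotientGroup.mk' (series r (n + 2))).comp f).comp (toCompletion r) =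
      (QuotientGroup.mk' (series r (n + 2))).comp (toCompletion r) :=
    FreeGroup.ext_hom _ _ fun i => hm _ le_rfl i
  have e' := DFunLike.congr_fun e w
  rw [map_mul, QuotientGroup.mk_mul, QuotientGroup.mk_mul, (QuotientGroup.eq_one_iff _).2 hk,
    (QuotientGroup.eq_one_iff _).2 (hf _ k hk)]
  exact congrArg (· * 1) e'

theorem mem_BFilt_of_gen {r n : ℕ} {φ : B r}
    (h : ∀ i, (gen r i)⁻¹ * φ.1 (gen r i) ∈ series r (n + 1)) : φ ∈ BFilt r n := by
  intro y
  obtain ⟨w, k, hk, rfl⟩ := exists_toCompletion_mul (n + 1) y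
  have e : ((QuotientGroup.mk' (series r (n + 1))).comp φ.1.toMonoidHom).comp (toCompletion r) =
      (QuotientGroup.mk' (series r (n + 1))).comp (toCompletion r) :=
    FreeGroup.ext_hom _ _ fun i => (QuotientGroup.eq.2 (h i)).symm
  have e' := DFunLike.congr_fun e w
  rw [map_mul, QuotientGroup.mk_mul, QuotientGroup.mk_mul, (QuotientGroup.eq_one_iff _).2 hk,
    (QuotientGroup.eq_one_iff _).2 (apply_mem_series φ _ hk)]
  exact congrArg (· * 1) e'

/-! ### The homogeneous components of the automorphism group -/

theorem tau_mem {r n : ℕ} {φ : B r} (hφ : φ ∈ BFilt r n) (y : Completion r) :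
    y⁻¹ * φ.1 y ∈ series r (n + 1) := QuotientGroup.eq.1 (hφ y).symm

theorem BFilt_le_one {r n : ℕ} : BFilt r (n + 1) ≤ BFilt r 1 := fun _ hχ x =>
  QuotientGroup.eq.2 (series_antitone r (by omega) (QuotientGroup.eq.1 (hχ x)))

/-- The homomorphism `φ ↦ x_i⁻¹ φ(x_i)`. -/
def tau (n : ℕ) (i : Fin 2) : M 2 (n + 1) →* J 2 (n + 2) :=
  QuotientGroup.lift _
    { toFun := fun φ => QuotientGroup.mk ⟨_, tau_mem φ.2 (gen 2 i)⟩
      map_one' := (QuotientGroup.eq_one_iff _).2 (by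
        rw [Subgroup.mem_subgroupOf]
        change (gen 2 i)⁻¹ * gen 2 i ∈ _
        rw [inv_mul_cancel]
        exact one_mem _)
      map_mul' := fun φ ψ => QuotientGroup.eq.2 (by
        rw [Subgroup.mem_subgroupOf]
        -- One has x⁻¹ φψ(x) = x⁻¹ φ(x) · φ(x⁻¹ ψ(x)), and φ acts trivially on J_{n+2}.
        have h := QuotientGroup.eq.1 (mk_apply_eq (BFilt_le_one φ.2) (n + 2) (tau_mem ψ.2 (gen 2 i)))
        have e : ((gen 2 i)⁻¹ * (φ.1.1 (ψ.1.1 (gen 2 i))))⁻¹ *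
            ((gen 2 i)⁻¹ * φ.1.1 (gen 2 i) * ((gen 2 i)⁻¹ * ψ.1.1 (gen 2 i))) =
            (φ.1.1 ((gen 2 i)⁻¹ * ψ.1.1 (gen 2 i)))⁻¹ * ((gen 2 i)⁻¹ * ψ.1.1 (gen 2 i)) := by
          rw [map_mul, map_inv]; group
        rw [← e] at h
        exact h) }
    fun φ hφ => (QuotientGroup.eq_one_iff _).2 (tau_mem hφ (gen 2 i))

/-- An automorphism that fixes the generators modulo the next term is trivial in the quotient, and
by `exists_mem_BFilt` every deep enough perturbation of the generators extends to an automorphism.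
-/
theorem tau_bijective (n : ℕ) : Function.Bijective ((tau n 0).prod (tau n 1)) := by
  constructor
  · rw [injective_iff_map_eq_one]
    intro z hz
    obtain ⟨⟨φ, hφ⟩, rfl⟩ := QuotientGroup.mk_surjective z
    have h0 : (QuotientGroup.mk ⟨_, tau_mem hφ (gen 2 0)⟩ : J 2 (n + 2)) = 1 := congrArg Prod.fst hz
    have h1 : (QuotientGroup.mk ⟨_, tau_mem hφ (gen 2 1)⟩ : J 2 (n + 2)) = 1 := congrArg Prod.snd hz
    have h0' := (QuotientGroup.eq_one_iff _).1 h0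
    have h1' := (QuotientGroup.eq_one_iff _).1 h1
    refine (QuotientGroup.eq_one_iff _).2 ?_
    rw [Subgroup.mem_subgroupOf]
    refine mem_BFilt_of_gen fun i => ?_
    fin_cases i
    · exact h0'
    · exact h1'
  · rintro ⟨a, b⟩
    obtain ⟨⟨a, ha⟩, rfl⟩ := QuotientGroup.mk_surjective a
    obtain ⟨⟨b, hb⟩, rfl⟩ := QuotientGroup.mk_surjective b
    obtain ⟨φ, hφ, hφu⟩ := exists_mem_BFilt (n := n) ![a, b] (by
      intro i
      fin_cases i
      exacts [ha, hb])
    refine ⟨QuotientGroup.mk ⟨φ, hφ⟩, Prod.ext ?_ ?_⟩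
    · change (QuotientGroup.mk _ : J 2 (n + 2)) = QuotientGroup.mk _
      congr 1
      refine Subtype.ext ?_
      change (gen 2 0)⁻¹ * φ.1 (gen 2 0) = a
      rw [hφu, inv_mul_cancel_left]
      rfl
    · change (QuotientGroup.mk _ : J 2 (n + 2)) = QuotientGroup.mk _
      congr 1
      refine Subtype.ext ?_
      change (gen 2 1)⁻¹ * φ.1 (gen 2 1) = b
      rw [hφu, inv_mul_cancel_left]
      rfl

/-- The embedding `(a, b) ↦ X_1 a - X_0 b` of `ℚ ⊗ J_{n+2} × ℚ ⊗ J_{n+2}`. -/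
def pairMap (n : ℕ) : (ℚ ⊗[ℤ] Additive (J 2 (n + 2))) × (ℚ ⊗[ℤ] Additive (J 2 (n + 2))) →ₗ[ℚ] NC :=
  (LinearMap.mulLeft ℚ (x 1) ∘ₗ iotaQ (n + 1)).coprod (-(LinearMap.mulLeft ℚ (x 0) ∘ₗ iotaQ (n + 1)))

theorem pairMap_apply (n : ℕ) (a b : ℚ ⊗[ℤ] Additive (J 2 (n + 2))) :
    pairMap n (a, b) = x 1 * iotaQ (n + 1) a - x 0 * iotaQ (n + 1) b := by
  simp [pairMap, LinearMap.coprod_apply, sub_eq_add_neg]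

theorem x_mul_sub_x_mul_eq {a b a' b' : NC} (h : x 1 * a - x 0 * b = x 1 * a' - x 0 * b') :
    a = a' ∧ b = b' := by
  constructor
  · refine ext_cf fun l => ?_
    have := congrArg (cf (1 :: l)) h
    simpa [cf_cons_x_mul] using this
  · refine ext_cf fun l => ?_
    have := congrArg (cf (0 :: l)) h
    simpa [cf_cons_x_mul] using this

theorem pairMap_injective (n : ℕ) : Function.Injective (pairMap n) := by
  rintro ⟨a, b⟩ ⟨a', b'⟩ h
  rw [pairMap_apply, pairMap_apply] at h
  obtain ⟨h1, h2⟩ := x_mul_sub_x_mul_eq h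
  exact Prod.ext (iotaQ_injective _ h1) (iotaQ_injective _ h2)

theorem mem_range_pairMap {n : ℕ} {z : NC} : z ∈ LinearMap.range (pairMap n) ↔
    ∃ a ∈ lie (n + 2), ∃ b ∈ lie (n + 2), z = x 1 * a - x 0 * b := by
  rw [← range_iotaQ (n + 1)]
  constructor
  · rintro ⟨⟨a, b⟩, rfl⟩
    exact ⟨_, ⟨a, rfl⟩, _, ⟨b, rfl⟩, pairMap_apply n a b⟩
  · rintro ⟨_, ⟨a, rfl⟩, _, ⟨b, rfl⟩, rfl⟩
    exact ⟨(a, b), pairMap_apply n a b⟩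

/-- The pair (a, b) is transformed with the entries of the adjugate of g: M is V* ⊗ J, and in V* ⊗
det ≅ V the dual basis becomes X_1, −X_0. This explains the sign and the twist by one power of det.
-/
theorem rhoA_pair (g : Matrix (Fin 2) (Fin 2) ℚ) (a b : NC) :
    rhoA g (x 1 * a - x 0 * b) = x 1 * (g 1 1 • rhoA g a - g 1 0 • rhoA g b) -
      x 0 * (g 0 0 • rhoA g b - g 0 1 • rhoA g a) := by
  rw [map_sub, map_mul (rhoA g), map_mul (rhoA g), rhoA_x, rhoA_x, lin, lin, Fin.sum_univ_two,
    Fin.sum_univ_two]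
  simp only [add_mul, mul_sub, smul_mul_assoc, mul_smul_comm]
  abel

theorem range_pairMap_le (n : ℕ) : LinearMap.range (pairMap n) ≤ deg (n + 3) := by
  intro z hz
  obtain ⟨a, ha, b, hb, rfl⟩ := mem_range_pairMap.1 hz
  rw [show n + 3 = 1 + (n + 2) by omega]
  exact sub_mem (mul_mem_deg (x_mem_deg 1) ha.2) (mul_mem_deg (x_mem_deg 0) hb.2)

theorem range_pairMap_stable (n : ℕ) : Stable (LinearMap.range (pairMap n)) := by
  intro g hg z hz
  obtain ⟨a, ha, b, hb, rfl⟩ := mem_range_pairMap.1 hz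
  have ha' := lie_stable _ g hg a ha
  have hb' := lie_stable _ g hg b hb
  rw [rhoA_pair]
  exact mem_range_pairMap.2 ⟨_, sub_mem (Submodule.smul_mem _ _ ha') (Submodule.smul_mem _ _ hb'), _,
    sub_mem (Submodule.smul_mem _ _ hb') (Submodule.smul_mem _ _ ha'), rfl⟩

/-- The isomorphism of `ℚ ⊗ M_{n+1}` with two copies of `ℚ ⊗ J_{n+2}`. -/
def tauEquiv (n : ℕ) : ℚ ⊗[ℤ] Additive (M 2 (n + 1)) ≃ₗ[ℚ]
    (ℚ ⊗[ℤ] Additive (J 2 (n + 2))) × (ℚ ⊗[ℤ] Additive (J 2 (n + 2))) :=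
  (TensorProduct.AlgebraTensorModule.congr (LinearEquiv.refl ℚ ℚ)
    (((MulEquiv.ofBijective _ (tau_bijective n)).toAdditive.trans
      (AddEquiv.prodAdditive _ _)).toIntLinearEquiv)).trans
    (TensorProduct.prodRight ℤ ℚ ℚ _ _)

theorem tauEquiv_mk {n : ℕ} {φ : B 2} (hφ : φ ∈ BFilt 2 (n + 1)) :
    tauEquiv n (1 ⊗ₜ Additive.ofMul (QuotientGroup.mk ⟨φ, hφ⟩)) =
      (jmk (n + 2) _ (tau_mem hφ (gen 2 0)), jmk (n + 2) _ (tau_mem hφ (gen 2 1))) := rfl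

end

section

open NC

/-! ### Equivariance of the components of the automorphism group -/

/-! ### The difference y⁻¹ χ(y) as a homomorphism -/

section Diff

variable {r n : ℕ} {χ : B r}

/-- The homomorphism `y ↦ y⁻¹ χ(y)`. -/
def diffHom (hχ : χ ∈ BFilt r (n + 1)) : Completion r →* J r (n + 2) :=
  MonoidHom.mk' (fun y => QuotientGroup.mk ⟨_, tau_mem hχ y⟩) fun y z => QuotientGroup.eq.2 (by
    rw [Subgroup.mem_subgroupOf]
    have h : ⁅z⁻¹, (y⁻¹ * χ.1 y)⁻¹⁆ ∈ series r (n + 2 + 1) := by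
      rw [add_comm (n + 2)]
      exact commutator_mem_series (mem_series_one _) (inv_mem (tau_mem hχ y))
    have h' := (series_normal r (n + 2 + 1)).conj_mem _ h (z⁻¹ * χ.1 z)⁻¹
    have e : (z⁻¹ * χ.1 z)⁻¹ * ⁅z⁻¹, (y⁻¹ * χ.1 y)⁻¹⁆ * (z⁻¹ * χ.1 z)⁻¹⁻¹ =
        ((y * z)⁻¹ * χ.1 (y * z))⁻¹ * ((y⁻¹ * χ.1 y) * (z⁻¹ * χ.1 z)) := by
      rw [map_mul, commutatorElement_def]; group
    rw [e] at h'
    exact h')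

theorem diffHom_eq_one_iff (hχ : χ ∈ BFilt r (n + 1)) {y : Completion r} :
    diffHom hχ y = 1 ↔ y⁻¹ * χ.1 y ∈ series r (n + 2 + 1) :=
  (QuotientGroup.eq_one_iff _).trans Subgroup.mem_subgroupOf

/-- A homomorphism to an abelian group kills commutators; its kernel is closed, so it contains
`series r 2`. -/
theorem diffHom_congr (hχ : χ ∈ BFilt r (n + 1)) {y z : Completion r}
    (h : (QuotientGroup.mk y : Completion r ⧸ series r 2) = QuotientGroup.mk z) :
    diffHom hχ y = diffHom hχ z := by
  have hle : series r 2 ≤ (diffHom hχ).ker := by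
    refine Subgroup.topologicalClosure_minimal _ ?_ ?_
    · rw [Subgroup.commutator_le]
      intro a _ b _
      rw [MonoidHom.mem_ker, map_commutatorElement, commutatorElement_eq_one_iff_mul_comm]
      exact mul_comm _ _
    · have : ((diffHom hχ).ker : Set (Completion r)) =
          (fun y => y⁻¹ * χ.1 y) ⁻¹' (series r (n + 2 + 1) : Set (Completion r)) :=
        Set.ext fun y => diffHom_eq_one_iff hχ
      rw [this]
      refine (isClosed_series r _).preimage ?_
      have := χ.2.1
      fun_prop
  have h1 := hle (QuotientGroup.eq.1 h)
  rw [MonoidHom.mem_ker, map_mul, map_inv, inv_mul_eq_one] at h1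
  exact h1

end Diff

theorem iotaQ_diffHom {n : ℕ} {χ : B 2} (hχ : χ ∈ BFilt 2 (n + 1)) (y : Completion 2) :
    iotaQ (n + 1) (1 ⊗ₜ Additive.ofMul (diffHom hχ y)) = iota (n + 2) (y⁻¹ * χ.1 y) :=
  iotaQ_jmk (tau_mem hχ y)

/-- Here χ = φψφ⁻¹, and φ(x_j⁻¹ ψ(x_j)) = φ(x_j)⁻¹ χ(φ(x_j)). The latter depends, in J, only on the
class of φ(x_j) in ℤ², given by column j of g. -/
theorem rhoA_iota_tau {n : ℕ} {φ ψ χ : B 2} {g : GL (Fin 2) ℤ} (hφ : Induces 2 φ g)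
    (hψ : ψ ∈ BFilt 2 (n + 1)) (hχ : χ ∈ BFilt 2 (n + 1)) (h : χ * φ = φ * ψ) (j : Fin 2) :
    rhoA (g.1.map (Int.cast : ℤ → ℚ)) (iota (n + 2) ((gen 2 j)⁻¹ * ψ.1 (gen 2 j))) =
      ∑ i, (g.1 i j : ℚ) • iota (n + 2) ((gen 2 i)⁻¹ * χ.1 (gen 2 i)) := by
  have e : (φ.1 (gen 2 j))⁻¹ * χ.1 (φ.1 (gen 2 j)) = φ.1 ((gen 2 j)⁻¹ * ψ.1 (gen 2 j)) := by
    rw [map_mul φ.1, map_inv φ.1]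
    congr 1
    exact DFunLike.congr_fun (congrArg Subtype.val h) (gen 2 j)
  rw [← iota_act hφ (tau_mem hψ _), ← e, ← iotaQ_diffHom hχ, diffHom_congr hχ (hφ j),
    map_prod_gen_zpow (fun y => iotaQ (n + 1) (1 ⊗ₜ Additive.ofMul (diffHom hχ y)))
      fun y z => by rw [map_mul (diffHom hχ), ofMul_mul, TensorProduct.tmul_add, map_add]]
  exact Finset.sum_congr rfl fun i _ => by rw [iotaQ_diffHom, Int.cast_smul_eq_zsmul]

/-- Inserting `rhoA_iota_tau` into `rhoA_pair`, g meets its adjugate and only det g remains, which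
is the twist k = 1. -/
theorem M_models (n : ℕ) :
    (∃ ρ, IsRationalForm (actM 2 (n + 1)) (n + 1) ρ) ∧
      ∀ ρ, IsRationalForm (actM 2 (n + 1)) (n + 1) ρ →
        ∃ M : Model ρ (n + 1 + 2 * 1) 1, LinearMap.range M.j = LinearMap.range (pairMap n) := by
  have hr : LinearMap.range (pairMap n ∘ₗ (tauEquiv n).toLinearMap) = LinearMap.range (pairMap n) :=
    LinearEquiv.range_comp _ _
  have hj : ∀ {ψ : B 2} (hψ : ψ ∈ BFilt 2 (n + 1)),
      (pairMap n ∘ₗ (tauEquiv n).toLinearMap) (1 ⊗ₜ Additive.ofMul (QuotientGroup.mk ⟨ψ, hψ⟩)) =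
        x 1 * iota (n + 2) ((gen 2 0)⁻¹ * ψ.1 (gen 2 0)) -
          x 0 * iota (n + 2) ((gen 2 1)⁻¹ * ψ.1 (gen 2 1)) := by
    intro ψ hψ
    rw [LinearMap.comp_apply, LinearEquiv.coe_coe, tauEquiv_mk, pairMap_apply, iotaQ_jmk, iotaQ_jmk]
  obtain ⟨h1, h2⟩ := rational_form_models (actM 2 (n + 1)) (n := n + 1) (k := 1)
    (j := pairMap n ∘ₗ (tauEquiv n).toLinearMap)
    ((pairMap_injective n).comp (tauEquiv n).injective) (hr ▸ range_pairMap_le n)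
    (hr ▸ range_pairMap_stable n) (fun φ g hφ z => by
      obtain ⟨⟨ψ, hψ⟩, rfl⟩ := QuotientGroup.mk_surjective z
      have hχ := (BFilt_normal 2 (n + 1)).conj_mem ψ hψ φ
      have hR := rhoA_iota_tau hφ hψ hχ (by group)
      refine (congrArg _ (hj hχ)).trans ?_
      rw [hj hψ, rhoA_pair, hR 0, hR 1, Fin.sum_univ_two, Fin.sum_univ_two, pow_one,
        Matrix.det_fin_two]
      simp only [Matrix.map_apply, smul_sub, smul_add, smul_smul, mul_add, mul_sub, mul_smul_comm,
        Int.cast_sub, Int.cast_mul]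
      module) exists_induces_transvection
  refine ⟨h1, fun ρ hρ => ?_⟩
  obtain ⟨M, hM⟩ := h2 ρ hρ
  exact ⟨M, by rw [hM, hr]⟩

/-! ### Weights -/

theorem x_zero_mem_wt : x 0 ∈ wt 1 1 := x_mem_wt 0

theorem x_one_mem_wt : x 1 ∈ wt 1 0 := x_mem_wt 1

theorem mem_range_pairMap_inf_wt {n w : ℕ} {z : NC} :
    z ∈ LinearMap.range (pairMap n) ⊓ wt (n + 3) (w + 1) ↔
      ∃ a ∈ lie (n + 2) ⊓ wt (n + 2) (w + 1), ∃ b ∈ lie (n + 2) ⊓ wt (n + 2) w,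
        z = x 1 * a - x 0 * b := by
  constructor
  · rintro ⟨hz, hw⟩
    obtain ⟨a, ha, b, hb, rfl⟩ := mem_range_pairMap.1 hz
    have h := pr_of_mem hw
    rw [map_sub, pr_mul_of_mem_wt x_one_mem_wt, pr_mul_of_mem_wt x_zero_mem_wt,
      if_pos ⟨by omega, by omega⟩, if_pos ⟨by omega, by omega⟩] at h
    exact ⟨_, ⟨pr_mem_of_stable (lie_le _) (lie_stable _) ha _, pr_mem _ _ _⟩, _,
      ⟨pr_mem_of_stable (lie_le _) (lie_stable _) hb _, pr_mem _ _ _⟩, h.symm⟩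
  · rintro ⟨a, ⟨ha, ha'⟩, b, ⟨hb, hb'⟩, rfl⟩
    refine ⟨mem_range_pairMap.2 ⟨a, ha, b, hb, rfl⟩, sub_mem ?_ ?_⟩
    · have := mul_mem_wt x_one_mem_wt ha'
      rwa [zero_add, add_comm 1] at this
    · have := mul_mem_wt x_zero_mem_wt hb'
      rwa [add_comm 1, add_comm 1] at this

/-- The letter X_0 carries weight 1 and X_1 weight 0, so in X_1 a − X_0 b the element a has weight w
+ 1 and b weight w; both are recovered from the difference. -/
theorem finrank_range_pairMap_inf_wt (n w : ℕ) :
    Module.finrank ℚ ↥(LinearMap.range (pairMap n) ⊓ wt (n + 3) (w + 1)) =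
      Module.finrank ℚ ↥(lie (n + 2) ⊓ wt (n + 2) (w + 1)) +
        Module.finrank ℚ ↥(lie (n + 2) ⊓ wt (n + 2) w) := by
  have hfin : ∀ v, FiniteDimensional ℚ ↥(lie (n + 2) ⊓ wt (n + 2) v) := fun v =>
    Submodule.finiteDimensional_of_le (inf_le_left.trans (lie_le (n + 2)))
  have := hfin w
  have := hfin (w + 1)
  rw [← Module.finrank_prod]
  let L : (↥(lie (n + 2) ⊓ wt (n + 2) (w + 1)) × ↥(lie (n + 2) ⊓ wt (n + 2) w)) →ₗ[ℚ] NC :=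
    (LinearMap.mulLeft ℚ (x 1) ∘ₗ Submodule.subtype _).coprod
      (-(LinearMap.mulLeft ℚ (x 0) ∘ₗ Submodule.subtype _))
  have hL : ∀ p, L p = x 1 * p.1.1 - x 0 * p.2.1 := fun p => by
    simp [L, LinearMap.coprod_apply, sub_eq_add_neg]
  have hinj : Function.Injective L := fun p q h => by
    rw [hL, hL] at h
    obtain ⟨h1, h2⟩ := x_mul_sub_x_mul_eq h
    exact Prod.ext (Subtype.ext h1) (Subtype.ext h2)
  rw [← LinearMap.finrank_range_of_inj hinj]
  congr 2
  all_goals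
    ext z
    rw [mem_range_pairMap_inf_wt]
    constructor
    · rintro ⟨a, ha, b, hb, rfl⟩
      exact ⟨(⟨a, ha⟩, ⟨b, hb⟩), hL _⟩
    · rintro ⟨⟨a, b⟩, rfl⟩
      exact ⟨a.1, a.2, b.1, b.2, hL _⟩

end

section

open NC

/-! ### The values of `θ` -/

/-- Covers the boundary b = 0 of the multiplicity formulas, where the second argument becomes −1. -/
theorem theta_of_neg (a : ℤ) {b : ℤ} (hb : b < 0) : theta a b = 0 := by
  rw [theta, Finset.sum_eq_zero, mul_zero]
  intro d hd
  have hd' := Nat.dvd_of_mem_divisors hd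
  have hpos : (0 : ℤ) < d := by exact_mod_cast Nat.pos_of_mem_divisors hd
  obtain ⟨u, rfl⟩ := (Int.natCast_dvd_natCast.2 hd').trans (Int.gcd_dvd_left a b)
  obtain ⟨v, rfl⟩ := (Int.natCast_dvd_natCast.2 hd').trans (Int.gcd_dvd_right (d * u) b)
  have hv : v < 0 := by nlinarith
  rw [← mul_add, Int.mul_ediv_cancel_left _ hpos.ne', Int.mul_ediv_cancel_left _ hpos.ne', binom,
    if_neg (by omega), mul_zero]

theorem binom_symm (m k : ℤ) : binom m (m - k) = binom m k := by
  by_cases h : 0 ≤ k ∧ k ≤ m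
  · rw [binom, binom, if_pos h, if_pos (by omega), show (m - k).toNat = m.toNat - k.toNat by omega,
      Nat.choose_symm (by omega)]
  · rw [binom, binom, if_neg h, if_neg (by omega)]

theorem theta_comm (a b : ℤ) : theta a b = theta b a := by
  rw [theta, theta, Int.gcd_comm, add_comm]
  congr 1
  refine Finset.sum_congr rfl fun d hd => ?_
  have hd' := Nat.dvd_of_mem_divisors hd
  rw [← binom_symm, add_comm b, Int.add_ediv_of_dvd_left
    ((Int.natCast_dvd_natCast.2 hd').trans (Int.gcd_dvd_right b a)), add_sub_cancel_left]

theorem theta_succ_self (p : ℕ) :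
    theta (p + 1) p = 1 / ((2 * p + 1 : ℕ) : ℚ) * ((2 * p + 1).choose p : ℚ) := by
  have hg : Int.gcd (p + 1) p = 1 := by
    rw [← Int.isCoprime_iff_gcd_eq_one]
    exact ⟨1, -1, by ring⟩
  rw [theta, hg, Nat.divisors_one, Finset.sum_singleton, ArithmeticFunction.moebius_apply_one,
    Nat.cast_one, Int.ediv_one, Int.ediv_one, binom, if_pos (by omega),
    show ((p : ℤ) + 1 + p).toNat = 2 * p + 1 by omega, show ((p : ℤ) + 1).toNat = p + 1 by omega,
    Nat.choose_symm_half]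
  push_cast
  ring

/-- With integral c and d the out-of-range weights a > n are included: there d is negative and both
sides vanish. -/
theorem finrank_lie_inf_wt {n a : ℕ} {c d : ℤ} (hn : n ≠ 0) (hc : c = a) (hd : c + d = n) :
    (Module.finrank ℚ ↥(lie n ⊓ wt n a) : ℚ) = theta c d := by
  subst hc
  by_cases h : a ≤ n
  · obtain ⟨b, rfl⟩ := Nat.exists_eq_add_of_le h
    obtain rfl : d = b := by omega
    rw [lie_inf_wt, finrank_prim_wt hn]
  · rw [wt_eq_bot (by omega), inf_bot_eq, finrank_bot, theta_of_neg _ (by omega), Nat.cast_zero]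

theorem finrank_range_pairMap_inf_wt' {n w : ℕ} {c d c' d' : ℤ} (hc : c = w + 1)
    (hd : c + d = n + 2) (hc' : c' = w) (hd' : c' + d' = n + 2) :
    (Module.finrank ℚ ↥(LinearMap.range (pairMap n) ⊓ wt (n + 3) (w + 1)) : ℚ) =
      theta c d + theta c' d' := by
  rw [finrank_range_pairMap_inf_wt, Nat.cast_add,
    finrank_lie_inf_wt (n + 1).succ_ne_zero (by rw [hc]; rfl) hd,
    finrank_lie_inf_wt (n + 1).succ_ne_zero hc' hd']

end

end PronilpotentFree

end

/-! ### Reading off multiplicities and counts from weight dimensions -/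

open PronilpotentFree TensorProduct in
theorem mainTheorem10 (n : ℕ) [NeZero n] :
    ((∃ ρ, IsRationalForm (actJ 2 n) n ρ) ∧
      ∀ ρ, IsRationalForm (actJ 2 n) n ρ →
        FiniteDimensional ℚ (ℚ ⊗[ℤ] Additive (J 2 n)) ∧
        ρ.IsSemisimpleRepresentation ∧
        (∀ a b : ℕ, b ≤ a → a + b = n →
          (mult ρ a b : ℚ) = theta a b - theta (a + 1) (b - 1)) ∧
        ∃ i : ℕ, irreducibleCount ρ = i ∧
          (Even n → (i : ℚ) = theta (n / 2) (n / 2)) ∧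
          (Odd n → (i : ℚ) = theta ((n + 1) / 2) ((n - 1) / 2) ∧
            theta ((n + 1) / 2) ((n - 1) / 2) = 1 / (n : ℚ) * (n.choose ((n - 1) / 2) : ℚ))) ∧
    ((∃ ρ, IsRationalForm (actM 2 n) n ρ) ∧
      ∀ ρ, IsRationalForm (actM 2 n) n ρ →
        FiniteDimensional ℚ (ℚ ⊗[ℤ] Additive (M 2 n)) ∧
        ρ.IsSemisimpleRepresentation ∧
        (∀ a b : ℕ, b ≤ a → a + b = n →
          (mult ρ a b : ℚ) = theta a (b + 1) - theta (a + 2) (b - 1)) ∧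
        ∃ m : ℕ, irreducibleCount ρ = m ∧
          (Even n → (m : ℚ) = 2 * theta (n / 2 + 1) (n / 2)) ∧
          (Odd n → (m : ℚ) =
            theta ((n + 1) / 2) ((n + 1) / 2) + theta ((n + 3) / 2) ((n - 1) / 2))) := by
  obtain ⟨m, rfl⟩ := Nat.exists_eq_succ_of_ne_zero (NeZero.ne n)
  have hJ := J_models m
  have hM := M_models m
  refine ⟨⟨hJ.1, fun ρ hρ => ?_⟩, hM.1, fun ρ hρ => ?_⟩
  · obtain ⟨N, hN⟩ := hJ.2 ρ hρ
    refine ⟨N.finiteDimensional, N.isSemisimple, fun a b hba hab => ?_, _, N.irreducibleCount_eq,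
      fun ⟨p, hp⟩ => ?_, fun ⟨p, hp⟩ => ?_⟩
    · have h := congrArg (Nat.cast : ℕ → ℚ) (N.mult_eq hba (by omega))
      rw [hN, Nat.cast_add] at h
      rw [eq_sub_iff_add_eq]
      refine Eq.trans (congrArg _ (Eq.symm ?_)) (h.trans ?_)
      · exact finrank_lie_inf_wt m.succ_ne_zero (by push_cast; ring) (by omega)
      · exact finrank_lie_inf_wt m.succ_ne_zero rfl (by omega)
    · rw [hN]
      exact finrank_lie_inf_wt m.succ_ne_zero (by omega) (by omega)
    · refine ⟨?_, ?_⟩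
      · rw [hN]
        exact finrank_lie_inf_wt m.succ_ne_zero (by omega) (by omega)
      · rw [hp, show ((2 * p + 1 : ℕ) + 1 : ℤ) / 2 = p + 1 by omega,
          show ((2 * p + 1 : ℕ) - 1 : ℤ) / 2 = p by omega, show (2 * p + 1 - 1) / 2 = p by omega,
          theta_succ_self]
  · obtain ⟨N, hN⟩ := hM.2 ρ hρ
    refine ⟨N.finiteDimensional, N.isSemisimple, fun a b hba hab => ?_, _, N.irreducibleCount_eq,
      fun ⟨p, hp⟩ => ?_, fun ⟨p, hp⟩ => ?_⟩
    · have h := congrArg (Nat.cast : ℕ → ℚ) (N.mult_eq hba (by omega))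
      rw [hN, Nat.cast_add] at h
      -- The weight spaces a + 2 and a + 1 of the model share the term θ(a + 1, b), which cancels in
      -- the difference.
      have h1 := finrank_range_pairMap_inf_wt' (n := m) (w := a + 1) (c := a + 2) (d := b - 1)
        (c' := a + 1) (d' := b) (by push_cast; ring) (by omega) (by push_cast; ring) (by omega)
      have h2 := finrank_range_pairMap_inf_wt' (n := m) (w := a) (c := a + 1) (d := b)
        (c' := a) (d' := b + 1) rfl (by omega) rfl (by omega)
      have h' := (congrArg _ h1.symm).trans (h.trans h2)
      linarith
    -- The model of M_n has degree n + 2, so for n = 2p the middle weight is p + 1; it receives Lie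
    -- elements of weights p + 1 and p, equally many by symmetry of θ.
    · have h := finrank_range_pairMap_inf_wt' (n := m) (w := p) (c := p + 1) (d := p)
        (c' := p) (d' := p + 1) rfl (by omega) rfl (by omega)
      rw [hN, show (m + 1 + 2 * 1 + 1) / 2 = p + 1 by omega,
        show ((m.succ : ℕ) : ℤ) / 2 = p by omega, two_mul (theta _ _)]
      rw [theta_comm p] at h
      exact h
    -- For n = 2p + 1 the middle weight is p + 2, fed by Lie elements of weights p + 2 and p + 1.
    · have h := finrank_range_pairMap_inf_wt' (n := m) (w := p + 1) (c := p + 2) (d := p)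
        (c' := p + 1) (d' := p + 1) (by push_cast; ring) (by omega) (by push_cast; ring) (by omega)
      rw [hN, show (m + 1 + 2 * 1 + 1) / 2 = p + 1 + 1 by omega,
        show ((m.succ : ℕ) + 1 : ℤ) / 2 = p + 1 by omega,
        show ((m.succ : ℕ) + 3 : ℤ) / 2 = p + 2 by omega,
        show ((m.succ : ℕ) - 1 : ℤ) / 2 = p by omega, add_comm (theta _ _)]
      exact h
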